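/- **Theorem 4.1.** Let $0<a\le 1$, $b=1-a$, and let $F(v)=a\|v\|_2+b\|v\|_4=a(v_1^2+v_2^2)^{1/2}+b(v_1^4+v_2^4)^{1/4}$ be the mixed norm on $\mathbb R^2$. Let $L,\varepsilon>0$ and let $\alpha:(-\varepsilon,\varepsilon)\to\mathbb R$ be a smooth even function with $\alpha(0)=0$. Consider the billiard table with interior $Q=\{(x,y): |y|<\varepsilon,\ \alpha(y)<x<L-\alpha(y)\}$, which is symmetric about the line $x=L/2$; its curved ends are $\gamma_0:t\mapsto(\alpha(t),t)$ and $\gamma_1:t\mapsto(L-\alpha(t),-t)$. Reparametrize both ends by $F$-arc length $s$, with $s=0$ at $t=0$. Let $R(s)$ be the Euclidean radius of curvature of $\gamma_0$ (equivalently of $\gamma_1$) at parameter $s$, i.e. $R(s)=(1+\alpha'(t)^2)^{3/2}/\alpha''(t)$ with $t=t(s)$, and put $R=R(0)$, $R''=\frac{d^2R}{ds^2}(0)$. A phase point is a pair $(x,v)$ of a boundary point $x$ and an $F$-unit vector $v$ pointing into $Q$. The ball leaving $x$ in direction $v$ hits the boundary at a point $x_1$ and is reflected to the direction $v_1$ for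 which $x_1$ is a critical point, along the boundary, of $z\mapsto F(z-x)+F(y_1-z)$, where $y_1\in Q$ lies on the reflected ray. For $x=\gamma_0(s)$ whose ray hits $\gamma_1(s_1)$ use the coordinates $(s,u)$ with $u=\frac{\partial}{\partial s}F(\gamma_1(s_1)-\gamma_0(s))$. Let $\mathcal T:(s,u)\mapsto(s_1,u_1)$ be the one-step billiard map from $\gamma_0$ to $\gamma_1$ followed by the rotation by $\pi$ about $(L/2,0)$, $(x_1,v_1)\mapsto((L,0)-x_1,-v_1)$, which identifies phase points on $\gamma_1$ with phase points on $\gamma_0$. The point $P=(0,0)$ (foot $\gamma_0(0)=(0,0)$, direction $(1,0)$) corresponds to the period-2 orbit between $(0,0)$ and $(L,0)$. A real number $\tau_1$ is called the first twist coefficient at the origin of a planar map $f$ if, near the origin, $f$ is smooth and area-preserving, the origin is an elliptic fixed point ($f(0)=0$, $|\operatorname{tr}D_0f|<2$), and there are a smooth local diffeomorphism $h$ with $h(0)=0$ and $\det Dh\equiv1$ and a $\theta\in\mathbb R$ such that $$h^{-1}\circ f\circ h\begin{pmatrix}x\\y\end{pmatrix}=\begin{pmatrix}\cos\Theta&-\sin\Theta\\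 \sin\Theta&\cos\Theta\end{pmatrix}\begin{pmatrix}x\\y\end{pmatrix}+O\big((x^2+y^2)^{2}\big),\qquad \Theta=\theta+\tau_1(x^2+y^2).$$ Assume that $0<L<2aR$ (the period-2 orbit is elliptic) and $L\ne aR$ (non-resonance). Then the first twist coefficient of $\mathcal T$ at $P$ exists, is unique, and equals $$\tau_1(\mathcal T,P)=\frac{a^2LRR''+(4-3a)aL+2(2a-9)aR+12R}{8a^2R(L-2aR)}.$$ -/

import Mathlib

open Set Filter Topology Asymptotics
open scoped ContDiff

noncomputable section

namespace MinkowskiBilliard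

/-! ### Twist coefficients of symplectic maps of the plane -/

/-- The counterclockwise rotation of the plane by the angle `φ`. -/
def rotate (φ : ℝ) (p : ℝ × ℝ) : ℝ × ℝ :=
  (Real.cos φ * p.1 - Real.sin φ * p.2, Real.sin φ * p.1 + Real.cos φ * p.2)

/-- Near the origin `f` is smooth and preserves the standard area form, the origin is a fixed
point, and it is elliptic: the derivative there has two non-real eigenvalues of modulus one. -/
structure IsEllipticFixedPoint (f : ℝ × ℝ → ℝ × ℝ) : Prop where
  smooth : ContDiffAt ℝ ∞ f 0
  symplectic : ∀ᶠ p in 𝓝 (0 : ℝ × ℝ), (fderiv ℝ f p).det = 1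
  fixed : f 0 = 0
  elliptic : |LinearMap.trace ℝ (ℝ × ℝ) (fderiv ℝ f 0).toLinearMap| < 2

/-- `τ` is the first twist coefficient of `f` at its elliptic fixed point `0`: in suitable smooth
area-preserving coordinates centred at `0`, the map is the rotation by the angle
`θ + τ * (x ^ 2 + y ^ 2)`, up to terms of order at least four. -/
def IsFirstTwistCoefficient (f : ℝ × ℝ → ℝ × ℝ) (τ : ℝ) : Prop :=
  IsEllipticFixedPoint f ∧
  ∃ (h : OpenPartialHomeomorph (ℝ × ℝ) (ℝ × ℝ)) (θ : ℝ),
    (0 : ℝ × ℝ) ∈ h.source ∧ h 0 = 0 ∧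
    ContDiffOn ℝ ∞ h h.source ∧
    (∀ p ∈ h.source, (fderiv ℝ h p).det = 1) ∧
    (fun p : ℝ × ℝ => h.symm (f (h p)) - rotate (θ + τ * (p.1 ^ 2 + p.2 ^ 2)) p)
      =O[𝓝 0] fun p : ℝ × ℝ => ‖p‖ ^ 4

/-! ### The mixed norm and the table -/

/-- The mixed norm `a ‖v‖₂ + b ‖v‖₄` on the plane. -/
def mixedNorm (a b : ℝ) (v : ℝ × ℝ) : ℝ :=
  a * √(v.1 ^ 2 + v.2 ^ 2) + b * (v.1 ^ 4 + v.2 ^ 4) ^ ((1 : ℝ) / 4)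

/-- The interior of the table: it is bounded by the graph `x = α y` on the left, by its mirror
image `x = L - α y` on the right, and by the horizontal lines `y = ± ε`. -/
def table (L ε : ℝ) (α : ℝ → ℝ) : Set (ℝ × ℝ) :=
  {p | |p.2| < ε ∧ α p.2 < p.1 ∧ p.1 < L - α p.2}

/-- The Minkowski arc length of the curve `t ↦ (α t, t)`, measured from the vertex `t = 0`. -/
def arcLength (a b : ℝ) (α : ℝ → ℝ) (t : ℝ) : ℝ :=
  ∫ x in (0 : ℝ)..t, mixedNorm a b (deriv α x, 1)

/-- The range of the arc-length parameter. -/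
def params (a b ε : ℝ) (α : ℝ → ℝ) : Set ℝ :=
  arcLength a b α '' Ioo (-ε) ε

/-- The inverse of the arc length: the height `t` as a function of the arc-length parameter. -/
def height (a b ε : ℝ) (α : ℝ → ℝ) (s : ℝ) : ℝ :=
  Function.invFunOn (arcLength a b α) (Ioo (-ε) ε) s

/-- The left end `(α t, t)` of the table, parametrized by Minkowski arc length. -/
def leftCurve (a b ε : ℝ) (α : ℝ → ℝ) (s : ℝ) : ℝ × ℝ :=
  (α (height a b ε α s), height a b ε α s)

/-- The right end `(L - α t, -t)` of the table, parametrized by Minkowski arc length. -/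
def rightCurve (a b L ε : ℝ) (α : ℝ → ℝ) (s : ℝ) : ℝ × ℝ :=
  (L - α (height a b ε α s), -height a b ε α s)

/-- The (signed) Euclidean radius of curvature of the left end, as a function of the Minkowski
arc-length parameter. It is positive where the table is locally convex. -/
def radius (a b ε : ℝ) (α : ℝ → ℝ) (s : ℝ) : ℝ :=
  (1 + deriv α (height a b ε α s) ^ 2) ^ ((3 : ℝ) / 2) / deriv (deriv α) (height a b ε α s)

/-! ### The billiard -/

/-- The ray from `x` in direction `v` runs inside `Q` until it leaves `Q` at `x'`. In particular
`v` points into `Q` at `x`. -/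
def FirstHit (Q : Set (ℝ × ℝ)) (x v x' : ℝ × ℝ) : Prop :=
  ∃ l : ℝ, 0 < l ∧ x' = x + l • v ∧ x' ∉ Q ∧ ∀ r : ℝ, 0 < r → r < l → x + r • v ∈ Q

/-- The phase point `(x, v)`, with foot on the left end and unit vector `v` pointing into the
table towards the right end, has coordinates `(s, u)`: the foot is the left point with
parameter `s`, and `u = ∂ F(γ₁(s₁) - γ₀(s)) / ∂ s`, where `γ₁(s₁)` is the point that the ray hits.
-/
def HasCoords (a b L ε : ℝ) (α : ℝ → ℝ) (x v : ℝ × ℝ) (p : ℝ × ℝ) : Prop :=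
  p.1 ∈ params a b ε α ∧ x = leftCurve a b ε α p.1 ∧ mixedNorm a b v = 1 ∧
  ∃ s₁ ∈ params a b ε α, FirstHit (table L ε α) x v (rightCurve a b L ε α s₁) ∧
    HasDerivAt (fun σ : ℝ => mixedNorm a b (rightCurve a b L ε α s₁ - leftCurve a b ε α σ))
      p.2 p.1

/-- The billiard ball that leaves the left end at `x` in direction `v` hits the right end at `x₁`
and is reflected to the direction `v₁`. The reflection law: for a point `y₁` of the table on the
reflected ray, `x₁` is a critical point of the distance `F(z - x) + F(y₁ - z)` among the points
`z` of the right end. -/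
def Step (a b L ε : ℝ) (α : ℝ → ℝ) (x v x₁ v₁ : ℝ × ℝ) : Prop :=
  FirstHit (table L ε α) x v x₁ ∧ mixedNorm a b v₁ = 1 ∧
  ∃ s₁ ∈ params a b ε α, x₁ = rightCurve a b L ε α s₁ ∧
  ∃ r : ℝ, 0 < r ∧ (∀ r' : ℝ, 0 < r' → r' ≤ r → x₁ + r' • v₁ ∈ table L ε α) ∧
    HasDerivAt
      (fun σ : ℝ => mixedNorm a b (rightCurve a b L ε α σ - x) +
        mixedNorm a b (x₁ + r • v₁ - rightCurve a b L ε α σ)) 0 s₁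

/-- The rotation of the plane by `π` about the centre `(L / 2, 0)` of the table. On vectors it
acts as `v ↦ -v`. -/
def halfTurn (L : ℝ) (x : ℝ × ℝ) : ℝ × ℝ := (L - x.1, -x.2)

/-- The one-step billiard map from the left end to the right end, followed by the half turn that
brings the phase points on the right end back to the left end, in the coordinates `(s, u)`. -/
def ReducedStep (a b L ε : ℝ) (α : ℝ → ℝ) (p q : ℝ × ℝ) : Prop :=
  ∃ x v x₁ v₁ : ℝ × ℝ, HasCoords a b L ε α x v p ∧ Step a b L ε α x v x₁ v₁ ∧
    HasCoords a b L ε α (halfTurn L x₁) (-v₁) q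

/-- The symmetry-reduced one-step billiard map `(s, u) ↦ (s₁, u₁)`; its values are arbitrary
where the billiard step is not defined. -/
def billiardMap (a b L ε : ℝ) (α : ℝ → ℝ) (p : ℝ × ℝ) : ℝ × ℝ :=
  Classical.epsilon fun q => ReducedStep a b L ε α p q

end MinkowskiBilliard

end

noncomputable section

namespace MinkowskiBilliard

/-! ### Linear maps of the plane -/

/-! The length of a chord is a generating function. Let `H(s, s₁)` be the `F`-length of the chord
from the left point with parameter `s` to the right point with parameter `s₁`. The half turn
symmetry makes `H` symmetric, and the reflection law says that the reduced map is given by `u =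
∂H/∂s`, `u₁ = -∂H/∂s₁`. Evenness of the profile removes the odd terms, so up to order four `H` is a
constant plus `A/2 (s² + s₁²) + B s s₁ + κ (s⁴ + s₁⁴) + m₁ (s³ s₁ + s s₁³) + m₂ s² s₁²`. Here `A =
a/L - k` and `B = a/L`, with `k = α''(0) = 1/R`. The linear part has trace `-2A/B`: it is elliptic
iff `|A| < B`, and it has no resonance of order four iff `A ≠ 0`.

The twist coefficient of such a map (`isFirstTwistCoefficient_of_jet`) comes from averaging. A
diagonal scaling makes the linear part the rotation by `θ` with `cos θ = -A/B`. On the circle of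
radius `r`, with `x = r cos φ` and `x₁ = r cos (φ + θ)`, the quartic part of `H` has only the
harmonics `1`, `cos (2φ + θ)`, `cos (4φ + 2θ)`. The last two are coboundaries of `Im z²` and `Im
z⁴`, with divisors `sin θ` and `sin 2θ`, so a symplectic change of coordinates tangent to the
identity removes them (`homological_equation`, `exists_symplectomorphism`). The mean, `3κ/4 + 3 m₁
cos θ / 4 + m₂ (1 + 2 cos² θ)/8` times `r⁴`, survives, and `τ` is `-4` times its coefficient, up to
the factor `1/(B² - A²)` from the scaling.

Uniqueness (`IsFirstTwistCoefficient.unique`): a transition map `k` between two normal forms is a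
rotation to first order. Comparing the first Fourier coefficients of both sides of the conjugacy on
a circle of radius `r` shows that the two phases `θ + τ r²` agree modulo `2π` up to `o(r²)`, so the
two `τ` coincide (`twist_eq_of_conj`).

The geometric work is to identify `billiardMap`, defined by a choice among billiard steps, with a
smooth map. The heights `(t, t₁)` of the ends of a chord serve as coordinates: `chordMap` and
`reflectedChordMap` send them to the phase points before and after the step. Both pull the area form
back to the same density, because that density is symmetric in the two ends; hence their quotient
preserves area. Existence of the step uses convexity of the table near the vertices
(`exists_firstHit`). Its uniqueness uses that a small momentum forces a nearly horizontal direction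
(`slope_small`), and that the direction is then determined by the momentum (`tangential_injective`).
What remains is the jet of the momentum of a chord (`chordMomentum_jet`), of arc length
(`arcLength_jet`) and of the radius of curvature (`iteratedDeriv_radius`). -/

theorem det_prod_clm (A : ℝ × ℝ →L[ℝ] ℝ × ℝ) :
    A.det = (A (1, 0)).1 * (A (0, 1)).2 - (A (0, 1)).1 * (A (1, 0)).2 := by
  rw [ContinuousLinearMap.det, ← LinearMap.det_toMatrix (Module.Basis.finTwoProd ℝ),
    Matrix.det_fin_two]
  simp [LinearMap.toMatrix_apply]

theorem trace_prod_clm (A : ℝ × ℝ →L[ℝ] ℝ × ℝ) :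
    LinearMap.trace ℝ (ℝ × ℝ) A.toLinearMap = (A (1, 0)).1 + (A (0, 1)).2 := by
  rw [LinearMap.trace_eq_matrix_trace ℝ (Module.Basis.finTwoProd ℝ), Matrix.trace_fin_two]
  simp [LinearMap.toMatrix_apply]

/-- The linear map of the plane with rows `(p, q)` and `(r, s)`. -/
def planeMap (p q r s : ℝ) : ℝ × ℝ →L[ℝ] ℝ × ℝ :=
  (p • ContinuousLinearMap.fst ℝ ℝ ℝ + q • ContinuousLinearMap.snd ℝ ℝ ℝ).prod
    (r • ContinuousLinearMap.fst ℝ ℝ ℝ + s • ContinuousLinearMap.snd ℝ ℝ ℝ)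

@[simp] theorem planeMap_apply (p q r s : ℝ) (z : ℝ × ℝ) :
    planeMap p q r s z = (p * z.1 + q * z.2, r * z.1 + s * z.2) := by
  simp [planeMap]

theorem det_planeMap (p q r s : ℝ) : (planeMap p q r s).det = p * s - q * r := by
  simp [det_prod_clm]

theorem det_clm_comp (A B : ℝ × ℝ →L[ℝ] ℝ × ℝ) : (A.comp B).det = A.det * B.det := by
  simp [ContinuousLinearMap.det]

theorem eq_planeMap (A : ℝ × ℝ →L[ℝ] ℝ × ℝ) :
    A = planeMap (A (1, 0)).1 (A (0, 1)).1 (A (1, 0)).2 (A (0, 1)).2 := by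
  ext <;> simp

/-! ### Rotations with amplitude dependent angle -/

/-- The twist map `p ↦ rotate (θ + τ |p|²) p`. -/
def twist (θ τ : ℝ) (p : ℝ × ℝ) : ℝ × ℝ := rotate (θ + τ * (p.1 ^ 2 + p.2 ^ 2)) p

theorem twist_zero (θ τ : ℝ) : twist θ τ 0 = 0 := by simp [twist, rotate]

theorem contDiff_twist (θ τ : ℝ) : ContDiff ℝ ∞ (twist θ τ) := by
  unfold twist rotate
  fun_prop

theorem hasFDerivAt_twist (θ τ : ℝ) :
    HasFDerivAt (twist θ τ)
      (planeMap (Real.cos θ) (-Real.sin θ) (Real.sin θ) (Real.cos θ)) 0 := by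
  have hd : DifferentiableAt ℝ (twist θ τ) 0 :=
    (contDiff_twist θ τ).differentiable (by simp) 0
  -- Differentiability is known, so derivatives along lines suffice. The phase is quadratic, hence
  -- stationary at the origin, and only the rotation by `θ` remains.
  have key : ∀ w : ℝ × ℝ, HasDerivAt (fun t : ℝ => twist θ τ (t • w)) (rotate θ w) 0 := by
    intro w
    have h1 : HasDerivAt (fun t : ℝ => θ + τ * ((t * w.1) ^ 2 + (t * w.2) ^ 2)) 0 0 := by
      have := (((((hasDerivAt_id (0 : ℝ)).mul_const w.1).pow 2).add
        (((hasDerivAt_id (0 : ℝ)).mul_const w.2).pow 2)).const_mul τ).const_add θ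
      simpa using this
    have hw1 := (hasDerivAt_id (0 : ℝ)).mul_const w.1
    have hw2 := (hasDerivAt_id (0 : ℝ)).mul_const w.2
    have h2 := (h1.cos.mul hw1).sub (h1.sin.mul hw2)
    have h3 := (h1.sin.mul hw1).add (h1.cos.mul hw2)
    have := h2.prodMk h3
    simpa [twist, rotate] using this
  have hcomp : ∀ w : ℝ × ℝ, fderiv ℝ (twist θ τ) 0 w = rotate θ w := by
    intro w
    have h1 : HasDerivAt (fun t : ℝ => t • w) w 0 := by
      simpa using (hasDerivAt_id (0 : ℝ)).smul_const w
    have h2 : HasFDerivAt (twist θ τ) (fderiv ℝ (twist θ τ) 0) ((0 : ℝ) • w) := by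
      simpa using hd.hasFDerivAt
    have h3 : HasDerivAt (fun t : ℝ => twist θ τ (t • w)) (fderiv ℝ (twist θ τ) 0 w) 0 :=
      HasFDerivAt.comp_hasDerivAt (f := fun t : ℝ => t • w) (0 : ℝ) h2 h1
    exact h3.unique (key w)
  have : fderiv ℝ (twist θ τ) 0 =
      planeMap (Real.cos θ) (-Real.sin θ) (Real.sin θ) (Real.cos θ) := by
    rw [eq_planeMap (fderiv ℝ (twist θ τ) 0)]
    simp [hcomp, rotate]
  rw [← this]
  exact hd.hasFDerivAt

/-! ### Asymptotics -/

theorem hasFDerivAt_zero_of_isBigO {g : ℝ × ℝ → ℝ × ℝ} {n : ℕ} (hn : 1 < n)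
    (h : g =O[𝓝 0] fun p : ℝ × ℝ => ‖p‖ ^ n) : HasFDerivAt g (0 : ℝ × ℝ →L[ℝ] ℝ × ℝ) 0 := by
  have hg0 : g 0 = 0 := by
    obtain ⟨C, hC⟩ := h.bound
    have := hC.self_of_nhds
    simpa [show n ≠ 0 by omega] using this
  rw [hasFDerivAt_iff_isLittleO_nhds_zero]
  simp only [zero_add, hg0, sub_zero, zero_apply]
  exact h.trans_isLittleO (isLittleO_norm_pow_id hn)

/-- A smooth map is Lipschitz near `p`, so it may be applied to both sides of a congruence modulo a
given order. -/
theorem isBigO_comp_sub {k u v : ℝ × ℝ → ℝ × ℝ} {l : Filter (ℝ × ℝ)} {p : ℝ × ℝ}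
    (hk : ContDiffAt ℝ ∞ k p) (hu : Tendsto u l (𝓝 p)) (hv : Tendsto v l (𝓝 p)) :
    (fun z => k (u z) - k (v z)) =O[l] fun z => u z - v z :=
  ((hk.hasStrictFDerivAt (by simp)).isBigO_sub).comp_tendsto (hu.prodMk_nhds hv)

/-- An open partial homeomorphism which is smooth and area preserving has a smooth inverse. -/
theorem contDiffAt_symm_of_det {h : OpenPartialHomeomorph (ℝ × ℝ) (ℝ × ℝ)}
    (hs : ContDiffOn ℝ ∞ h h.source) (hd : ∀ p ∈ h.source, (fderiv ℝ h p).det = 1)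
    {p : ℝ × ℝ} (hp : p ∈ h.target) : ContDiffAt ℝ ∞ h.symm p := by
  have hmem := h.map_target hp
  have hc : ContDiffAt ℝ ∞ h (h.symm p) := hs.contDiffAt (h.open_source.mem_nhds hmem)
  have hne : (fderiv ℝ h (h.symm p)).det ≠ 0 := by rw [hd _ hmem]; exact one_ne_zero
  refine h.contDiffAt_symm (f₀' := (fderiv ℝ h (h.symm p)).toContinuousLinearEquivOfDetNeZero hne)
    hp ?_ hc
  simpa using (hc.differentiableAt (by simp)).hasFDerivAt

/-- A linear map of determinant one that conjugates two rotations, the first of which is neither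
the identity nor the half turn, is a rotation. -/
theorem rotation_of_conj {c s c' s' p q r t : ℝ} (h : c ^ 2 + s ^ 2 = 1) (h' : c' ^ 2 + s' ^ 2 = 1)
    (hs : s ≠ 0) (hdet : p * t - q * r = 1)
    (hconj : (planeMap c (-s) s c).comp (planeMap p q r t) =
      (planeMap p q r t).comp (planeMap c' (-s') s' c')) : t = p ∧ q = -r := by
  have h1 := DFunLike.congr_fun hconj (1, 0)
  have h2 := DFunLike.congr_fun hconj (0, 1)
  simp only [ContinuousLinearMap.comp_apply, planeMap_apply, Prod.mk.injEq, mul_one, mul_zero,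
    add_zero, zero_add] at h1 h2
  obtain ⟨e1, e2⟩ := h1
  obtain ⟨e3, e4⟩ := h2
  -- Traces of conjugate matrices agree; the combination expands the trace of the adjugate of the
  -- conjugating matrix times the relation.
  have hc : c' = c := by
    have : 2 * c = 2 * c' := by
      linear_combination (t * e1 - q * e2 + p * e4 - r * e3) + (2 * c' - 2 * c) * hdet
    linarith
  subst hc
  have hss : (s' - s) * (s' + s) = 0 := by linear_combination h' - h
  rcases mul_eq_zero.mp hss with hs' | hs'
  · have : s' = s := by linarith
    subst this
    constructor
    · apply mul_left_cancel₀ hs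
      linarith
    · apply mul_left_cancel₀ hs
      linarith
  -- With opposite sines the conjugating matrix is a multiple of a reflection, and its determinant
  -- `-(t² + r²)` cannot be one.
  · exfalso
    have : s' = -s := by linarith
    subst this
    have e5 : r = q := by
      apply mul_left_cancel₀ hs
      linarith
    have e6 : p = -t := by
      apply mul_left_cancel₀ hs
      linarith
    subst e5
    subst e6
    nlinarith [sq_nonneg t, sq_nonneg r]

/-! ### Uniqueness of the twist coefficient -/

/-- The identification of the plane with `ℂ`. -/
def toC (p : ℝ × ℝ) : ℂ := ⟨p.1, p.2⟩

theorem toC_sub (p q : ℝ × ℝ) : toC (p - q) = toC p - toC q := by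
  apply Complex.ext <;> simp [toC]

theorem continuous_toC : Continuous toC := by
  have : toC = fun p : ℝ × ℝ => (p.1 : ℂ) + p.2 * Complex.I := by
    ext p
    apply Complex.ext <;> simp [toC]
  rw [this]
  fun_prop

theorem norm_toC_le (p : ℝ × ℝ) : ‖toC p‖ ≤ 2 * ‖p‖ := by
  have h1 : ‖toC p‖ ≤ |(toC p).re| + |(toC p).im| := Complex.norm_le_abs_re_add_abs_im _
  have h2 : |(toC p).re| ≤ ‖p‖ := norm_fst_le p
  have h3 : |(toC p).im| ≤ ‖p‖ := norm_snd_le p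
  linarith

theorem toC_rotate (φ : ℝ) (p : ℝ × ℝ) :
    toC (rotate φ p) = Complex.exp (φ * Complex.I) * toC p := by
  rw [Complex.exp_mul_I, ← Complex.ofReal_cos, ← Complex.ofReal_sin]
  apply Complex.ext <;> simp [toC, rotate, Complex.cos_ofReal_re, Complex.sin_ofReal_re]
  ring

/-- The circle of radius `r`. -/
def circ (r φ : ℝ) : ℝ × ℝ := (r * Real.cos φ, r * Real.sin φ)

theorem norm_circ_le {r : ℝ} (hr : 0 ≤ r) (φ : ℝ) : ‖circ r φ‖ ≤ r := by
  refine norm_prod_le_iff.mpr ⟨?_, ?_⟩ <;>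
    simp only [circ, norm_mul, Real.norm_eq_abs, abs_of_nonneg hr]
  · exact mul_le_of_le_one_right hr (Real.abs_cos_le_one φ)
  · exact mul_le_of_le_one_right hr (Real.abs_sin_le_one φ)

theorem toC_circ (r φ : ℝ) : toC (circ r φ) = r * Complex.exp (φ * Complex.I) := by
  rw [Complex.exp_mul_I, ← Complex.ofReal_cos, ← Complex.ofReal_sin]
  apply Complex.ext <;> simp [toC, circ, Complex.cos_ofReal_re, Complex.sin_ofReal_re]

theorem circ_sq (r φ : ℝ) : (circ r φ).1 ^ 2 + (circ r φ).2 ^ 2 = r ^ 2 := by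
  simp only [circ]
  linear_combination r ^ 2 * Real.cos_sq_add_sin_sq φ

theorem rotate_circ (r φ ψ : ℝ) : rotate ψ (circ r φ) = circ r (φ + ψ) := by
  simp only [rotate, circ, Real.cos_add, Real.sin_add]
  ext <;> simp <;> ring

/-- The first Fourier coefficient of `k` over the circle of radius `r`. -/
def fourierOne (k : ℝ × ℝ → ℝ × ℝ) (r : ℝ) : ℂ :=
  ∫ φ in (0 : ℝ)..(2 * Real.pi), Complex.exp (-(φ * Complex.I)) * toC (k (circ r φ))

/-- Translate the angle by `ψ`, and use periodicity to restore the interval of integration. -/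
theorem fourierOne_rotate (k : ℝ × ℝ → ℝ × ℝ) (r ψ : ℝ) :
    fourierOne (fun p => k (rotate ψ p)) r = Complex.exp (ψ * Complex.I) * fourierOne k r := by
  unfold fourierOne
  rw [← intervalIntegral.integral_const_mul]
  set G : ℝ → ℂ := fun φ => Complex.exp (ψ * Complex.I) *
    (Complex.exp (-(φ * Complex.I)) * toC (k (circ r φ))) with hG
  have hper : Function.Periodic G (2 * Real.pi) := by
    intro φ
    have h1 : circ r (φ + 2 * Real.pi) = circ r φ := by simp [circ]
    have h2 : Complex.exp (-(((φ + 2 * Real.pi : ℝ) : ℂ) * Complex.I)) =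
        Complex.exp (-(φ * Complex.I)) := by
      rw [Complex.exp_eq_exp_iff_exists_int]
      exact ⟨-1, by push_cast; ring⟩
    simp only [hG, h1, h2]
  have h1 : ∀ φ : ℝ, Complex.exp (-(φ * Complex.I)) * toC (k (rotate ψ (circ r φ))) =
      G (φ + ψ) := by
    intro φ
    simp only [hG, rotate_circ, ← mul_assoc, ← Complex.exp_add]
    congr 2
    push_cast
    ring
  simp only [h1]
  rw [intervalIntegral.integral_comp_add_right]
  have := hper.intervalIntegral_add_eq ψ 0
  rw [zero_add] at this
  rw [zero_add, add_comm, this]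

/-- A chord of the unit circle is no longer than its arc. -/
theorem norm_exp_real_mul_I_sub (x y : ℝ) :
    ‖Complex.exp (x * Complex.I) - Complex.exp (y * Complex.I)‖ ≤ |x - y| := by
  have h : Complex.exp (x * Complex.I) - Complex.exp (y * Complex.I) =
      Complex.exp (y * Complex.I) * (Complex.exp (Complex.I * ((x - y : ℝ) : ℂ)) - 1) := by
    rw [mul_sub, ← Complex.exp_add, mul_one]
    congr 2
    push_cast
    ring
  rw [h, norm_mul, Complex.norm_exp_ofReal_mul_I, one_mul]
  exact Real.norm_exp_I_mul_ofReal_sub_one_le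

/-- A phase `d₀ + d x` which is a multiple of `2π` up to `o(x)` has `d = 0`. -/
theorem eq_zero_of_exp_close {d₀ d : ℝ}
    (h : ∀ η > 0, ∃ δ > 0, ∀ x : ℝ, 0 < x → x < δ →
      ‖Complex.exp ((d₀ + d * x : ℝ) * Complex.I) - 1‖ ≤ η * x) : d = 0 := by
  have hcont : Tendsto (fun x : ℝ => ‖Complex.exp ((d₀ + d * x : ℝ) * Complex.I) - 1‖) (𝓝[>] 0)
      (𝓝 ‖Complex.exp ((d₀ + d * (0 : ℝ) : ℝ) * Complex.I) - 1‖) := by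
    apply tendsto_nhdsWithin_of_tendsto_nhds
    apply Continuous.tendsto
    fun_prop
  -- Letting `x → 0` with `η = 1` shows that `d₀` is a multiple of `2π`, so it disappears from the
  -- exponential.
  have h0 : Complex.exp ((d₀ : ℝ) * Complex.I) = 1 := by
    have hle : ‖Complex.exp ((d₀ + d * (0 : ℝ) : ℝ) * Complex.I) - 1‖ ≤ 0 := by
      have hlim : Tendsto (fun x : ℝ => 1 * x) (𝓝[>] 0) (𝓝 0) := by
        apply tendsto_nhdsWithin_of_tendsto_nhds
        have : Continuous fun x : ℝ => 1 * x := by fun_prop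
        simpa using this.tendsto 0
      refine le_of_tendsto_of_tendsto hcont hlim ?_
      obtain ⟨δ, hδ, hx⟩ := h 1 one_pos
      filter_upwards [Ioo_mem_nhdsGT hδ] with x hx'
      exact hx x hx'.1 hx'.2
    simpa [sub_eq_zero] using hle
  have hder : HasDerivAt (fun x : ℝ => Complex.exp (((d * x : ℝ) : ℂ) * Complex.I))
      ((d : ℂ) * Complex.I) 0 := by
    have h1 : HasDerivAt (fun x : ℝ => ((d * x : ℝ) : ℂ)) (d : ℂ) 0 := by
      have : HasDerivAt (fun x : ℝ => d * x) d 0 := by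
        simpa using (hasDerivAt_id (0 : ℝ)).const_mul d
      exact this.ofReal_comp
    simpa using (h1.mul_const Complex.I).cexp
  have hslope := (hasDerivAt_iff_tendsto_slope.mp hder).norm
  have hslope' : Tendsto (fun x : ℝ => ‖slope
      (fun x : ℝ => Complex.exp (((d * x : ℝ) : ℂ) * Complex.I)) 0 x‖) (𝓝[>] 0)
      (𝓝 ‖(d : ℂ) * Complex.I‖) :=
    hslope.mono_left (nhdsWithin_mono _ fun x hx => ne_of_gt hx)
  -- What is left is the modulus of a difference quotient of `x ↦ exp (i d x)` at zero, which tends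
  -- to `|d|`.
  have hle : ∀ η > 0, |d| ≤ 0 + η := by
    intro η hη
    obtain ⟨δ, hδ, hx⟩ := h η hη
    have : ‖(d : ℂ) * Complex.I‖ ≤ η := by
      refine le_of_tendsto hslope' ?_
      filter_upwards [Ioo_mem_nhdsGT hδ] with x hx'
      have h2 := hx x hx'.1 hx'.2
      have h3 : Complex.exp ((d₀ + d * x : ℝ) * Complex.I) =
          Complex.exp (((d * x : ℝ) : ℂ) * Complex.I) := by
        push_cast
        rw [add_mul, Complex.exp_add, h0, one_mul]
      rw [h3] at h2
      rw [slope_def_module, norm_smul]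
      simp only [sub_zero, mul_zero, Complex.ofReal_zero, zero_mul, Complex.exp_zero]
      rw [norm_inv, Real.norm_eq_abs, abs_of_pos hx'.1, inv_mul_le_iff₀ hx'.1]
      linarith [mul_comm η x]
    simpa using this
  exact abs_eq_zero.mp (le_antisymm (le_of_forall_pos_le_add hle) (abs_nonneg d))

/-- The phase on the left can be evaluated at `z` instead of `k z`: the derivative of `k` is an
isometry, so `|k z|² - |z|² = o(|z|²)`, and the phase multiplies a factor of size `|z|`. After this
the phase is constant on circles. -/
theorem isLittleO_phase {k : ℝ × ℝ → ℝ × ℝ} {θ₀ τ₀ θ τ p q : ℝ} (hk0 : k 0 = 0)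
    (hpq : p ^ 2 + q ^ 2 = 1) (hD : HasFDerivAt k (planeMap p (-q) q p) 0)
    (h : (fun z => twist θ₀ τ₀ (k z) - k (twist θ τ z)) =O[𝓝 0] fun z : ℝ × ℝ => ‖z‖ ^ 4) :
    (fun z : ℝ × ℝ => Complex.exp ((θ₀ + τ₀ * (z.1 ^ 2 + z.2 ^ 2) : ℝ) * Complex.I) * toC (k z) -
      toC (k (twist θ τ z))) =o[𝓝 0] fun z : ℝ × ℝ => ‖z‖ ^ 3 := by
  have hlin : (fun z => k z - planeMap p (-q) q p z) =o[𝓝 0] fun z : ℝ × ℝ => z := by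
    have := hasFDerivAt_iff_isLittleO_nhds_zero.mp hD
    simpa [hk0] using this
  have hkO : k =O[𝓝 0] fun z : ℝ × ℝ => z := by
    have := hD.isBigO_sub
    simpa [hk0] using this
  have hDO : (planeMap p (-q) q p) =O[𝓝 0] fun z : ℝ × ℝ => z :=
    (planeMap p (-q) q p).isBigO_id _
  have hsum := hkO.add hDO
  have hfst : ∀ {u : ℝ × ℝ → ℝ × ℝ}, (fun z => (u z).1) =O[𝓝 (0 : ℝ × ℝ)] u := isBigO_fst_prod
  have hsnd : ∀ {u : ℝ × ℝ → ℝ × ℝ}, (fun z => (u z).2) =O[𝓝 (0 : ℝ × ℝ)] u := isBigO_snd_prod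
  -- With `D` the derivative of `k`, `|D z|² = |z|²`, and each coordinate contributes a difference
  -- of squares: `(k z - D z)` is `o(|z|)` and `(k z + D z)` is `O(|z|)`.
  have hsq : (fun z : ℝ × ℝ => z.1 ^ 2 + z.2 ^ 2 - ((k z).1 ^ 2 + (k z).2 ^ 2)) =o[𝓝 0]
      fun z : ℝ × ℝ => ‖z‖ * ‖z‖ := by
    have h1 := (hfst.trans_isLittleO hlin).norm_right.mul_isBigO (hfst.trans hsum).norm_right
    have h2 := (hsnd.trans_isLittleO hlin).norm_right.mul_isBigO (hsnd.trans hsum).norm_right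
    refine (h1.add h2).neg_left.congr_left fun z => ?_
    simp only [planeMap_apply, Prod.fst_sub, Prod.snd_sub, Prod.fst_add, Prod.snd_add]
    linear_combination (z.1 ^ 2 + z.2 ^ 2) * hpq
  have hexp : (fun z : ℝ × ℝ =>
      Complex.exp ((θ₀ + τ₀ * (z.1 ^ 2 + z.2 ^ 2) : ℝ) * Complex.I) -
      Complex.exp ((θ₀ + τ₀ * ((k z).1 ^ 2 + (k z).2 ^ 2) : ℝ) * Complex.I)) =o[𝓝 0]
      fun z : ℝ × ℝ => ‖z‖ * ‖z‖ := by
    refine IsBigO.trans_isLittleO (.of_bound |τ₀| (.of_forall fun z => ?_)) hsq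
    refine (norm_exp_real_mul_I_sub _ _).trans (le_of_eq ?_)
    rw [Real.norm_eq_abs, ← abs_mul]
    congr 1
    ring
  have htoC : ∀ {u : ℝ × ℝ → ℝ × ℝ}, (fun z => toC (u z)) =O[𝓝 (0 : ℝ × ℝ)] u :=
    .of_bound 2 (.of_forall fun z => norm_toC_le _)
  have h1 := hexp.mul_isBigO ((htoC (u := k)).trans hkO).norm_right
  have h2 : (fun z => toC (twist θ₀ τ₀ (k z) - k (twist θ τ z))) =o[𝓝 0]
      fun z : ℝ × ℝ => ‖z‖ ^ 3 :=
    (htoC.trans h).trans_isLittleO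
      ((isLittleO_pow_pow (by norm_num : 3 < 4)).comp_tendsto tendsto_norm_zero)
  refine ((h1.congr_right fun z => ?_).add h2).congr_left fun z => ?_
  · ring
  · rw [toC_sub]
    simp only [twist, toC_rotate]
    ring

/-- A smooth map whose derivative at the origin is a rotation can conjugate two twist maps, up to
terms of order four, only if their twist coefficients agree. -/
theorem twist_eq_of_conj {k : ℝ × ℝ → ℝ × ℝ} {θ₀ τ₀ θ τ p q : ℝ} (hk : ContDiffAt ℝ ∞ k 0)
    (hk0 : k 0 = 0) (hpq : p ^ 2 + q ^ 2 = 1) (hD : HasFDerivAt k (planeMap p (-q) q p) 0)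
    (h : (fun z => twist θ₀ τ₀ (k z) - k (twist θ τ z)) =O[𝓝 0] fun z : ℝ × ℝ => ‖z‖ ^ 4) :
    τ₀ = τ := by
  have hF := isLittleO_phase hk0 hpq hD h
  have hlin : (fun z => toC (k z) - (⟨p, q⟩ : ℂ) * toC z) =o[𝓝 0] fun z : ℝ × ℝ => z := by
    have h1 := hasFDerivAt_iff_isLittleO_nhds_zero.mp hD
    have h2 : (fun z => k z - planeMap p (-q) q p z) =o[𝓝 0] fun z : ℝ × ℝ => z := by
      simpa [hk0] using h1
    refine IsBigO.trans_isLittleO (.of_bound 2 (.of_forall fun z => ?_)) h2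
    refine le_trans (le_of_eq ?_) (norm_toC_le _)
    congr 1
    rw [toC_sub]
    congr 1
    apply Complex.ext <;> simp [toC] <;> ring
  have hA : ‖(⟨p, q⟩ : ℂ)‖ = 1 := by
    rw [Complex.norm_eq_sqrt_sq_add_sq, hpq, Real.sqrt_one]
  have hcont : ∀ᶠ z in 𝓝 (0 : ℝ × ℝ), ContinuousAt k z :=
    ((hk.of_le (m := 1) (by simp)).eventually (by simp)).mono fun z hz => hz.continuousAt
  -- This is used with `x = r²`. The relative error `1/2` in the linear part keeps the Fourier
  -- coefficient at least `π r`, and the bound `η/2` on the remainder integrates to `η π r³`; the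
  -- quotient is `η r²`.
  refine sub_eq_zero.mp (eq_zero_of_exp_close (d₀ := θ₀ - θ) fun η hη => ?_)
  obtain ⟨δ, hδ, hball⟩ := Metric.eventually_nhds_iff.mp
    ((hF.bound (half_pos hη)).and ((hlin.bound one_half_pos).and hcont))
  refine ⟨δ ^ 2, by positivity, fun x hx hxδ => ?_⟩
  set r := √x with hr
  have hr0 : 0 < r := Real.sqrt_pos.mpr hx
  have hrx : r ^ 2 = x := Real.sq_sqrt hx.le
  have hrδ : r < δ := (Real.sqrt_lt' hδ).mpr hxδ
  have hin : ∀ φ, dist (circ r φ) 0 < δ := fun φ => by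
    rw [dist_zero_right]
    exact (norm_circ_le hr0.le φ).trans_lt hrδ
  have hcirc : Continuous (circ r) := by unfold circ; fun_prop
  have hkc : Continuous fun φ => toC (k (circ r φ)) := by
    refine continuous_toC.comp (continuous_iff_continuousAt.mpr fun φ => ?_)
    exact ContinuousAt.comp (g := k) (hball (hin φ)).2.2 hcirc.continuousAt
  have hrot : Continuous fun φ => toC (k (rotate (θ + τ * r ^ 2) (circ r φ))) := by
    simp only [rotate_circ]
    exact hkc.comp (continuous_id.add continuous_const)
  have hexpc : Continuous fun φ : ℝ => Complex.exp (-(φ * Complex.I)) := by fun_prop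
  have hkI : IntervalIntegrable (fun φ : ℝ => Complex.exp (-(φ * Complex.I)) *
      toC (k (circ r φ))) MeasureTheory.volume 0 (2 * Real.pi) :=
    (hexpc.mul hkc).intervalIntegrable _ _
  have hrotI : IntervalIntegrable (fun φ : ℝ => Complex.exp (-(φ * Complex.I)) *
      toC (k (rotate (θ + τ * r ^ 2) (circ r φ)))) MeasureTheory.volume 0 (2 * Real.pi) :=
    (hexpc.mul hrot).intervalIntegrable _ _
  have hexpn : ∀ φ : ℝ, ‖Complex.exp (-(φ * Complex.I))‖ = 1 := fun φ => by
    have := Complex.norm_exp_ofReal_mul_I (-φ)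
    simpa using this
  -- On the circle of radius `r` the twist is the rigid rotation by `θ + τ r²`, which multiplies the
  -- first Fourier coefficient of `k` by a phase. No information on the quadratic and cubic terms of
  -- `k` is needed.
  have hE1 : Complex.exp ((θ₀ + τ₀ * r ^ 2 : ℝ) * Complex.I) * fourierOne k r -
      Complex.exp ((θ + τ * r ^ 2 : ℝ) * Complex.I) * fourierOne k r =
      ∫ φ in (0 : ℝ)..(2 * Real.pi), Complex.exp (-(φ * Complex.I)) *
        (Complex.exp ((θ₀ + τ₀ * r ^ 2 : ℝ) * Complex.I) * toC (k (circ r φ)) -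
          toC (k (rotate (θ + τ * r ^ 2) (circ r φ)))) := by
    rw [← fourierOne_rotate k r (θ + τ * r ^ 2)]
    unfold fourierOne
    rw [← intervalIntegral.integral_const_mul, ← intervalIntegral.integral_sub]
    · congr 1
      ext φ
      ring
    · exact hkI.const_mul _
    · exact hrotI
  have hB1 : ‖Complex.exp ((θ₀ + τ₀ * r ^ 2 : ℝ) * Complex.I) * fourierOne k r -
      Complex.exp ((θ + τ * r ^ 2 : ℝ) * Complex.I) * fourierOne k r‖ ≤
      η / 2 * r ^ 3 * (2 * Real.pi) := by
    rw [hE1]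
    have := intervalIntegral.norm_integral_le_of_norm_le_const (a := 0) (b := 2 * Real.pi)
      (C := η / 2 * r ^ 3) (f := fun φ : ℝ => Complex.exp (-(φ * Complex.I)) *
        (Complex.exp ((θ₀ + τ₀ * r ^ 2 : ℝ) * Complex.I) * toC (k (circ r φ)) -
          toC (k (rotate (θ + τ * r ^ 2) (circ r φ))))) (fun φ _ => by
        rw [norm_mul, hexpn, one_mul]
        have h1 := (hball (hin φ)).1
        simp only [circ_sq, twist] at h1
        refine h1.trans ?_
        rw [norm_pow, norm_norm]
        have := norm_circ_le hr0.le φ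
        gcongr)
    rwa [sub_zero, abs_of_pos Real.two_pi_pos] at this
  -- The linear part of `k` is multiplication by the complex number `p + i q` of modulus one, and
  -- its first Fourier coefficient is `2π (p + i q) r`.
  have hE2 : fourierOne k r - (2 * Real.pi) * ((⟨p, q⟩ : ℂ) * r) =
      ∫ φ in (0 : ℝ)..(2 * Real.pi), Complex.exp (-(φ * Complex.I)) *
        (toC (k (circ r φ)) - (⟨p, q⟩ : ℂ) * toC (circ r φ)) := by
    have h1 : ∀ φ : ℝ, Complex.exp (-(φ * Complex.I)) *
        (toC (k (circ r φ)) - (⟨p, q⟩ : ℂ) * toC (circ r φ)) =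
        Complex.exp (-(φ * Complex.I)) * toC (k (circ r φ)) - (⟨p, q⟩ : ℂ) * r := by
      intro φ
      rw [toC_circ, mul_sub]
      congr 1
      have h2 : Complex.exp (-(φ * Complex.I)) * Complex.exp (φ * Complex.I) = 1 := by
        rw [← Complex.exp_add, neg_add_cancel, Complex.exp_zero]
      linear_combination (⟨p, q⟩ : ℂ) * r * h2
    simp only [h1]
    rw [intervalIntegral.integral_sub hkI intervalIntegrable_const, intervalIntegral.integral_const]
    simp [fourierOne]
  have hB2 : ‖fourierOne k r - (2 * Real.pi) * ((⟨p, q⟩ : ℂ) * r)‖ ≤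
      1 / 2 * r * (2 * Real.pi) := by
    rw [hE2]
    have := intervalIntegral.norm_integral_le_of_norm_le_const (a := 0) (b := 2 * Real.pi)
      (C := 1 / 2 * r) (f := fun φ : ℝ => Complex.exp (-(φ * Complex.I)) *
        (toC (k (circ r φ)) - (⟨p, q⟩ : ℂ) * toC (circ r φ))) (fun φ _ => by
        rw [norm_mul, hexpn, one_mul]
        refine (hball (hin φ)).2.1.trans ?_
        have := norm_circ_le hr0.le φ
        gcongr)
    rwa [sub_zero, abs_of_pos Real.two_pi_pos] at this
  have hmain : ‖(2 * Real.pi : ℂ) * ((⟨p, q⟩ : ℂ) * r)‖ = 2 * Real.pi * r := by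
    simp [hA, abs_of_pos hr0, abs_of_pos Real.pi_pos]
  have hlow : Real.pi * r ≤ ‖fourierOne k r‖ := by
    have := norm_sub_norm_le ((2 * Real.pi : ℂ) * ((⟨p, q⟩ : ℂ) * r)) (fourierOne k r)
    rw [norm_sub_rev, hmain] at this
    nlinarith [hB2]
  have hfac : Complex.exp ((θ₀ + τ₀ * r ^ 2 : ℝ) * Complex.I) * fourierOne k r -
      Complex.exp ((θ + τ * r ^ 2 : ℝ) * Complex.I) * fourierOne k r =
      Complex.exp ((θ + τ * r ^ 2 : ℝ) * Complex.I) *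
        ((Complex.exp ((θ₀ - θ + (τ₀ - τ) * r ^ 2 : ℝ) * Complex.I) - 1) * fourierOne k r) := by
    have h1 : Complex.exp ((θ₀ + τ₀ * r ^ 2 : ℝ) * Complex.I) =
        Complex.exp ((θ + τ * r ^ 2 : ℝ) * Complex.I) *
        Complex.exp ((θ₀ - θ + (τ₀ - τ) * r ^ 2 : ℝ) * Complex.I) := by
      rw [← Complex.exp_add]
      congr 1
      push_cast
      ring
    rw [h1]
    ring
  rw [hfac, norm_mul, Complex.norm_exp_ofReal_mul_I, one_mul, norm_mul] at hB1
  rw [← hrx]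
  set N := ‖Complex.exp ((θ₀ - θ + (τ₀ - τ) * r ^ 2 : ℝ) * Complex.I) - 1‖ with hN
  have hN0 : 0 ≤ N := norm_nonneg _
  have h2 : N * (Real.pi * r) ≤ η * r ^ 2 * (Real.pi * r) := by
    refine (mul_le_mul_of_nonneg_left hlow hN0).trans (hB1.trans (le_of_eq ?_))
    ring
  exact le_of_mul_le_mul_right h2 (by positivity)

/-- The first twist coefficient is unique. -/
theorem IsFirstTwistCoefficient.unique {f : ℝ × ℝ → ℝ × ℝ} {τ₀ τ : ℝ}
    (h₀ : IsFirstTwistCoefficient f τ₀) (h₁ : IsFirstTwistCoefficient f τ) : τ₀ = τ := by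
  obtain ⟨hf, g, θ₀, hg0, hgz, hgs, hgd, hgN⟩ := h₀
  obtain ⟨-, h, θ, hh0, hhz, hhs, hhd, hhN⟩ := h₁
  have hgt : (0 : ℝ × ℝ) ∈ g.target := by rw [← hgz]; exact g.map_source hg0
  have hht : (0 : ℝ × ℝ) ∈ h.target := by rw [← hhz]; exact h.map_source hh0
  have hgsz : g.symm 0 = 0 := by simpa [hgz] using g.left_inv hg0
  have hhsz : h.symm 0 = 0 := by simpa [hhz] using h.left_inv hh0
  have hgc : ContDiffAt ℝ ∞ g 0 := hgs.contDiffAt (g.open_source.mem_nhds hg0)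
  have hhc : ContDiffAt ℝ ∞ h 0 := hhs.contDiffAt (h.open_source.mem_nhds hh0)
  have hgsc : ContDiffAt ℝ ∞ g.symm 0 := contDiffAt_symm_of_det hgs hgd hgt
  have hhsc : ContDiffAt ℝ ∞ h.symm 0 := contDiffAt_symm_of_det hhs hhd hht
  -- The transition map between the two normalizing charts intertwines the two twist maps modulo
  -- order four.
  set k : ℝ × ℝ → ℝ × ℝ := fun z => g.symm (h z) with hk
  have hkc : ContDiffAt ℝ ∞ k 0 := by
    have : ContDiffAt ℝ ∞ g.symm (h 0) := by rwa [hhz]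
    exact this.comp (0 : ℝ × ℝ) hhc
  have hkz : k 0 = 0 := by simp only [hk, hhz, hgsz]
  have hk_tend : Tendsto k (𝓝 0) (𝓝 0) := by simpa [hkz] using hkc.continuousAt.tendsto
  have hh_tend : Tendsto h (𝓝 0) (𝓝 0) := by simpa [hhz] using hhc.continuousAt.tendsto
  have hf_tend : Tendsto f (𝓝 0) (𝓝 0) := by
    simpa [hf.fixed] using hf.smooth.continuousAt.tendsto
  have hhs_tend : Tendsto h.symm (𝓝 0) (𝓝 0) := by
    simpa [hhsz] using hhsc.continuousAt.tendsto
  have hN_tend : ∀ θ τ : ℝ, Tendsto (twist θ τ) (𝓝 0) (𝓝 0) := fun θ τ => by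
    simpa [twist_zero] using (contDiff_twist θ τ).continuous.tendsto 0
  have hkO : k =O[𝓝 0] fun z : ℝ × ℝ => z := by
    have := (hkc.differentiableAt (by simp)).hasFDerivAt.isBigO_sub
    simpa [hkz] using this
  have hgk : ∀ᶠ z in 𝓝 (0 : ℝ × ℝ), g (k z) = h z :=
    (hh_tend.eventually (g.open_target.mem_nhds hgt)).mono fun z hz => g.right_inv hz
  -- the conjugation
  have hconj : (fun z => twist θ₀ τ₀ (k z) - k (twist θ τ z)) =O[𝓝 0]
      fun z : ℝ × ℝ => ‖z‖ ^ 4 := by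
    have e1 : (fun z => g.symm (f (h z)) - twist θ₀ τ₀ (k z)) =O[𝓝 0]
        fun z : ℝ × ℝ => ‖z‖ ^ 4 := by
      have h1 := (hgN.comp_tendsto hk_tend).trans (hkO.norm_norm.pow 4)
      refine h1.congr' (hgk.mono fun z hz => ?_) .rfl
      simp only [Function.comp_apply, hz]
      rfl
    have e2 : (fun z => g.symm (f (h z)) - k (twist θ τ z)) =O[𝓝 0]
        fun z : ℝ × ℝ => ‖z‖ ^ 4 := by
      have hu : Tendsto (fun z => h.symm (f (h z))) (𝓝 0) (𝓝 0) :=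
        hhs_tend.comp (hf_tend.comp hh_tend)
      have h1 := (isBigO_comp_sub hkc hu (hN_tend θ τ)).trans hhN
      refine h1.congr' ?_ .rfl
      filter_upwards [(hf_tend.comp hh_tend).eventually (h.open_target.mem_nhds hht)] with z hz
      simp only [hk]
      rw [h.right_inv (x := f (h z)) hz]
    refine (e2.sub e1).congr_left fun z => ?_
    abel
  -- linear parts
  have hgsd : HasFDerivAt g.symm (fderiv ℝ g.symm 0) 0 :=
    (hgsc.differentiableAt (by simp)).hasFDerivAt
  have hkd : HasFDerivAt k (fderiv ℝ k 0) 0 := (hkc.differentiableAt (by simp)).hasFDerivAt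
  have hgd0 : HasFDerivAt g (fderiv ℝ g 0) 0 := (hgc.differentiableAt (by simp)).hasFDerivAt
  have hhd0 : HasFDerivAt h (fderiv ℝ h 0) 0 := (hhc.differentiableAt (by simp)).hasFDerivAt
  have hfd0 : HasFDerivAt f (fderiv ℝ f 0) 0 :=
    (hf.smooth.differentiableAt (by simp)).hasFDerivAt
  have hdetk : (fderiv ℝ k 0).det = 1 := by
    have h1 : HasFDerivAt (fun z => g (k z)) ((fderiv ℝ g 0).comp (fderiv ℝ k 0)) 0 := by
      refine HasFDerivAt.comp (g := g) (0 : ℝ × ℝ) ?_ hkd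
      rwa [hkz]
    have h2 := (h1.congr_of_eventuallyEq (hgk.mono fun z hz => hz.symm)).unique hhd0
    have h3 := congrArg ContinuousLinearMap.det h2
    rwa [det_clm_comp, hgd 0 hg0, hhd 0 hh0, one_mul] at h3
  set R : ℝ → ℝ × ℝ →L[ℝ] ℝ × ℝ := fun θ =>
    planeMap (Real.cos θ) (-Real.sin θ) (Real.sin θ) (Real.cos θ) with hR
  have hlin : (R θ₀).comp (fderiv ℝ k 0) = (fderiv ℝ k 0).comp (R θ) := by
    have h1 : HasFDerivAt (fun z => twist θ₀ τ₀ (k z)) ((R θ₀).comp (fderiv ℝ k 0)) 0 := by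
      refine HasFDerivAt.comp (g := twist θ₀ τ₀) (0 : ℝ × ℝ) ?_ hkd
      rw [hkz]
      exact hasFDerivAt_twist θ₀ τ₀
    have h2 : HasFDerivAt (fun z => k (twist θ τ z)) ((fderiv ℝ k 0).comp (R θ)) 0 := by
      refine HasFDerivAt.comp (g := k) (0 : ℝ × ℝ) ?_ (hasFDerivAt_twist θ τ)
      rwa [twist_zero]
    exact sub_eq_zero.mp
      ((h1.sub h2).unique (hasFDerivAt_zero_of_isBigO (by norm_num) hconj))
  -- The derivative of `f` is conjugate to the rotation by `θ₀`, so its trace is `2 cos θ₀`;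
  -- ellipticity excludes `cos θ₀ = ±1`.
  have hsin : Real.sin θ₀ ≠ 0 := by
    intro hsin
    have h1 : HasFDerivAt (fun z => g.symm (f (g z)))
        ((fderiv ℝ g.symm 0).comp ((fderiv ℝ f 0).comp (fderiv ℝ g 0))) 0 := by
      have h2 : HasFDerivAt (fun z => f (g z)) ((fderiv ℝ f 0).comp (fderiv ℝ g 0)) 0 := by
        refine HasFDerivAt.comp (g := f) (0 : ℝ × ℝ) ?_ hgd0
        rwa [hgz]
      refine HasFDerivAt.comp (g := g.symm) (0 : ℝ × ℝ) ?_ h2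
      rwa [hgz, hf.fixed]
    have h3 := sub_eq_zero.mp ((h1.sub (hasFDerivAt_twist θ₀ τ₀)).unique
      (hasFDerivAt_zero_of_isBigO (by norm_num) hgN))
    have h4 : (fderiv ℝ g 0).comp (fderiv ℝ g.symm 0) = ContinuousLinearMap.id ℝ (ℝ × ℝ) := by
      have h5 : HasFDerivAt (fun z => g (g.symm z)) ((fderiv ℝ g 0).comp (fderiv ℝ g.symm 0)) 0 := by
        refine HasFDerivAt.comp (g := g) (0 : ℝ × ℝ) ?_ hgsd
        rwa [hgsz]
      refine (h5.congr_of_eventuallyEq ?_).unique (hasFDerivAt_id 0)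
      filter_upwards [g.open_target.mem_nhds hgt] with z hz
      exact (g.right_inv hz).symm
    have h5 : LinearMap.trace ℝ (ℝ × ℝ) (fderiv ℝ f 0).toLinearMap =
        LinearMap.trace ℝ (ℝ × ℝ) (R θ₀).toLinearMap := by
      have h6 : (R θ₀).toLinearMap = (fderiv ℝ g.symm 0).toLinearMap *
          ((fderiv ℝ f 0).toLinearMap * (fderiv ℝ g 0).toLinearMap) := by
        rw [hR]
        simp only []
        rw [← h3]
        rfl
      have h7 : (fderiv ℝ g 0).toLinearMap * (fderiv ℝ g.symm 0).toLinearMap = 1 :=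
        congrArg ContinuousLinearMap.toLinearMap h4
      rw [h6, LinearMap.trace_mul_comm, mul_assoc, h7, mul_one]
    have h6 := hf.elliptic
    rw [h5, trace_prod_clm] at h6
    simp only [hR, planeMap_apply, mul_one, mul_zero, add_zero, zero_add] at h6
    have h7 := abs_lt.mp h6
    nlinarith [Real.sin_sq_add_cos_sq θ₀, hsin]
  rw [eq_planeMap (fderiv ℝ k 0)] at hlin hdetk hkd
  rw [det_planeMap] at hdetk
  obtain ⟨h1, h2⟩ := rotation_of_conj (Real.cos_sq_add_sin_sq θ₀) (Real.cos_sq_add_sin_sq θ) hsin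
    hdetk hlin
  rw [h1, h2] at hkd hdetk
  exact twist_eq_of_conj hkc hkz (by linear_combination hdetk) hkd hconj

/-! ### Orders of vanishing at the origin -/

/-- The function `u` vanishes at the origin of the plane to order `n`. -/
def VanishesTo (n : ℕ) (u : ℝ × ℝ → ℝ) : Prop := u =O[𝓝 0] fun z : ℝ × ℝ => ‖z‖ ^ n

namespace VanishesTo

variable {m n : ℕ} {u v : ℝ × ℝ → ℝ}

theorem congr (h : VanishesTo n u) (e : ∀ z, u z = v z) : VanishesTo n v :=
  IsBigO.congr_left h e

theorem congr' (h : VanishesTo n u) (e : u =ᶠ[𝓝 0] v) : VanishesTo n v :=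
  IsBigO.congr' h e .rfl

theorem add (hu : VanishesTo n u) (hv : VanishesTo n v) : VanishesTo n fun z => u z + v z :=
  IsBigO.add hu hv

theorem sub (hu : VanishesTo n u) (hv : VanishesTo n v) : VanishesTo n fun z => u z - v z :=
  IsBigO.sub hu hv

theorem neg (hu : VanishesTo n u) : VanishesTo n fun z => -u z :=
  IsBigO.neg_left hu

theorem const_mul (k : ℝ) (hu : VanishesTo n u) : VanishesTo n fun z => k * u z :=
  IsBigO.const_mul_left hu k

theorem mul (hu : VanishesTo m u) (hv : VanishesTo n v) :
    VanishesTo (m + n) fun z => u z * v z :=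
  (IsBigO.mul hu hv).congr_right fun _ => (pow_add _ _ _).symm

theorem pow (hu : VanishesTo m u) (k : ℕ) : VanishesTo (m * k) fun z => u z ^ k :=
  (IsBigO.pow hu k).congr_right fun _ => (pow_mul _ _ _).symm

theorem mono (hu : VanishesTo m u) (h : n ≤ m) : VanishesTo n u := by
  refine IsBigO.trans hu (.of_bound 1 ?_)
  filter_upwards [Metric.ball_mem_nhds (0 : ℝ × ℝ) one_pos] with z hz
  rw [mem_ball_zero_iff] at hz
  simp only [norm_pow, norm_norm, one_mul]
  exact pow_le_pow_of_le_one (norm_nonneg _) hz.le h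

theorem fst : VanishesTo 1 fun z => z.1 :=
  IsBigO.of_bound 1 (.of_forall fun z => by simpa using norm_fst_le z)

theorem snd : VanishesTo 1 fun z => z.2 :=
  IsBigO.of_bound 1 (.of_forall fun z => by simpa using norm_snd_le z)

theorem of_continuousAt (hu : ContinuousAt u 0) : VanishesTo 0 u := by
  have := hu.tendsto.isBigO_one ℝ
  simpa [VanishesTo] using this

theorem const (k : ℝ) : VanishesTo 0 fun _ => k := of_continuousAt continuousAt_const

theorem isBigO_of_components {g : ℝ × ℝ → ℝ × ℝ} (h1 : VanishesTo n fun z => (g z).1)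
    (h2 : VanishesTo n fun z => (g z).2) : g =O[𝓝 0] fun z : ℝ × ℝ => ‖z‖ ^ n :=
  IsBigO.prod_left h1 h2

theorem tendsto (hu : VanishesTo n u) (hn : n ≠ 0) : Tendsto u (𝓝 0) (𝓝 0) := by
  refine IsBigO.trans_tendsto hu ?_
  have : Continuous fun z : ℝ × ℝ => ‖z‖ ^ n := by fun_prop
  simpa [hn] using this.tendsto 0

/-- Substitution of a map that vanishes at the origin. -/
theorem comp {g : ℝ × ℝ → ℝ × ℝ} (hu : VanishesTo n u) (h1 : VanishesTo 1 fun z => (g z).1)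
    (h2 : VanishesTo 1 fun z => (g z).2) : VanishesTo n fun z => u (g z) := by
  have hg : g =O[𝓝 0] fun z : ℝ × ℝ => ‖z‖ ^ 1 := isBigO_of_components h1 h2
  have ht : Tendsto g (𝓝 0) (𝓝 0) := by
    exact (h1.tendsto one_ne_zero).prodMk_nhds (h2.tendsto one_ne_zero)
  refine (IsBigO.comp_tendsto hu ht).trans ?_
  have := hg.norm_left.pow n
  simpa [Function.comp_def] using this

end VanishesTo

/-- A binary cubic form. -/
def cubic (c₀ c₁ c₂ c₃ x y : ℝ) : ℝ := c₀ * x ^ 3 + c₁ * x ^ 2 * y + c₂ * x * y ^ 2 + c₃ * y ^ 3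

theorem VanishesTo.cubic {c₀ c₁ c₂ c₃ : ℝ} {x y : ℝ × ℝ → ℝ} (hx : VanishesTo 1 x)
    (hy : VanishesTo 1 y) : VanishesTo 3 fun z => cubic c₀ c₁ c₂ c₃ (x z) (y z) := by
  have h1 := ((hx.pow 3).const_mul c₀).add (((hx.pow 2).mul hy).const_mul c₁)
  have h2 := ((hx.mul (hy.pow 2)).const_mul c₂).add ((hy.pow 3).const_mul c₃)
  refine (h1.add h2).congr fun z => ?_
  simp only [MinkowskiBilliard.cubic]
  ring

/-- The difference factors as `x - x'` and `y - y'` times quadratic forms, giving order `2 + 2`.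
Hence, modulo order four, the arguments of a cubic form may be replaced by their linear parts. -/
theorem VanishesTo.cubic_sub {c₀ c₁ c₂ c₃ : ℝ} {x y x' y' : ℝ × ℝ → ℝ} (hx : VanishesTo 1 x)
    (hy : VanishesTo 1 y) (hx' : VanishesTo 1 x') (hy' : VanishesTo 1 y')
    (hxx : VanishesTo 2 fun z => x z - x' z) (hyy : VanishesTo 2 fun z => y z - y' z) :
    VanishesTo 4 fun z =>
      MinkowskiBilliard.cubic c₀ c₁ c₂ c₃ (x z) (y z) -
        MinkowskiBilliard.cubic c₀ c₁ c₂ c₃ (x' z) (y' z) := by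
  have h1 : VanishesTo 2 fun z => c₀ * (x z ^ 2 + x z * x' z + x' z ^ 2) +
      c₁ * (x z + x' z) * y z + c₂ * y z ^ 2 := by
    refine ((((((hx.pow 2).add (hx.mul hx')).add (hx'.pow 2)).const_mul c₀).add
      (((hx.add hx').mul hy).const_mul c₁)).add ((hy.pow 2).const_mul c₂)).congr fun z => ?_
    ring
  have h2 : VanishesTo 2 fun z => c₃ * (y z ^ 2 + y z * y' z + y' z ^ 2) +
      c₂ * (y z + y' z) * x' z + c₁ * x' z ^ 2 := by
    refine ((((((hy.pow 2).add (hy.mul hy')).add (hy'.pow 2)).const_mul c₃).add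
      (((hy.add hy').mul hx').const_mul c₂)).add ((hx'.pow 2).const_mul c₁)).congr fun z => ?_
    ring
  refine ((hxx.mul h1).add (hyy.mul h2)).congr fun z => ?_
  simp only [MinkowskiBilliard.cubic]
  ring

/-! ### Shears -/

/-- The time `k` map of the Hamiltonian `(p x + q y) ^ 4 / 4`. -/
def shear (k p q : ℝ) (z : ℝ × ℝ) : ℝ × ℝ :=
  (z.1 + k * q * (p * z.1 + q * z.2) ^ 3, z.2 - k * p * (p * z.1 + q * z.2) ^ 3)

theorem contDiff_shear (k p q : ℝ) : ContDiff ℝ ∞ (shear k p q) := by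
  unfold shear
  fun_prop

theorem shear_neg_shear (k p q : ℝ) (z : ℝ × ℝ) : shear (-k) p q (shear k p q z) = z := by
  ext <;> simp only [shear] <;> ring

/-- The shear as a homeomorphism of the plane. -/
def shearHomeomorph (k p q : ℝ) : (ℝ × ℝ) ≃ₜ (ℝ × ℝ) where
  toFun := shear k p q
  invFun := shear (-k) p q
  left_inv := shear_neg_shear k p q
  right_inv z := by simpa using shear_neg_shear (-k) p q z
  continuous_toFun := (contDiff_shear k p q).continuous
  continuous_invFun := (contDiff_shear (-k) p q).continuous

/-- The derivative is the identity plus a rank one matrix that is nilpotent, since `(q, -p)` is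
orthogonal to `(p, q)`. -/
theorem det_fderiv_shear (k p q : ℝ) (z : ℝ × ℝ) : (fderiv ℝ (shear k p q) z).det = 1 := by
  have hl : HasFDerivAt (fun z : ℝ × ℝ => (p * z.1 + q * z.2) ^ 3)
      ((3 * (p * z.1 + q * z.2) ^ 2) •
        (p • ContinuousLinearMap.fst ℝ ℝ ℝ + q • ContinuousLinearMap.snd ℝ ℝ ℝ)) z := by
    have h0 : HasFDerivAt (fun z : ℝ × ℝ => p * z.1 + q * z.2)
        (p • ContinuousLinearMap.fst ℝ ℝ ℝ + q • ContinuousLinearMap.snd ℝ ℝ ℝ) z :=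
      (hasFDerivAt_fst.const_mul p).add (hasFDerivAt_snd.const_mul q)
    simpa using h0.pow 3
  have h := (hasFDerivAt_fst.add (hl.const_mul (k * q))).prodMk
    (hasFDerivAt_snd.sub (hl.const_mul (k * p)))
  have h' : HasFDerivAt (shear k p q) _ z := h
  rw [h'.fderiv, det_prod_clm]
  simp
  ring

/-- A smooth area preserving homeomorphism. -/
def IsSymplectomorphism (h : (ℝ × ℝ) ≃ₜ (ℝ × ℝ)) : Prop :=
  ContDiff ℝ ∞ h ∧ ∀ z, (fderiv ℝ h z).det = 1

theorem IsSymplectomorphism.trans {g h : (ℝ × ℝ) ≃ₜ (ℝ × ℝ)} (hg : IsSymplectomorphism g)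
    (hh : IsSymplectomorphism h) : IsSymplectomorphism (g.trans h) := by
  refine ⟨hh.1.comp hg.1, fun z => ?_⟩
  have h1 : HasFDerivAt (g.trans h) ((fderiv ℝ h (g z)).comp (fderiv ℝ g z)) z :=
    ((hh.1.differentiable (by simp)) (g z)).hasFDerivAt.comp z
      ((hg.1.differentiable (by simp)) z).hasFDerivAt
  rw [h1.fderiv, det_clm_comp, hh.2, hg.2, one_mul]

theorem isSymplectomorphism_shear (k p q : ℝ) : IsSymplectomorphism (shearHomeomorph k p q) :=
  ⟨contDiff_shear k p q, det_fderiv_shear k p q⟩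

/-- The area preserving diagonal map. -/
def diagHomeomorph (ρ : ℝ) (hρ : ρ ≠ 0) : (ℝ × ℝ) ≃ₜ (ℝ × ℝ) where
  toFun z := (ρ * z.1, ρ⁻¹ * z.2)
  invFun z := (ρ⁻¹ * z.1, ρ * z.2)
  left_inv z := by ext <;> simp [hρ]
  right_inv z := by ext <;> simp [hρ]
  continuous_toFun := by fun_prop
  continuous_invFun := by fun_prop

theorem isSymplectomorphism_diag (ρ : ℝ) (hρ : ρ ≠ 0) :
    IsSymplectomorphism (diagHomeomorph ρ hρ) := by
  have h : ⇑(diagHomeomorph ρ hρ) = planeMap ρ 0 0 ρ⁻¹ := by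
    ext z <;> simp [diagHomeomorph]
  refine ⟨by rw [h]; exact (planeMap ρ 0 0 ρ⁻¹).contDiff, fun z => ?_⟩
  rw [h, ContinuousLinearMap.fderiv, det_planeMap]
  simp [hρ]

/-- A smooth map vanishing at the origin is conjugate by a symplectomorphism to a twist map up to
order four if it satisfies the corresponding intertwining relation. -/
theorem isBigO_conj_of_intertwine {f : ℝ × ℝ → ℝ × ℝ} {h : (ℝ × ℝ) ≃ₜ (ℝ × ℝ)} {θ τ : ℝ}
    (hh : IsSymplectomorphism h) (hh0 : h 0 = 0) (hf : ContinuousAt f 0) (hf0 : f 0 = 0)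
    (H : (fun z => f (h z) - h (twist θ τ z)) =O[𝓝 0] fun z : ℝ × ℝ => ‖z‖ ^ 4) :
    (fun z => h.symm (f (h z)) - twist θ τ z) =O[𝓝 0] fun z : ℝ × ℝ => ‖z‖ ^ 4 := by
  have hs : ContDiffAt ℝ ∞ h.symm 0 :=
    contDiffAt_symm_of_det (h := h.toOpenPartialHomeomorph) hh.1.contDiffOn
      (fun p _ => hh.2 p) (mem_univ _)
  have ht : Tendsto h (𝓝 0) (𝓝 0) := by simpa [hh0] using h.continuous.tendsto 0
  have hu : Tendsto (fun z => f (h z)) (𝓝 0) (𝓝 0) := by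
    have : Tendsto f (𝓝 0) (𝓝 0) := by simpa [hf0] using hf.tendsto
    exact this.comp ht
  have hv : Tendsto (fun z => h (twist θ τ z)) (𝓝 0) (𝓝 0) := by
    refine ht.comp ?_
    simpa [twist_zero] using (contDiff_twist θ τ).continuous.tendsto 0
  refine ((isBigO_comp_sub hs hu hv).trans H).congr_left fun z => ?_
  simp

/-- The cubic part of the homological equation for the twist normal form, in the two
coordinates. -/
theorem homological_equation {c σ p q κ m₁ m₂ : ℝ} (h : c ^ 2 + σ ^ 2 = 1)
    (hp : 16 * (p * σ) = -(8 * κ * c + m₁ * (4 * c ^ 2 + 4) + 4 * m₂ * c))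
    (hq : 8 * (q * σ * c) = 2 * κ * (2 * c ^ 2 - 1) + 2 * m₁ * c + m₂) (x y : ℝ) :
    c * cubic (q - 2 * p) 0 (3 * (-2 * p - q)) 0 x y -
        σ * cubic 0 (-3 * (q - 2 * p)) 0 (2 * p + q) x y +
        σ * cubic (4 * κ) (3 * m₁) (2 * m₂) m₁ x (c * x - σ * y) =
      cubic (q - 2 * p) 0 (3 * (-2 * p - q)) 0 (c * x - σ * y) (σ * x + c * y) +
        (3 * κ + 3 * m₁ * c + m₂ * (1 + 2 * c ^ 2) / 2) * (x ^ 2 + y ^ 2) * (σ * x + c * y) ∧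
    σ * cubic (q - 2 * p) 0 (3 * (-2 * p - q)) 0 x y +
        c * cubic 0 (-3 * (q - 2 * p)) 0 (2 * p + q) x y -
        c * cubic (4 * κ) (3 * m₁) (2 * m₂) m₁ x (c * x - σ * y) -
        cubic m₁ (2 * m₂) (3 * m₁) (4 * κ) x (c * x - σ * y) =
      cubic 0 (-3 * (q - 2 * p)) 0 (2 * p + q) (c * x - σ * y) (σ * x + c * y) -
        (3 * κ + 3 * m₁ * c + m₂ * (1 + 2 * c ^ 2) / 2) * (x ^ 2 + y ^ 2) * (c * x - σ * y) := by
  -- The generator of the coordinate change is `-p |z|² Im z² + (q/4) Im z⁴`. Thus `p` handles the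
  -- second harmonic with divisor `σ`, and `q` the fourth with divisor `σ c`. Multiples of `Re z²`
  -- and `Re z⁴` are not needed: symmetry of the generating function in its two arguments fixes the
  -- phase of each harmonic. The two identities `e1`, `e2` isolate `p σ` and `q σ c`, so that `hp`
  -- and `hq` can be substituted.
  have e1 : c * cubic (q - 2 * p) 0 (3 * (-2 * p - q)) 0 x y -
        σ * cubic 0 (-3 * (q - 2 * p)) 0 (2 * p + q) x y -
      cubic (q - 2 * p) 0 (3 * (-2 * p - q)) 0 (c * x - σ * y) (σ * x + c * y) =
      2 * (p * σ) * ((c ^ 2 - σ ^ 2) * (3 * x ^ 2 * y - y ^ 3) +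
        2 * c * σ * (x ^ 3 - 3 * x * y ^ 2) - 3 * (x ^ 2 + y ^ 2) * y) -
      4 * (q * σ * c) * (-c * (3 * x ^ 2 * y - y ^ 3) - σ * (x ^ 3 - 3 * x * y ^ 2)) := by
    simp only [cubic]
    clear hp hq
    grind
  have e2 : σ * cubic (q - 2 * p) 0 (3 * (-2 * p - q)) 0 x y +
        c * cubic 0 (-3 * (q - 2 * p)) 0 (2 * p + q) x y -
      cubic 0 (-3 * (q - 2 * p)) 0 (2 * p + q) (c * x - σ * y) (σ * x + c * y) =
      -2 * (p * σ) * ((c ^ 2 - σ ^ 2) * (x ^ 3 - 3 * x * y ^ 2) -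
        2 * c * σ * (3 * x ^ 2 * y - y ^ 3) + 3 * (x ^ 2 + y ^ 2) * x) +
      4 * (q * σ * c) * (c * (x ^ 3 - 3 * x * y ^ 2) - σ * (3 * x ^ 2 * y - y ^ 3)) := by
    simp only [cubic]
    clear hp hq
    grind
  have hp' : p * σ = -(8 * κ * c + m₁ * (4 * c ^ 2 + 4) + 4 * m₂ * c) / 16 := by linarith
  have hq' : q * σ * c = (2 * κ * (2 * c ^ 2 - 1) + 2 * m₁ * c + m₂) / 8 := by linarith
  rw [hp', hq'] at e1 e2
  clear hp hq hp' hq'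
  constructor
  · rw [← sub_eq_zero] at e1 ⊢
    refine Eq.trans ?_ e1
    simp only [cubic]
    clear e1 e2
    grind
  · rw [← sub_eq_zero] at e2 ⊢
    refine Eq.trans ?_ e2
    simp only [cubic]
    clear e1 e2
    grind

/-! ### Taylor estimates in one variable -/

/-- The mean value inequality on the segment from `0` to `x`. It is used to integrate Taylor jets.
-/
theorem isBigO_pow_succ_of_hasDerivAt {φ φ' : ℝ → ℝ} {n : ℕ}
    (h : ∀ᶠ x in 𝓝 (0 : ℝ), HasDerivAt φ (φ' x) x) (h0 : φ 0 = 0)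
    (hO : φ' =O[𝓝 0] fun x : ℝ => x ^ n) : φ =O[𝓝 0] fun x : ℝ => x ^ (n + 1) := by
  obtain ⟨C, hC⟩ := hO.bound
  obtain ⟨δ, hδ, hball⟩ := Metric.eventually_nhds_iff_ball.mp (h.and hC)
  refine .of_bound C ?_
  filter_upwards [Metric.ball_mem_nhds (0 : ℝ) hδ] with x hx
  have hseg : ∀ y ∈ uIcc 0 x, |y| ≤ |x| := fun y hy => by
    simpa using abs_sub_left_of_mem_uIcc hy
  have hsub : ∀ y ∈ uIcc 0 x, y ∈ Metric.ball (0 : ℝ) δ := fun y hy => by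
    rw [mem_ball_zero_iff, Real.norm_eq_abs] at hx ⊢
    exact (hseg y hy).trans_lt hx
  have hbound : ∀ y ∈ uIcc 0 x, ‖φ' y‖ ≤ C * |x| ^ n := fun y hy => by
    have h1 := (hball y (hsub y hy)).2
    have hC0 : 0 ≤ C * ‖y ^ n‖ := (norm_nonneg _).trans h1
    -- The constant `C` is not known to be nonnegative. Where `y ^ n = 0` the derivative vanishes,
    -- and the bound at `x` itself supplies the sign of the right side.
    rcases eq_or_ne (‖y ^ n‖) 0 with hz | hz
    · rw [hz, mul_zero] at h1
      have h2 := (hball x hx).2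
      have h3 : 0 ≤ C * ‖x ^ n‖ := (norm_nonneg _).trans h2
      rw [norm_pow, Real.norm_eq_abs] at h3
      exact h1.trans h3
    · have hCn : 0 ≤ C := nonneg_of_mul_nonneg_left hC0 (lt_of_le_of_ne (norm_nonneg _) hz.symm)
      refine h1.trans ?_
      rw [norm_pow, Real.norm_eq_abs]
      have := hseg y hy
      gcongr
  have := (convex_uIcc (0 : ℝ) x).norm_image_sub_le_of_norm_hasDerivWithin_le
    (fun y hy => (hball y (hsub y hy)).1.hasDerivWithinAt) hbound left_mem_uIcc right_mem_uIcc
  rw [h0, sub_zero, sub_zero, Real.norm_eq_abs x] at this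
  rw [norm_pow, Real.norm_eq_abs x, pow_succ, ← mul_assoc]
  exact this

theorem isBigO_sub_affine {φ : ℝ → ℝ} {d : ℝ} (h : ContDiffAt ℝ 2 φ 0) (hd : HasDerivAt φ d 0) :
    (fun x => φ x - (φ 0 + d * x)) =O[𝓝 0] fun x : ℝ => x ^ 2 := by
  have hev : ∀ᶠ x in 𝓝 (0 : ℝ), HasDerivAt φ (deriv φ x) x :=
    (h.eventually (by simp)).mono fun x hx => (hx.differentiableAt (by simp)).hasDerivAt
  have h1 : ContDiffAt ℝ 1 (deriv φ) 0 := by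
    have h3 : ContDiffAt ℝ 1 (fun x => fderiv ℝ φ x 1) 0 :=
      (h.fderiv_right (by norm_num)).clm_apply contDiffAt_const
    simpa only [fderiv_apply_one_eq_deriv] using h3
  have h2 : (fun x => deriv φ x - d) =O[𝓝 0] fun x : ℝ => x ^ 1 := by
    have := (h1.differentiableAt (by simp)).isBigO_sub
    simpa [hd.deriv] using this
  refine isBigO_pow_succ_of_hasDerivAt (n := 1) (φ' := fun x => deriv φ x - d) ?_ (by simp) h2
  filter_upwards [hev] with x hx
  have := hx.fun_sub (((hasDerivAt_id' x).const_mul d).const_add (φ 0))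
  simpa using this

theorem VanishesTo.comp_real {φ : ℝ → ℝ} {u : ℝ × ℝ → ℝ} {m k : ℕ}
    (hφ : φ =O[𝓝 0] fun x : ℝ => x ^ k) (hu : VanishesTo m u) (hm : m ≠ 0) :
    VanishesTo (m * k) fun z => φ (u z) :=
  (hφ.comp_tendsto (hu.tendsto hm)).trans (hu.pow k)

theorem VanishesTo.sq_add_sq : VanishesTo 2 fun z => z.1 ^ 2 + z.2 ^ 2 :=
  (VanishesTo.fst.pow 2).add (VanishesTo.snd.pow 2)

theorem VanishesTo.linear (p q : ℝ) : VanishesTo 1 fun z => p * z.1 + q * z.2 :=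
  (VanishesTo.fst.const_mul p).add (VanishesTo.snd.const_mul q)

/-! ### The cubic jet of a twist map -/

/-- Cosine and sine are expanded to first order in `τ |z|²`. The remainder is of order four and
multiplies a linear term. -/
theorem twist_jet (θ τ : ℝ) :
    (VanishesTo 4 fun z => (twist θ τ z).1 - (Real.cos θ * z.1 - Real.sin θ * z.2 -
      τ * (z.1 ^ 2 + z.2 ^ 2) * (Real.sin θ * z.1 + Real.cos θ * z.2))) ∧
    VanishesTo 4 fun z => (twist θ τ z).2 - (Real.sin θ * z.1 + Real.cos θ * z.2 +
      τ * (z.1 ^ 2 + z.2 ^ 2) * (Real.cos θ * z.1 - Real.sin θ * z.2)) := by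
  have hd : HasDerivAt (fun x : ℝ => θ + τ * x) τ 0 := by
    simpa using ((hasDerivAt_id (0 : ℝ)).const_mul τ).const_add θ
  have hc : (fun x : ℝ => Real.cos (θ + τ * x) - (Real.cos θ - τ * Real.sin θ * x)) =O[𝓝 0]
      fun x : ℝ => x ^ 2 := by
    refine (isBigO_sub_affine (φ := fun x : ℝ => Real.cos (θ + τ * x)) (by fun_prop)
      hd.cos).congr_left fun x => ?_
    simp only [mul_zero, add_zero]
    ring
  have hs : (fun x : ℝ => Real.sin (θ + τ * x) - (Real.sin θ + τ * Real.cos θ * x)) =O[𝓝 0]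
      fun x : ℝ => x ^ 2 := by
    refine (isBigO_sub_affine (φ := fun x : ℝ => Real.sin (θ + τ * x)) (by fun_prop)
      hd.sin).congr_left fun x => ?_
    simp only [mul_zero, add_zero]
    ring
  have hc' := VanishesTo.comp_real hc VanishesTo.sq_add_sq two_ne_zero
  have hs' := VanishesTo.comp_real hs VanishesTo.sq_add_sq two_ne_zero
  constructor
  · refine (((hc'.mul .fst).sub (hs'.mul .snd)).mono (by norm_num)).congr fun z => ?_
    simp only [twist, rotate]
    ring
  · refine (((hs'.mul .fst).add (hc'.mul .snd)).mono (by norm_num)).congr fun z => ?_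
    simp only [twist, rotate]
    ring

theorem twist_vanishes (θ τ : ℝ) :
    (VanishesTo 1 fun z => (twist θ τ z).1) ∧ VanishesTo 1 fun z => (twist θ τ z).2 := by
  obtain ⟨h1, h2⟩ := twist_jet θ τ
  have hr := VanishesTo.sq_add_sq.const_mul τ
  constructor
  · refine ((h1.mono (by norm_num)).add ((VanishesTo.linear (Real.cos θ) (-Real.sin θ)).sub
      ((hr.mul (.linear (Real.sin θ) (Real.cos θ))).mono (by norm_num)))).congr fun z => ?_
    ring
  · refine ((h2.mono (by norm_num)).add ((VanishesTo.linear (Real.sin θ) (Real.cos θ)).add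
      ((hr.mul (.linear (Real.cos θ) (-Real.sin θ))).mono (by norm_num)))).congr fun z => ?_
    ring

/-- The cubic jet of a composition with a shear. -/
theorem shear_jet {u : ℝ × ℝ → ℝ × ℝ} {C₁ C₂ : ℝ × ℝ → ℝ} (k p q : ℝ)
    (hC₁ : VanishesTo 3 C₁) (hC₂ : VanishesTo 3 C₂)
    (h1 : VanishesTo 4 fun z => (u z).1 - (z.1 + C₁ z))
    (h2 : VanishesTo 4 fun z => (u z).2 - (z.2 + C₂ z)) :
    (VanishesTo 4 fun z => (shear k p q (u z)).1 -
      (z.1 + (C₁ z + k * q * (p * z.1 + q * z.2) ^ 3))) ∧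
    VanishesTo 4 fun z => (shear k p q (u z)).2 -
      (z.2 + (C₂ z - k * p * (p * z.1 + q * z.2) ^ 3)) := by
  have d1 : VanishesTo 2 fun z => (u z).1 - z.1 :=
    ((h1.mono (by norm_num)).add (hC₁.mono (by norm_num))).congr fun z => by ring
  have d2 : VanishesTo 2 fun z => (u z).2 - z.2 :=
    ((h2.mono (by norm_num)).add (hC₂.mono (by norm_num))).congr fun z => by ring
  have u1 : VanishesTo 1 fun z => (u z).1 :=
    ((d1.mono (by norm_num)).add .fst).congr fun z => by ring
  have u2 : VanishesTo 1 fun z => (u z).2 :=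
    ((d2.mono (by norm_num)).add .snd).congr fun z => by ring
  have hcub := VanishesTo.cubic_sub (c₀ := p ^ 3) (c₁ := 3 * p ^ 2 * q) (c₂ := 3 * p * q ^ 2)
    (c₃ := q ^ 3) u1 u2 .fst .snd d1 d2
  constructor
  · refine (h1.add (hcub.const_mul (k * q))).congr fun z => ?_
    simp only [shear, cubic]
    ring
  · refine (h2.sub (hcub.const_mul (k * p))).congr fun z => ?_
    simp only [shear, cubic]
    ring

/-- There is a polynomial symplectomorphism, tangent to the identity, whose cubic part is the
Hamiltonian vector field of `μ x³ y + ν x y³`. -/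
theorem exists_symplectomorphism (μ ν : ℝ) : ∃ Q : (ℝ × ℝ) ≃ₜ (ℝ × ℝ),
    IsSymplectomorphism Q ∧ Q 0 = 0 ∧
    (VanishesTo 4 fun z => (Q z).1 - (z.1 + cubic μ 0 (3 * ν) 0 z.1 z.2)) ∧
    VanishesTo 4 fun z => (Q z).2 - (z.2 + cubic 0 (-3 * μ) 0 (-ν) z.1 z.2) := by
  -- Both monomials are combinations of fourth powers of linear forms: `(x + y)⁴ - (x - y)⁴ = 8 (x³y
  -- + xy³)` and `(x + 2y)⁴ - (x - 2y)⁴ = 16 x³y + 64 xy³`. The shears have Hamiltonians that are a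
  -- quarter of such powers, so one solves `2k + 4l = μ`, `2k + 16l = ν`.
  set k := (4 * μ - ν) / 6 with hk
  set l := (ν - μ) / 12 with hl
  refine ⟨(((shearHomeomorph k 1 1).trans (shearHomeomorph (-k) 1 (-1))).trans
    (shearHomeomorph l 1 2)).trans (shearHomeomorph (-l) 1 (-2)),
    (((isSymplectomorphism_shear _ _ _).trans (isSymplectomorphism_shear _ _ _)).trans
      (isSymplectomorphism_shear _ _ _)).trans (isSymplectomorphism_shear _ _ _), ?_, ?_⟩
  · ext <;> simp [shearHomeomorph, shear]
  have hlin : ∀ m p q : ℝ, VanishesTo 3 fun z => m * (p * z.1 + q * z.2) ^ 3 := fun m p q =>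
    ((VanishesTo.linear p q).pow 3).const_mul m
  have h0 : VanishesTo 3 fun _ => 0 :=
    ((hlin 0 0 0)).congr fun z => by ring
  have hid : VanishesTo 4 fun _ => 0 := ((VanishesTo.fst.pow 4).const_mul 0).congr fun z => by ring
  obtain ⟨a1, a2⟩ := shear_jet (u := fun z => z) k 1 1 h0 h0 (hid.congr fun z => by simp)
    (hid.congr fun z => by simp)
  have c1 := h0.add (hlin (k * 1) 1 1)
  have c2 := h0.sub (hlin (k * 1) 1 1)
  obtain ⟨b1, b2⟩ := shear_jet (-k) 1 (-1) c1 c2 a1 a2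
  have d1 := c1.add (hlin (-k * -1) 1 (-1))
  have d2 := c2.sub (hlin (-k * 1) 1 (-1))
  obtain ⟨e1, e2⟩ := shear_jet l 1 2 d1 d2 b1 b2
  have f1 := d1.add (hlin (l * 2) 1 2)
  have f2 := d2.sub (hlin (l * 1) 1 2)
  obtain ⟨g1, g2⟩ := shear_jet (-l) 1 (-2) f1 f2 e1 e2
  constructor
  · refine g1.congr fun z => ?_
    simp only [Homeomorph.trans_apply, shearHomeomorph, Homeomorph.homeomorph_mk_coe,
      Equiv.coe_fn_mk, cubic, hk, hl]
    ring
  · refine g2.congr fun z => ?_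
    simp only [Homeomorph.trans_apply, shearHomeomorph, Homeomorph.homeomorph_mk_coe,
      Equiv.coe_fn_mk, cubic, hk, hl]
    ring

/-! ### The normal form -/

/-- Modulo order four, cubic terms see only the linear parts of their arguments, so `g ∘ Q` and `Q ∘
twist` agree as soon as their cubic parts do. That is `homological_equation`, with the mean of the
quartic absorbed in `τ`. -/
theorem intertwine_of_jet {g Q : ℝ × ℝ → ℝ × ℝ} {θ κ m₁ m₂ p q τ : ℝ}
    (hp : 16 * (p * Real.sin θ) =
      -(8 * κ * Real.cos θ + m₁ * (4 * Real.cos θ ^ 2 + 4) + 4 * m₂ * Real.cos θ))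
    (hq : 8 * (q * Real.sin θ * Real.cos θ) =
      2 * κ * (2 * Real.cos θ ^ 2 - 1) + 2 * m₁ * Real.cos θ + m₂)
    (hτ : τ = -(3 * κ + 3 * m₁ * Real.cos θ + m₂ * (1 + 2 * Real.cos θ ^ 2) / 2))
    (g1 : VanishesTo 4 fun z => (g z).1 - (Real.cos θ * z.1 - Real.sin θ * z.2 + Real.sin θ *
      cubic (4 * κ) (3 * m₁) (2 * m₂) m₁ z.1 (Real.cos θ * z.1 - Real.sin θ * z.2)))
    (g2 : VanishesTo 4 fun z => (g z).2 - (Real.sin θ * z.1 + Real.cos θ * z.2 -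
      Real.cos θ * cubic (4 * κ) (3 * m₁) (2 * m₂) m₁ z.1 (Real.cos θ * z.1 - Real.sin θ * z.2) -
      cubic m₁ (2 * m₂) (3 * m₁) (4 * κ) z.1 (Real.cos θ * z.1 - Real.sin θ * z.2)))
    (Q1 : VanishesTo 4 fun z => (Q z).1 -
      (z.1 + cubic (q - 2 * p) 0 (3 * (-2 * p - q)) 0 z.1 z.2))
    (Q2 : VanishesTo 4 fun z => (Q z).2 -
      (z.2 + cubic 0 (-3 * (q - 2 * p)) 0 (-(-2 * p - q)) z.1 z.2)) :
    (VanishesTo 4 fun z => (g (Q z)).1 - (Q (twist θ τ z)).1) ∧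
    VanishesTo 4 fun z => (g (Q z)).2 - (Q (twist θ τ z)).2 := by
  have hν : -(-2 * p - q) = 2 * p + q := by ring
  rw [hν] at Q2
  have hcs := Real.cos_sq_add_sin_sq θ
  obtain ⟨n1, n2⟩ := twist_vanishes θ τ
  obtain ⟨N1, N2⟩ := twist_jet θ τ
  set c := Real.cos θ with hc
  set σ := Real.sin θ with hσ
  have X1 : VanishesTo 1 fun z => c * z.1 - σ * z.2 :=
    (VanishesTo.linear c (-σ)).congr fun z => by ring
  have Y1 : VanishesTo 1 fun z => σ * z.1 + c * z.2 := .linear σ c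
  have d1 : VanishesTo 2 fun z => (Q z).1 - z.1 :=
    ((Q1.mono (by norm_num)).add ((VanishesTo.fst.cubic .snd).mono (by norm_num))).congr
      fun z => by ring
  have d2 : VanishesTo 2 fun z => (Q z).2 - z.2 :=
    ((Q2.mono (by norm_num)).add ((VanishesTo.fst.cubic .snd).mono (by norm_num))).congr
      fun z => by ring
  have u1 : VanishesTo 1 fun z => (Q z).1 :=
    ((d1.mono (by norm_num)).add .fst).congr fun z => by ring
  have u2 : VanishesTo 1 fun z => (Q z).2 :=
    ((d2.mono (by norm_num)).add .snd).congr fun z => by ring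
  have u3 : VanishesTo 1 fun z => c * (Q z).1 - σ * (Q z).2 :=
    (u1.const_mul c).sub (u2.const_mul σ)
  have d3 : VanishesTo 2 fun z => c * (Q z).1 - σ * (Q z).2 - (c * z.1 - σ * z.2) :=
    ((d1.const_mul c).sub (d2.const_mul σ)).congr fun z => by ring
  have dn1 : VanishesTo 2 fun z => (twist θ τ z).1 - (c * z.1 - σ * z.2) :=
    ((N1.mono (by norm_num)).sub (((VanishesTo.sq_add_sq.const_mul τ).mul Y1).mono
      (by norm_num))).congr fun z => by ring
  have dn2 : VanishesTo 2 fun z => (twist θ τ z).2 - (σ * z.1 + c * z.2) :=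
    ((N2.mono (by norm_num)).add (((VanishesTo.sq_add_sq.const_mul τ).mul X1).mono
      (by norm_num))).congr fun z => by ring
  have H1 := VanishesTo.cubic_sub (c₀ := 4 * κ) (c₁ := 3 * m₁) (c₂ := 2 * m₂) (c₃ := m₁)
    u1 u3 .fst X1 d1 d3
  have H2 := VanishesTo.cubic_sub (c₀ := m₁) (c₁ := 2 * m₂) (c₂ := 3 * m₁) (c₃ := 4 * κ)
    u1 u3 .fst X1 d1 d3
  have P1 := VanishesTo.cubic_sub (c₀ := q - 2 * p) (c₁ := 0) (c₂ := 3 * (-2 * p - q)) (c₃ := 0)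
    n1 n2 X1 Y1 dn1 dn2
  have P2 := VanishesTo.cubic_sub (c₀ := 0) (c₁ := -3 * (q - 2 * p)) (c₂ := 0)
    (c₃ := 2 * p + q) n1 n2 X1 Y1 dn1 dn2
  have G1 := g1.comp u1 u2
  have G2 := g2.comp u1 u2
  have R1 := Q1.comp n1 n2
  have R2 := Q2.comp n1 n2
  constructor
  · refine ((((G1.add (H1.const_mul σ)).add ((Q1.const_mul c).sub (Q2.const_mul σ))).sub R1).sub
      (N1.add P1)).congr fun z => ?_
    have := (homological_equation hcs hp hq z.1 z.2).1
    rw [hτ]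
    linear_combination -this
  · refine (((((G2.sub (H1.const_mul c)).sub H2).add ((Q1.const_mul σ).add
      (Q2.const_mul c))).sub R2).sub (N2.add P2)).congr fun z => ?_
    have := (homological_equation hcs hp hq z.1 z.2).2
    rw [hτ]
    linear_combination -this

theorem cubic_smul (c₀ c₁ c₂ c₃ r x y : ℝ) :
    cubic c₀ c₁ c₂ c₃ (r * x) (r * y) = r ^ 3 * cubic c₀ c₁ c₂ c₃ x y := by
  simp only [cubic]
  ring

theorem cubic_const_mul (c₀ c₁ c₂ c₃ r x y : ℝ) :
    cubic (r * c₀) (r * c₁) (r * c₂) (r * c₃) x y = r * cubic c₀ c₁ c₂ c₃ x y := by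
  simp only [cubic]
  ring

theorem exists_angle {c σ : ℝ} (h : c ^ 2 + σ ^ 2 = 1) : ∃ θ, Real.cos θ = c ∧ Real.sin θ = σ := by
  have hn : ‖(⟨c, σ⟩ : ℂ)‖ = 1 := by rw [Complex.norm_eq_sqrt_sq_add_sq, h, Real.sqrt_one]
  have hz : (⟨c, σ⟩ : ℂ) ≠ 0 := by
    intro h0
    simp [h0] at hn
  refine ⟨Complex.arg ⟨c, σ⟩, ?_, ?_⟩
  · rw [Complex.cos_arg hz, hn, div_one]
  · rw [Complex.sin_arg, hn, div_one]

/-- Twist coefficient of the symplectic map generated by the function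
`A / 2 (s² + s₁²) + B s s₁ + κ (s⁴ + s₁⁴) + m₁ (s³ s₁ + s s₁³) + m₂ s² s₁²`, up to terms of order
four. -/
theorem isFirstTwistCoefficient_of_jet {f : ℝ × ℝ → ℝ × ℝ} {A B κ m₁ m₂ : ℝ} (hB : 0 < B)
    (hAB : A ^ 2 < B ^ 2) (hA : A ≠ 0) (hf : ContDiffAt ℝ ∞ f 0) (hf0 : f 0 = 0)
    (hsymp : ∀ᶠ p in 𝓝 (0 : ℝ × ℝ), (fderiv ℝ f p).det = 1)
    (f1 : VanishesTo 4 fun z => (f z).1 - ((z.2 - A * z.1) / B -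
      1 / B * cubic (4 * κ) (3 * m₁) (2 * m₂) m₁ z.1 ((z.2 - A * z.1) / B)))
    (f2 : VanishesTo 4 fun z => (f z).2 - (-A * ((z.2 - A * z.1) / B) - B * z.1 +
      A / B * cubic (4 * κ) (3 * m₁) (2 * m₂) m₁ z.1 ((z.2 - A * z.1) / B) -
      cubic m₁ (2 * m₂) (3 * m₁) (4 * κ) z.1 ((z.2 - A * z.1) / B))) :
    IsFirstTwistCoefficient f
      (-(4 / (B ^ 2 - A ^ 2)) * (3 * κ / 4 - 3 * m₁ * A / (4 * B) +
        m₂ * (1 + 2 * A ^ 2 / B ^ 2) / 8)) := by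
  have hE : 0 < B ^ 2 - A ^ 2 := by linarith
  have hx1 : VanishesTo 1 fun z => (z.2 - A * z.1) / B :=
    (VanishesTo.linear (-A / B) (1 / B)).congr fun z => by ring
  -- ellipticity
  have hell : IsEllipticFixedPoint f := by
    refine ⟨hf, hsymp, hf0, ?_⟩
    have hlin : HasFDerivAt f (planeMap (-A / B) (1 / B) (A ^ 2 / B - B) (-A / B)) 0 := by
      have h0 : (fun z => f z - planeMap (-A / B) (1 / B) (A ^ 2 / B - B) (-A / B) z) =O[𝓝 0]
          fun z : ℝ × ℝ => ‖z‖ ^ 3 := by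
        refine VanishesTo.isBigO_of_components ?_ ?_
        · refine ((f1.mono (by norm_num)).sub ((VanishesTo.cubic (c₀ := 4 * κ) (c₁ := 3 * m₁)
            (c₂ := 2 * m₂) (c₃ := m₁) .fst hx1).const_mul (1 / B))).congr fun z => ?_
          simp only [planeMap_apply, Prod.fst_sub]
          ring
        · refine (((f2.mono (by norm_num)).add ((VanishesTo.cubic (c₀ := 4 * κ) (c₁ := 3 * m₁)
            (c₂ := 2 * m₂) (c₃ := m₁) .fst hx1).const_mul (A / B))).sub (VanishesTo.cubic (c₀ := m₁)
            (c₁ := 2 * m₂) (c₂ := 3 * m₁) (c₃ := 4 * κ) .fst hx1)).congr fun z => ?_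
          simp only [planeMap_apply, Prod.snd_sub]
          ring
      have h1 := (hasFDerivAt_zero_of_isBigO (by norm_num) h0).add
        (planeMap (-A / B) (1 / B) (A ^ 2 / B - B) (-A / B)).hasFDerivAt
      rw [zero_add] at h1
      refine h1.congr_of_eventuallyEq (.of_forall fun z => ?_)
      simp
    rw [hlin.fderiv, trace_prod_clm]
    have hlt : |A| < B := abs_lt_of_sq_lt_sq hAB hB.le
    have : (planeMap (-A / B) (1 / B) (A ^ 2 / B - B) (-A / B) (1, 0)).1 +
        (planeMap (-A / B) (1 / B) (A ^ 2 / B - B) (-A / B) (0, 1)).2 = -(2 * (A / B)) := by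
      simp
      ring
    rw [this, abs_neg, abs_mul, abs_div, abs_of_pos hB, abs_two]
    rw [← div_lt_one hB] at hlt
    linarith
  -- scaling
  obtain ⟨ρ, hρ0, hρ⟩ : ∃ ρ : ℝ, 0 < ρ ∧ ρ ^ 4 * (B ^ 2 - A ^ 2) = 1 := by
    refine ⟨√(√(1 / (B ^ 2 - A ^ 2))), by positivity, ?_⟩
    have h4 : √(√(1 / (B ^ 2 - A ^ 2))) ^ 4 = 1 / (B ^ 2 - A ^ 2) := by
      rw [show (4 : ℕ) = 2 * 2 from rfl, pow_mul, Real.sq_sqrt (by positivity),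
        Real.sq_sqrt (by positivity)]
    rw [h4]
    field_simp
  -- The scaling by `ρ` keeps the diagonal entries `-A / B` of the linear part and turns the entry
  -- `1 / B` into `1 / (B ρ²)`. The equation for `ρ` says that these are the cosine and minus the
  -- sine of an angle.
  obtain ⟨θ, hcos, hsin⟩ := exists_angle (c := -A / B) (σ := -(1 / (B * ρ ^ 2))) (by
    field_simp
    linear_combination -hρ)
  have hs0 : Real.sin θ ≠ 0 := by rw [hsin]; exact neg_ne_zero.mpr (by positivity)
  -- Non-resonance: with `sin θ ≠ 0` this gives `sin 2θ ≠ 0`, the divisor of the fourth harmonic.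
  -- There is no condition of order three, because the map has no quadratic terms.
  have hc0 : Real.cos θ ≠ 0 := by
    rw [hcos]
    exact div_ne_zero (neg_ne_zero.mpr hA) hB.ne'
  set c := Real.cos θ with hc
  set σ := Real.sin θ with hσ
  -- Scaling both arguments by `ρ` multiplies a quartic generating function by `ρ⁴`.
  set κ' := ρ ^ 4 * κ with hκ'
  set n₁ := ρ ^ 4 * m₁ with hn₁
  set n₂ := ρ ^ 4 * m₂ with hn₂
  set p := -(8 * κ' * c + n₁ * (4 * c ^ 2 + 4) + 4 * n₂ * c) / (16 * σ) with hp
  set q := (2 * κ' * (2 * c ^ 2 - 1) + 2 * n₁ * c + n₂) / (8 * σ * c) with hq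
  have hp' : 16 * (p * σ) = -(8 * κ' * c + n₁ * (4 * c ^ 2 + 4) + 4 * n₂ * c) := by
    rw [hp]
    field_simp
  have hq' : 8 * (q * σ * c) = 2 * κ' * (2 * c ^ 2 - 1) + 2 * n₁ * c + n₂ := by
    rw [hq]
    field_simp
  obtain ⟨Q, hQs, hQ0, Q1, Q2⟩ := exists_symplectomorphism (q - 2 * p) (-2 * p - q)
  set D := diagHomeomorph ρ hρ0.ne' with hD
  set g : ℝ × ℝ → ℝ × ℝ := fun z => (ρ⁻¹ * (f (D z)).1, ρ * (f (D z)).2) with hg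
  have hDz : ∀ z, D z = (ρ * z.1, ρ⁻¹ * z.2) := fun z => rfl
  have hD1 : VanishesTo 1 fun z => (D z).1 := VanishesTo.fst.const_mul ρ
  have hD2 : VanishesTo 1 fun z => (D z).2 := VanishesTo.snd.const_mul ρ⁻¹
  have hxD : ∀ z : ℝ × ℝ, ((D z).2 - A * (D z).1) / B = ρ * (c * z.1 - σ * z.2) := fun z => by
    rw [hDz, hcos, hsin]
    field_simp
    ring
  have hcubD : ∀ c₀ c₁ c₂ c₃ : ℝ, ∀ z : ℝ × ℝ,
      cubic c₀ c₁ c₂ c₃ (D z).1 (((D z).2 - A * (D z).1) / B) =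
        ρ ^ 3 * cubic c₀ c₁ c₂ c₃ z.1 (c * z.1 - σ * z.2) := fun c₀ c₁ c₂ c₃ z => by
    rw [hxD, hDz, cubic_smul]
  have hscale1 : ∀ x y : ℝ, cubic (4 * κ') (3 * n₁) (2 * n₂) n₁ x y =
      ρ ^ 4 * cubic (4 * κ) (3 * m₁) (2 * m₂) m₁ x y := fun x y => by
    rw [← cubic_const_mul]
    congr 1 <;> simp only [hκ', hn₁, hn₂] <;> ring
  have hscale2 : ∀ x y : ℝ, cubic n₁ (2 * n₂) (3 * n₁) (4 * κ') x y =
      ρ ^ 4 * cubic m₁ (2 * m₂) (3 * m₁) (4 * κ) x y := fun x y => by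
    rw [← cubic_const_mul]
    congr 1 <;> simp only [hκ', hn₁, hn₂] <;> ring
  have hAB1 : A = -(B * c) := by rw [hcos]; field_simp
  have hsB : ρ ^ 2 * σ * B = -1 := by rw [hsin]; field_simp
  have hσ1 : 1 / B = -(ρ ^ 2 * σ) := by
    field_simp
    linear_combination hsB
  have hAc : A / B = -c := by rw [hcos]; ring
  have g1 : VanishesTo 4 fun z => (g z).1 - (c * z.1 - σ * z.2 + σ *
      cubic (4 * κ') (3 * n₁) (2 * n₂) n₁ z.1 (c * z.1 - σ * z.2)) := by
    refine ((f1.comp hD1 hD2).const_mul ρ⁻¹).congr fun z => ?_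
    simp only [hcubD, hscale1, hg]
    rw [hxD, hσ1]
    field_simp
    ring
  have g2 : VanishesTo 4 fun z => (g z).2 - (σ * z.1 + c * z.2 -
      c * cubic (4 * κ') (3 * n₁) (2 * n₂) n₁ z.1 (c * z.1 - σ * z.2) -
      cubic n₁ (2 * n₂) (3 * n₁) (4 * κ') z.1 (c * z.1 - σ * z.2)) := by
    refine ((f2.comp hD1 hD2).const_mul ρ).congr fun z => ?_
    simp only [hcubD, hscale1, hscale2, hg]
    rw [hxD, hAc]
    have hcs : c ^ 2 + σ ^ 2 = 1 := Real.cos_sq_add_sin_sq θ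
    have h5 : ρ * (-A * (ρ * (c * z.1 - σ * z.2)) - B * (D z).1) = σ * z.1 + c * z.2 := by
      rw [hDz, hAB1]
      simp only []
      linear_combination (-σ * z.1 - c * z.2) * hsB + (ρ ^ 2 * B * z.1) * hcs
    linear_combination -h5
  obtain ⟨i1, i2⟩ := intertwine_of_jet hp' hq' rfl g1 g2 Q1 Q2
  set τ := -(3 * κ' + 3 * n₁ * c + n₂ * (1 + 2 * c ^ 2) / 2) with hτ
  have hτ' : -(4 / (B ^ 2 - A ^ 2)) * (3 * κ / 4 - 3 * m₁ * A / (4 * B) +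
        m₂ * (1 + 2 * A ^ 2 / B ^ 2) / 8) = τ := by
    have h4 : 4 / (B ^ 2 - A ^ 2) = 4 * ρ ^ 4 := by
      field_simp
      linear_combination -hρ
    rw [h4, hτ, hcos, hκ', hn₁, hn₂]
    field_simp
    ring
  rw [hτ']
  have hQDs := hQs.trans (isSymplectomorphism_diag ρ hρ0.ne')
  have hQD0 : Q.trans D 0 = 0 := by
    simp [hQ0, hDz]
  refine ⟨hell, (Q.trans D).toOpenPartialHomeomorph, θ, mem_univ _, hQD0, hQDs.1.contDiffOn,
    fun z _ => hQDs.2 z, ?_⟩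
  refine isBigO_conj_of_intertwine hQDs hQD0 hf.continuousAt hf0
    (VanishesTo.isBigO_of_components ?_ ?_)
  · refine (i1.const_mul ρ).congr fun z => ?_
    simp only [hg, Homeomorph.trans_apply, Prod.fst_sub]
    rw [hDz (Q (twist θ τ z)), mul_sub, mul_inv_cancel_left₀ hρ0.ne']
  · refine (i2.const_mul ρ⁻¹).congr fun z => ?_
    simp only [hg, Homeomorph.trans_apply, Prod.snd_sub]
    rw [hDz (Q (twist θ τ z)), mul_sub, inv_mul_cancel_left₀ hρ0.ne']

/-- The cubic jet of a map given parametrically by `(S x, w (x, y)) ↦ (S y, -w (y, x))`. -/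
theorem jet_of_parametrization {f W : ℝ × ℝ → ℝ × ℝ} {S : ℝ → ℝ} {w : ℝ × ℝ → ℝ}
    {A B κ m₁ m₂ e : ℝ} (hB : B ≠ 0)
    (hS : (fun t => S t - (t + e * t ^ 3)) =O[𝓝 0] fun t : ℝ => t ^ 4)
    (hw : VanishesTo 4 fun z => w z - (A * z.1 + B * z.2 +
      cubic (4 * κ + A * e) (3 * m₁) (2 * m₂) (m₁ + B * e) z.1 z.2))
    (hW1 : VanishesTo 1 fun p => (W p).1) (hW2 : VanishesTo 1 fun p => (W p).2)
    (hW : ∀ᶠ p in 𝓝 (0 : ℝ × ℝ), (S (W p).1, w (W p)) = p)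
    (hf : ∀ᶠ p in 𝓝 (0 : ℝ × ℝ), f p = (S (W p).2, -w ((W p).2, (W p).1))) :
    (VanishesTo 4 fun z => (f z).1 - ((z.2 - A * z.1) / B -
      1 / B * cubic (4 * κ) (3 * m₁) (2 * m₂) m₁ z.1 ((z.2 - A * z.1) / B))) ∧
    VanishesTo 4 fun z => (f z).2 - (-A * ((z.2 - A * z.1) / B) - B * z.1 +
      A / B * cubic (4 * κ) (3 * m₁) (2 * m₂) m₁ z.1 ((z.2 - A * z.1) / B) -
      cubic m₁ (2 * m₂) (3 * m₁) (4 * κ) z.1 ((z.2 - A * z.1) / B)) := by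
  -- In terms of `s = t + e t³` the jet of `w` is `A s + B s₁` plus the cubic with coefficients `4κ,
  -- 3m₁, 2m₂, m₁`; the extra `A e` and `B e` in `hw` are the cubic corrections of the two linear
  -- terms. Both relations are verified in the parameters `(t, t₁)` and then pulled back along `W`.
  have S1 : VanishesTo 4 fun z => S z.1 - (z.1 + e * z.1 ^ 3) :=
    VanishesTo.comp_real hS VanishesTo.fst one_ne_zero
  have S2 : VanishesTo 4 fun z => S z.2 - (z.2 + e * z.2 ^ 3) :=
    VanishesTo.comp_real hS VanishesTo.snd one_ne_zero
  have w' : VanishesTo 4 fun z => w (z.2, z.1) - (A * z.2 + B * z.1 +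
      cubic (4 * κ + A * e) (3 * m₁) (2 * m₂) (m₁ + B * e) z.2 z.1) :=
    hw.comp (g := fun z => (z.2, z.1)) .snd .fst
  have d1 : VanishesTo 2 fun z => S z.1 - z.1 :=
    ((S1.mono (by norm_num)).add (((VanishesTo.fst.pow 3).const_mul e).mono (by norm_num))).congr
      fun z => by ring
  have hx : VanishesTo 4 fun z => (w z - A * S z.1) / B - (z.2 +
      (cubic (4 * κ + A * e) (3 * m₁) (2 * m₂) (m₁ + B * e) z.1 z.2 - A * e * z.1 ^ 3) / B) := by
    refine ((hw.sub (S1.const_mul A)).const_mul (1 / B)).congr fun z => ?_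
    field_simp
    ring
  have d2 : VanishesTo 2 fun z => (w z - A * S z.1) / B - z.2 :=
    ((hx.mono (by norm_num)).add ((((VanishesTo.fst.cubic .snd).sub
      ((VanishesTo.fst.pow 3).const_mul (A * e))).const_mul (1 / B)).mono (by norm_num))).congr
      fun z => by ring
  have u1 : VanishesTo 1 fun z => S z.1 :=
    ((d1.mono (by norm_num)).add .fst).congr fun z => by ring
  have u2 : VanishesTo 1 fun z => (w z - A * S z.1) / B :=
    ((d2.mono (by norm_num)).add .snd).congr fun z => by ring
  have H1 := VanishesTo.cubic_sub (c₀ := 4 * κ) (c₁ := 3 * m₁) (c₂ := 2 * m₂) (c₃ := m₁)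
    u1 u2 .fst .snd d1 d2
  have H2 := VanishesTo.cubic_sub (c₀ := m₁) (c₁ := 2 * m₂) (c₂ := 3 * m₁) (c₃ := 4 * κ)
    u1 u2 .fst .snd d1 d2
  have F1 : VanishesTo 4 fun z => S z.2 - ((w z - A * S z.1) / B -
      1 / B * cubic (4 * κ) (3 * m₁) (2 * m₂) m₁ (S z.1) ((w z - A * S z.1) / B)) := by
    refine ((S2.sub hx).add (H1.const_mul (1 / B))).congr fun z => ?_
    simp only [cubic]
    field_simp
    ring
  have F2 : VanishesTo 4 fun z => -w (z.2, z.1) - (-A * ((w z - A * S z.1) / B) - B * S z.1 +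
      A / B * cubic (4 * κ) (3 * m₁) (2 * m₂) m₁ (S z.1) ((w z - A * S z.1) / B) -
      cubic m₁ (2 * m₂) (3 * m₁) (4 * κ) (S z.1) ((w z - A * S z.1) / B)) := by
    refine (((hx.const_mul A).add (((S1.const_mul B).sub w').sub (H1.const_mul (A / B)))).add
      H2).congr fun z => ?_
    simp only [cubic]
    field_simp
    ring
  constructor
  · refine (F1.comp hW1 hW2).congr' ?_
    filter_upwards [hW, hf] with p hp hfp
    have e1 : S (W p).1 = p.1 := congrArg Prod.fst hp
    have e2 : w (W p) = p.2 := congrArg Prod.snd hp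
    simp only [hfp, e1, e2]
  · refine (F2.comp hW1 hW2).congr' ?_
    filter_upwards [hW, hf] with p hp hfp
    have e1 : S (W p).1 = p.1 := congrArg Prod.fst hp
    have e2 : w (W p) = p.2 := congrArg Prod.snd hp
    simp only [hfp, e1, e2]

/-! ### The profile of the table -/

/-- A smooth even function on `(-ε, ε)` vanishing at the origin. -/
structure IsProfile (ε : ℝ) (α : ℝ → ℝ) : Prop where
  pos : 0 < ε
  smooth : ContDiffOn ℝ ∞ α (Ioo (-ε) ε)
  even : ∀ t ∈ Ioo (-ε) ε, α (-t) = α t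
  zero : α 0 = 0

/-- Differentiate the symmetry relation. No differentiability is needed: the rules for `deriv` used
here hold unconditionally. -/
theorem deriv_neg_of_eventually {f : ℝ → ℝ} {s : ℝ} (h : ∀ᶠ t in 𝓝 (0 : ℝ), f (-t) = s * f t) :
    ∀ᶠ t in 𝓝 (0 : ℝ), deriv f (-t) = -s * deriv f t := by
  filter_upwards [h.eventually_nhds] with t ht
  have h1 : (fun t => f (-t)) =ᶠ[𝓝 t] fun t => s * f t := ht
  have h2 := h1.deriv_eq
  rw [deriv_comp_neg, deriv_const_mul_field] at h2
  linarith

namespace IsProfile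

variable {ε : ℝ} {α : ℝ → ℝ}

theorem zero_mem (h : IsProfile ε α) : (0 : ℝ) ∈ Ioo (-ε) ε := ⟨neg_lt_zero.mpr h.pos, h.pos⟩

theorem mem_nhds (h : IsProfile ε α) : Ioo (-ε) ε ∈ 𝓝 (0 : ℝ) := isOpen_Ioo.mem_nhds h.zero_mem

theorem smooth_iter (h : IsProfile ε α) (n : ℕ) : ContDiffOn ℝ ∞ (deriv^[n] α) (Ioo (-ε) ε) := by
  induction n with
  | zero => exact h.smooth
  | succ n ih =>
    rw [Function.iterate_succ_apply']
    exact ((contDiffOn_infty_iff_deriv_of_isOpen isOpen_Ioo).mp ih).2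

theorem hasDerivAt_iter (h : IsProfile ε α) (n : ℕ) {t : ℝ} (ht : t ∈ Ioo (-ε) ε) :
    HasDerivAt (deriv^[n] α) (deriv^[n + 1] α t) t := by
  rw [Function.iterate_succ_apply']
  exact (((h.smooth_iter n).contDiffAt (isOpen_Ioo.mem_nhds ht)).differentiableAt
    (by simp)).hasDerivAt

theorem iter_neg (h : IsProfile ε α) (n : ℕ) :
    ∀ᶠ t in 𝓝 (0 : ℝ), deriv^[n] α (-t) = (-1) ^ n * deriv^[n] α t := by
  induction n with
  | zero =>
    filter_upwards [h.mem_nhds] with t ht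
    simpa using h.even t ht
  | succ n ih =>
    simp only [Function.iterate_succ_apply']
    filter_upwards [deriv_neg_of_eventually ih] with t ht
    rw [ht, pow_succ]
    ring

theorem iter_odd (h : IsProfile ε α) {n : ℕ} (hn : Odd n) : deriv^[n] α 0 = 0 := by
  have := (h.iter_neg n).self_of_nhds
  rw [neg_zero, hn.neg_one_pow] at this
  linarith

theorem iter_jet (h : IsProfile ε α) (n : ℕ) :
    (fun t => deriv^[n] α t - deriv^[n] α 0) =O[𝓝 0] fun t : ℝ => t ^ 1 := by
  have := (h.hasDerivAt_iter n h.zero_mem).isBigO_sub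
  simpa using this

/-- The jets of the derivatives of `α` are obtained by integrating downwards from the fourth
derivative; the odd derivatives at the vertex vanish by evenness. -/
theorem jet_three (h : IsProfile ε α) :
    (fun t => deriv^[3] α t - deriv^[4] α 0 * t) =O[𝓝 0] fun t : ℝ => t ^ 2 := by
  refine isBigO_pow_succ_of_hasDerivAt ?_ ?_ (h.iter_jet 4)
  · filter_upwards [h.mem_nhds] with t ht
    have := (h.hasDerivAt_iter 3 ht).fun_sub ((hasDerivAt_id' t).const_mul (deriv^[4] α 0))
    simpa using this
  · rw [h.iter_odd (by decide)]
    simp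

theorem jet_two (h : IsProfile ε α) :
    (fun t => deriv^[2] α t - (deriv^[2] α 0 + deriv^[4] α 0 / 2 * t ^ 2)) =O[𝓝 0]
      fun t : ℝ => t ^ 3 := by
  refine isBigO_pow_succ_of_hasDerivAt ?_ (by simp) h.jet_three
  filter_upwards [h.mem_nhds] with t ht
  have := (h.hasDerivAt_iter 2 ht).fun_sub
    (((hasDerivAt_pow 2 t).const_mul (deriv^[4] α 0 / 2)).const_add (deriv^[2] α 0))
  refine this.congr_deriv ?_
  simp only [Nat.reduceAdd, Nat.reduceSub, pow_one, Nat.cast_ofNat]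
  ring

theorem jet_one (h : IsProfile ε α) :
    (fun t => deriv α t - (deriv^[2] α 0 * t + deriv^[4] α 0 / 6 * t ^ 3)) =O[𝓝 0]
      fun t : ℝ => t ^ 4 := by
  refine isBigO_pow_succ_of_hasDerivAt ?_ ?_ h.jet_two
  · filter_upwards [h.mem_nhds] with t ht
    have := (h.hasDerivAt_iter 1 ht).fun_sub
      (((hasDerivAt_id' t).const_mul (deriv^[2] α 0)).fun_add
        ((hasDerivAt_pow 3 t).const_mul (deriv^[4] α 0 / 6)))
    refine this.congr_deriv ?_
    simp only [Nat.reduceAdd, Nat.reduceSub, Nat.cast_ofNat]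
    ring
  · have := h.iter_odd (n := 1) (by decide)
    simp only [Function.iterate_one] at this
    simp [this]

theorem jet_zero (h : IsProfile ε α) :
    (fun t => α t - deriv^[2] α 0 / 2 * t ^ 2) =O[𝓝 0] fun t : ℝ => t ^ 4 := by
  have h3 : (fun t => deriv α t - deriv^[2] α 0 * t) =O[𝓝 0] fun t : ℝ => t ^ 3 := by
    have h1 := h.jet_one.trans (isLittleO_pow_pow (by norm_num : 3 < 4)).isBigO
    refine (h1.add ((isBigO_refl _ _).const_mul_left (deriv^[4] α 0 / 6))).congr_left fun t => ?_
    ring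
  refine isBigO_pow_succ_of_hasDerivAt ?_ ?_ h3
  · filter_upwards [h.mem_nhds] with t ht
    have := (h.hasDerivAt_iter 0 ht).fun_sub
      ((hasDerivAt_pow 2 t).const_mul (deriv^[2] α 0 / 2))
    refine this.congr_deriv ?_
    simp only [Nat.reduceAdd, Nat.reduceSub, pow_one, Nat.cast_ofNat, Function.iterate_one]
    ring
  · simp [h.zero]

end IsProfile

/-! ### Arc length -/

/-- The Minkowski length of `(w, 1)`. -/
def speed (a b w : ℝ) : ℝ := mixedNorm a b (w, 1)

theorem speed_eq (a b w : ℝ) :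
    speed a b w = a * √(w ^ 2 + 1) + b * (w ^ 4 + 1) ^ ((1 : ℝ) / 4) := by
  simp [speed, mixedNorm]

theorem speed_pos {a b : ℝ} (ha : 0 < a) (hb : 0 ≤ b) (w : ℝ) : 0 < speed a b w := by
  rw [speed_eq]
  positivity

theorem speed_zero {a b : ℝ} (hab : a + b = 1) : speed a b 0 = 1 := by
  simp [speed_eq, hab]

theorem contDiff_speed (a b : ℝ) : ContDiff ℝ ∞ (speed a b) := by
  have h : speed a b = fun w => a * √(w ^ 2 + 1) + b * (w ^ 4 + 1) ^ ((1 : ℝ) / 4) := by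
    ext w
    exact speed_eq a b w
  rw [h]
  refine (contDiff_const.mul (ContDiff.sqrt (by fun_prop) fun w => by positivity)).add
    (contDiff_const.mul (ContDiff.rpow_const_of_ne (by fun_prop) fun w => by positivity))

/-- The four-norm of `(w, 1)` is `1 + O(w⁴)`, so only the Euclidean part contributes a quadratic
term. -/
theorem speed_jet {a b : ℝ} (hab : a + b = 1) :
    (fun w => speed a b w - (1 + a / 2 * w ^ 2)) =O[𝓝 0] fun w : ℝ => w ^ 4 := by
  have ht : ∀ n : ℕ, n ≠ 0 → Tendsto (fun w : ℝ => w ^ n) (𝓝 0) (𝓝 0) := fun n hn => by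
    have : Continuous fun w : ℝ => w ^ n := by fun_prop
    simpa [hn] using this.tendsto 0
  have hid : HasDerivAt (fun y : ℝ => y + 1) 1 0 := (hasDerivAt_id' (0 : ℝ)).add_const 1
  have h1 : (fun y : ℝ => √(y + 1) - (1 + 1 / 2 * y)) =O[𝓝 0] fun y : ℝ => y ^ 2 := by
    have := isBigO_sub_affine (φ := fun y : ℝ => √(y + 1))
      (ContDiffAt.sqrt (by fun_prop) (by norm_num)) (hid.sqrt (by norm_num))
    simpa using this
  have h2 : (fun y : ℝ => (y + 1) ^ ((1 : ℝ) / 4) - 1) =O[𝓝 0] fun y : ℝ => y := by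
    have := (hid.rpow_const (p := (1 : ℝ) / 4) (by norm_num)).isBigO_sub
    simpa using this
  have e1 := h1.comp_tendsto (ht 2 two_ne_zero)
  have e2 := h2.comp_tendsto (ht 4 four_ne_zero)
  have e3 := (e1.const_mul_left a).add ((e2.const_mul_left b).congr_right
    (g₂ := (fun y : ℝ => y ^ 2) ∘ fun w : ℝ => w ^ 2) fun w => by simp [← pow_mul])
  refine (e3.congr_right fun w => ?_).congr_left fun w => ?_
  · simp [← pow_mul]
  · simp only [Function.comp_apply, speed_eq]
    linear_combination -hab

theorem arcLength_zero (a b : ℝ) (α : ℝ → ℝ) : arcLength a b α 0 = 0 := by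
  simp [arcLength]

namespace IsProfile

variable {a b ε : ℝ} {α : ℝ → ℝ}

theorem hasDerivAt (h : IsProfile ε α) {t : ℝ} (ht : t ∈ Ioo (-ε) ε) :
    HasDerivAt α (deriv α t) t := h.hasDerivAt_iter 0 ht

theorem smooth_deriv (h : IsProfile ε α) : ContDiffOn ℝ ∞ (deriv α) (Ioo (-ε) ε) :=
  h.smooth_iter 1

theorem deriv_zero (h : IsProfile ε α) : deriv α 0 = 0 := h.iter_odd (n := 1) (by decide)

theorem smooth_speed (h : IsProfile ε α) (a b : ℝ) :
    ContDiffOn ℝ ∞ (fun t => speed a b (deriv α t)) (Ioo (-ε) ε) :=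
  (contDiff_speed a b).comp_contDiffOn h.smooth_deriv

theorem hasDerivAt_arcLength (h : IsProfile ε α) (a b : ℝ) {t : ℝ} (ht : t ∈ Ioo (-ε) ε) :
    HasDerivAt (arcLength a b α) (speed a b (deriv α t)) t := by
  have hc := (h.smooth_speed a b).continuousOn
  have hsub : uIcc 0 t ⊆ Ioo (-ε) ε := ordConnected_Ioo.uIcc_subset h.zero_mem ht
  exact intervalIntegral.integral_hasDerivAt_right ((hc.mono hsub).intervalIntegrable)
    (hc.stronglyMeasurableAtFilter isOpen_Ioo t ht) (hc.continuousAt (isOpen_Ioo.mem_nhds ht))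

theorem smooth_arcLength (h : IsProfile ε α) (a b : ℝ) :
    ContDiffOn ℝ ∞ (arcLength a b α) (Ioo (-ε) ε) := by
  refine (contDiffOn_infty_iff_deriv_of_isOpen isOpen_Ioo).mpr ⟨fun t ht =>
    (h.hasDerivAt_arcLength a b ht).differentiableAt.differentiableWithinAt, ?_⟩
  exact (h.smooth_speed a b).congr fun t ht => (h.hasDerivAt_arcLength a b ht).deriv

theorem strictMonoOn_arcLength (h : IsProfile ε α) (ha : 0 < a) (hb : 0 ≤ b) :
    StrictMonoOn (arcLength a b α) (Ioo (-ε) ε) := by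
  refine strictMonoOn_of_deriv_pos (convex_Ioo _ _) (h.smooth_arcLength a b).continuousOn ?_
  intro t ht
  rw [interior_Ioo] at ht
  rw [(h.hasDerivAt_arcLength a b ht).deriv]
  exact speed_pos ha hb _

theorem height_arcLength (h : IsProfile ε α) (ha : 0 < a) (hb : 0 ≤ b) {t : ℝ}
    (ht : t ∈ Ioo (-ε) ε) : height a b ε α (arcLength a b α t) = t :=
  (h.strictMonoOn_arcLength ha hb).injOn.leftInvOn_invFunOn ht

theorem height_zero (h : IsProfile ε α) (ha : 0 < a) (hb : 0 ≤ b) : height a b ε α 0 = 0 := by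
  have := h.height_arcLength ha hb h.zero_mem
  rwa [arcLength_zero] at this

theorem smooth_height (h : IsProfile ε α) (ha : 0 < a) (hb : 0 ≤ b) {t : ℝ}
    (ht : t ∈ Ioo (-ε) ε) : ContDiffAt ℝ ∞ (height a b ε α) (arcLength a b α t) := by
  have hc : ContDiffAt ℝ ∞ (arcLength a b α) t :=
    (h.smooth_arcLength a b).contDiffAt (isOpen_Ioo.mem_nhds ht)
  have hd := h.hasDerivAt_arcLength a b ht
  have hne : speed a b (deriv α t) ≠ 0 := (speed_pos ha hb _).ne'
  have hd' : HasFDerivAt (arcLength a b α)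
      ((ContinuousLinearEquiv.unitsEquivAut ℝ (Units.mk0 _ hne) : ℝ ≃L[ℝ] ℝ) : ℝ →L[ℝ] ℝ) t :=
    (hd.hasFDerivAt_equiv hne)
  set e := hc.toOpenPartialHomeomorph _ hd' (by simp) with he
  have hmem : t ∈ e.source := hc.mem_toOpenPartialHomeomorph_source hd' (by simp)
  have hcoe : ⇑e = arcLength a b α := hc.toOpenPartialHomeomorph_coe hd' (by simp)
  have hsymm : ContDiffAt ℝ ∞ e.symm (arcLength a b α t) := by
    have := hc.to_localInverse hd' (by simp)
    exact this
  -- The local inverse from the inverse function theorem coincides with `height` near this point,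
  -- since arc length is injective on the whole interval and the local inverse takes values there.
  refine hsymm.congr_of_eventuallyEq ?_
  have htgt : arcLength a b α t ∈ e.target := by rw [← hcoe]; exact e.map_source hmem
  have h1 : e.symm (arcLength a b α t) = t := by
    rw [← hcoe]
    exact e.left_inv hmem
  have h2 : ∀ᶠ s in 𝓝 (arcLength a b α t), e.symm s ∈ Ioo (-ε) ε := by
    refine hsymm.continuousAt.eventually ?_
    rw [h1]
    exact isOpen_Ioo.mem_nhds ht
  filter_upwards [h2, e.open_target.mem_nhds htgt] with s hs hst
  have h3 := h.height_arcLength ha hb hs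
  rwa [← hcoe, e.right_inv hst] at h3

/-- Arc length has nonzero strict derivative, so it maps neighbourhoods of `t` onto neighbourhoods
of its image. -/
theorem params_mem_nhds (h : IsProfile ε α) (ha : 0 < a) (hb : 0 ≤ b) {t : ℝ}
    (ht : t ∈ Ioo (-ε) ε) : ∀ᶠ s in 𝓝 (arcLength a b α t), s ∈ params a b ε α ∧
      arcLength a b α (height a b ε α s) = s ∧ height a b ε α s ∈ Ioo (-ε) ε := by
  have hd : HasStrictDerivAt (arcLength a b α) (speed a b (deriv α t)) t :=
    (((h.smooth_arcLength a b).contDiffAt (isOpen_Ioo.mem_nhds ht)).hasStrictDerivAt'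
      (h.hasDerivAt_arcLength a b ht) (by simp))
  have hmap := hd.map_nhds_eq (speed_pos ha hb _).ne'
  rw [← hmap, eventually_map]
  filter_upwards [isOpen_Ioo.mem_nhds ht] with x hx
  rw [h.height_arcLength ha hb hx]
  exact ⟨⟨x, hx, rfl⟩, rfl, hx⟩

theorem hasDerivAt_height (h : IsProfile ε α) (ha : 0 < a) (hb : 0 ≤ b) {t : ℝ}
    (ht : t ∈ Ioo (-ε) ε) : HasDerivAt (height a b ε α) (speed a b (deriv α t))⁻¹
      (arcLength a b α t) := by
  refine HasDerivAt.of_local_left_inverse (f := arcLength a b α)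
    ((h.smooth_height ha hb ht).continuousAt) ?_
    (speed_pos ha hb _).ne' ?_
  · rw [h.height_arcLength ha hb ht]
    exact h.hasDerivAt_arcLength a b ht
  · exact (h.params_mem_nhds ha hb ht).mono fun s hs => hs.2.1

/-- The speed is `1 + a α'²/2` up to fourth order in `α'`, and `α' = α''(0) t + O(t³)`; integrate.
-/
theorem arcLength_jet (h : IsProfile ε α) (hab : a + b = 1) :
    (fun t => arcLength a b α t - (t + a * deriv^[2] α 0 ^ 2 / 6 * t ^ 3)) =O[𝓝 0]
      fun t : ℝ => t ^ 4 := by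
  have htend : Tendsto (deriv α) (𝓝 0) (𝓝 0) := by
    have := ((h.smooth_deriv).contDiffAt h.mem_nhds).continuousAt.tendsto
    rwa [h.deriv_zero] at this
  have hO : deriv α =O[𝓝 0] fun t : ℝ => t := by
    have := (h.hasDerivAt_iter 1 h.zero_mem).isBigO_sub
    simpa [h.deriv_zero] using this
  have hlin : (fun t => deriv α t - deriv^[2] α 0 * t) =O[𝓝 0] fun t : ℝ => t ^ 3 := by
    have h1 := h.jet_one.trans (isLittleO_pow_pow (by norm_num : 3 < 4)).isBigO
    refine (h1.add ((isBigO_refl _ _).const_mul_left (deriv^[4] α 0 / 6))).congr_left fun t => ?_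
    ring
  have h1 : (fun t => speed a b (deriv α t) - (1 + a / 2 * deriv α t ^ 2)) =O[𝓝 0]
      fun t : ℝ => t ^ 3 :=
    (((speed_jet hab).comp_tendsto htend).trans (hO.pow 4)).trans
      (isLittleO_pow_pow (by norm_num : 3 < 4)).isBigO
  have h2 : (fun t => (deriv α t - deriv^[2] α 0 * t) * (deriv α t + deriv^[2] α 0 * t)) =O[𝓝 0]
      fun t : ℝ => t ^ 3 := by
    have h3 : (fun t => deriv α t + deriv^[2] α 0 * t) =O[𝓝 0] fun t : ℝ => t :=
      hO.add ((isBigO_refl _ _).const_mul_left _)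
    refine ((hlin.mul h3).congr_right fun t => (pow_succ t 3).symm).trans
      (isLittleO_pow_pow (by norm_num : 3 < 4)).isBigO
  refine isBigO_pow_succ_of_hasDerivAt (φ' := fun t => speed a b (deriv α t) -
    (1 + a * deriv^[2] α 0 ^ 2 / 2 * t ^ 2)) ?_ (by simp [arcLength_zero]) ?_
  · filter_upwards [h.mem_nhds] with t ht
    have := (h.hasDerivAt_arcLength a b ht).fun_sub ((hasDerivAt_id' t).fun_add
      ((hasDerivAt_pow 3 t).const_mul (a * deriv^[2] α 0 ^ 2 / 6)))
    refine this.congr_deriv ?_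
    simp only [Nat.reduceSub, Nat.cast_ofNat]
    ring
  · refine (h1.add (h2.const_mul_left (a / 2))).congr_left fun t => ?_
    ring

/-! ### The radius of curvature at the vertex -/

theorem radius_zero (h : IsProfile ε α) (ha : 0 < a) (hb : 0 ≤ b) :
    radius a b ε α 0 = 1 / deriv^[2] α 0 := by
  simp [radius, h.height_zero ha hb, h.deriv_zero]

/-- The second derivative of the radius of curvature at the vertex. -/
theorem iteratedDeriv_radius (h : IsProfile ε α) (ha : 0 < a) (hb : 0 ≤ b) (hab : a + b = 1)
    (hα : deriv^[2] α 0 ≠ 0) :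
    iteratedDeriv 2 (radius a b ε α) 0 = 3 * deriv^[2] α 0 -
      deriv^[4] α 0 / deriv^[2] α 0 ^ 2 := by
  set H := height a b ε α with hH
  have hH0 : H 0 = 0 := h.height_zero ha hb
  have hHd : HasDerivAt H 1 0 := by
    have := h.hasDerivAt_height ha hb h.zero_mem
    rwa [h.deriv_zero, speed_zero hab, inv_one, arcLength_zero] at this
  have hHs : ContDiffAt ℝ ∞ H 0 := by
    have := h.smooth_height ha hb h.zero_mem
    rwa [arcLength_zero] at this
  -- Only existence of the second derivative of the height matters: in the second derivative of the
  -- composition it is multiplied by the first derivative of the radius with respect to `t`, which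
  -- vanishes at the vertex.
  have hH' : DifferentiableAt ℝ (deriv H) 0 := by
    have h3 : ContDiffAt ℝ 1 (fun x => fderiv ℝ H x 1) 0 :=
      (hHs.fderiv_right (m := 1) (by norm_cast)).clm_apply contDiffAt_const
    simp only [fderiv_apply_one_eq_deriv] at h3
    exact h3.differentiableAt (by simp)
  have hHd0 : deriv H 0 = 1 := hHd.deriv
  set ρ' : ℝ → ℝ := fun t => 3 * deriv α t * √(1 + deriv α t ^ 2) -
    (1 + deriv α t ^ 2) ^ ((3 : ℝ) / 2) * deriv^[3] α t / deriv^[2] α t ^ 2 with hρ'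
  have hρ : ∀ᶠ t in 𝓝 (0 : ℝ), HasDerivAt
      (fun t => (1 + deriv α t ^ 2) ^ ((3 : ℝ) / 2) / deriv (deriv α) t) (ρ' t) t := by
    have hne : ∀ᶠ t in 𝓝 (0 : ℝ), deriv^[2] α t ≠ 0 :=
      (h.hasDerivAt_iter 2 h.zero_mem).continuousAt.eventually_ne hα
    filter_upwards [hne, h.mem_nhds] with t ht hm
    have h1 : HasDerivAt (deriv α) (deriv^[2] α t) t := h.hasDerivAt_iter 1 hm
    have h2 : HasDerivAt (deriv (deriv α)) (deriv^[3] α t) t := h.hasDerivAt_iter 2 hm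
    have h3 : HasDerivAt (fun t => (1 + deriv α t ^ 2) ^ ((3 : ℝ) / 2))
        (3 * deriv α t * deriv^[2] α t * √(1 + deriv α t ^ 2)) t := by
      have := ((h1.fun_pow 2).const_add 1).rpow_const (p := (3 : ℝ) / 2)
        (Or.inl (by positivity))
      refine this.congr_deriv ?_
      rw [Real.sqrt_eq_rpow, show (3 : ℝ) / 2 - 1 = 1 / 2 by norm_num]
      simp only [Nat.reduceSub, pow_one, Nat.cast_ofNat]
      ring
    have h4 := h3.fun_div h2 ht
    refine h4.congr_deriv ?_
    have : deriv (deriv α) t = deriv^[2] α t := rfl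
    simp only [hρ', this]
    field_simp
  have hHt : Tendsto H (𝓝 0) (𝓝 0) := by
    have := hHd.continuousAt.tendsto
    rwa [hH0] at this
  have hfirst : deriv (radius a b ε α) =ᶠ[𝓝 0] fun s => ρ' (H s) * deriv H s := by
    filter_upwards [hHt.eventually hρ, (hHs.of_le (m := 1) (by simp)).eventually (by simp)] with s hs hs'
    exact (HasDerivAt.comp s hs (hs'.differentiableAt (by simp)).hasDerivAt).deriv
  have hρ0 : ρ' 0 = 0 := by
    have e3 : deriv (deriv (deriv α)) 0 = 0 := h.iter_odd (n := 3) (by decide)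
    simp [hρ', h.deriv_zero, e3]
  have hρd : HasDerivAt ρ' (3 * deriv^[2] α 0 - deriv^[4] α 0 / deriv^[2] α 0 ^ 2) 0 := by
    have h1 : HasDerivAt (deriv α) (deriv^[2] α 0) 0 := h.hasDerivAt_iter 1 h.zero_mem
    have h2 : HasDerivAt (deriv^[2] α) (deriv^[3] α 0) 0 := h.hasDerivAt_iter 2 h.zero_mem
    have h3 : HasDerivAt (deriv^[3] α) (deriv^[4] α 0) 0 := h.hasDerivAt_iter 3 h.zero_mem
    have hpos : (1 : ℝ) + deriv α 0 ^ 2 ≠ 0 := by positivity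
    have hbase := (h1.fun_pow 2).const_add 1
    have := ((h1.const_mul 3).fun_mul (hbase.sqrt hpos)).fun_sub
      (((hbase.rpow_const (p := (3 : ℝ) / 2) (Or.inl hpos)).fun_mul h3).fun_div (h2.fun_pow 2)
        (pow_ne_zero 2 hα))
    refine this.congr_deriv ?_
    have e3 : deriv^[3] α 0 = 0 := h.iter_odd (by decide)
    rw [h.deriv_zero, e3]
    simp
    field_simp
  have hρd' : HasDerivAt ρ' (3 * deriv^[2] α 0 - deriv^[4] α 0 / deriv^[2] α 0 ^ 2) (H 0) := by
    rwa [hH0]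
  have hprod := (HasDerivAt.comp (0 : ℝ) hρd' hHd).fun_mul hH'.hasDerivAt
  rw [iteratedDeriv_succ, iteratedDeriv_one, hfirst.deriv_eq]
  refine hprod.deriv.trans ?_
  simp [hH0, hρ0, hHd0]

end IsProfile

/-! ### The gradient of the mixed norm -/

/-- First partial derivative of the mixed norm. -/
def gradOne (a b : ℝ) (v : ℝ × ℝ) : ℝ :=
  a * (v.1 / √(v.1 ^ 2 + v.2 ^ 2)) + b * (v.1 ^ 3 * (v.1 ^ 4 + v.2 ^ 4) ^ (-(3 : ℝ) / 4))

/-- Second partial derivative of the mixed norm. -/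
def gradTwo (a b : ℝ) (v : ℝ × ℝ) : ℝ :=
  a * (v.2 / √(v.1 ^ 2 + v.2 ^ 2)) + b * (v.2 ^ 3 * (v.1 ^ 4 + v.2 ^ 4) ^ (-(3 : ℝ) / 4))

theorem sq_add_sq_pos {v : ℝ × ℝ} (hv : v ≠ 0) : 0 < v.1 ^ 2 + v.2 ^ 2 := by
  rcases eq_or_ne v.1 0 with h | h
  · have : v.2 ≠ 0 := fun h2 => hv (Prod.ext h h2)
    positivity
  · positivity

theorem pow_four_add_pos {v : ℝ × ℝ} (hv : v ≠ 0) : 0 < v.1 ^ 4 + v.2 ^ 4 := by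
  rcases eq_or_ne v.1 0 with h | h
  · have : v.2 ≠ 0 := fun h2 => hv (Prod.ext h h2)
    positivity
  · positivity

theorem hasDerivAt_mixedNorm {a b : ℝ} {c : ℝ → ℝ × ℝ} {c' : ℝ × ℝ} {σ : ℝ}
    (hc : HasDerivAt c c' σ) (hne : c σ ≠ 0) :
    HasDerivAt (fun σ => mixedNorm a b (c σ))
      (gradOne a b (c σ) * c'.1 + gradTwo a b (c σ) * c'.2) σ := by
  have h1 : HasDerivAt (fun σ => (c σ).1) c'.1 σ := (hasFDerivAt_fst (𝕜 := ℝ) (p := c σ)).comp_hasDerivAt σ hc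
  have h2 : HasDerivAt (fun σ => (c σ).2) c'.2 σ := (hasFDerivAt_snd (𝕜 := ℝ) (p := c σ)).comp_hasDerivAt σ hc
  have hs := ((h1.fun_pow 2).fun_add (h2.fun_pow 2)).sqrt (sq_add_sq_pos hne).ne'
  have hf := ((h1.fun_pow 4).fun_add (h2.fun_pow 4)).rpow_const (p := (1 : ℝ) / 4)
    (Or.inl (pow_four_add_pos hne).ne')
  refine ((hs.const_mul a).fun_add (hf.const_mul b)).congr_deriv ?_
  rw [show (1 : ℝ) / 4 - 1 = -3 / 4 by norm_num]
  have := Real.sqrt_pos.mpr (sq_add_sq_pos hne)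
  simp only [gradOne, gradTwo, Nat.cast_ofNat, Nat.reduceSub, pow_one]
  field_simp
  ring

/-! ### Homogeneity of the norm and of its gradient, and bounds on the gradient -/

theorem mixedNorm_smul {a b l : ℝ} (hl : 0 ≤ l) (v : ℝ × ℝ) :
    mixedNorm a b (l • v) = l * mixedNorm a b v := by
  have h1 : √((l * v.1) ^ 2 + (l * v.2) ^ 2) = l * √(v.1 ^ 2 + v.2 ^ 2) := by
    rw [show (l * v.1) ^ 2 + (l * v.2) ^ 2 = l ^ 2 * (v.1 ^ 2 + v.2 ^ 2) by ring,
      Real.sqrt_mul (sq_nonneg l), Real.sqrt_sq hl]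
  have h2 : ((l * v.1) ^ 4 + (l * v.2) ^ 4) ^ ((1 : ℝ) / 4) =
      l * (v.1 ^ 4 + v.2 ^ 4) ^ ((1 : ℝ) / 4) := by
    rw [show (l * v.1) ^ 4 + (l * v.2) ^ 4 = l ^ 4 * (v.1 ^ 4 + v.2 ^ 4) by ring,
      Real.mul_rpow (by positivity) (by positivity), ← Real.rpow_natCast l 4, ← Real.rpow_mul hl]
    norm_num
  simp only [mixedNorm, Prod.smul_fst, Prod.smul_snd, smul_eq_mul, h1, h2]
  ring

theorem mixedNorm_neg (a b : ℝ) (v : ℝ × ℝ) : mixedNorm a b (-v) = mixedNorm a b v := by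
  simp only [mixedNorm, Prod.fst_neg, Prod.snd_neg, even_two.neg_pow,
    (by decide : Even 4).neg_pow]

theorem mixedNorm_pos {a b : ℝ} (ha : 0 < a) (hb : 0 ≤ b) {v : ℝ × ℝ} (hv : v ≠ 0) :
    0 < mixedNorm a b v := by
  have h1 := Real.sqrt_pos.mpr (sq_add_sq_pos hv)
  have h2 := pow_four_add_pos hv
  unfold mixedNorm
  positivity

theorem rpow_scale {l : ℝ} (hl : 0 < l) (v : ℝ × ℝ) :
    l ^ 3 * ((l * v.1) ^ 4 + (l * v.2) ^ 4) ^ (-(3 : ℝ) / 4) =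
      (v.1 ^ 4 + v.2 ^ 4) ^ (-(3 : ℝ) / 4) := by
  rw [show (l * v.1) ^ 4 + (l * v.2) ^ 4 = l ^ 4 * (v.1 ^ 4 + v.2 ^ 4) by ring,
    Real.mul_rpow (by positivity) (by positivity), ← mul_assoc, ← Real.rpow_natCast l 4,
    ← Real.rpow_mul hl.le, ← Real.rpow_natCast l 3, ← Real.rpow_add hl]
  norm_num

theorem sqrt_scale {l : ℝ} (hl : 0 < l) (v : ℝ × ℝ) :
    √((l * v.1) ^ 2 + (l * v.2) ^ 2) = l * √(v.1 ^ 2 + v.2 ^ 2) := by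
  rw [show (l * v.1) ^ 2 + (l * v.2) ^ 2 = l ^ 2 * (v.1 ^ 2 + v.2 ^ 2) by ring,
    Real.sqrt_mul (sq_nonneg l), Real.sqrt_sq hl.le]

theorem gradOne_smul {a b l : ℝ} (hl : 0 < l) (v : ℝ × ℝ) :
    gradOne a b (l • v) = gradOne a b v := by
  simp only [gradOne, Prod.smul_fst, Prod.smul_snd, smul_eq_mul]
  rw [← rpow_scale hl v, sqrt_scale hl, mul_div_mul_left _ _ hl.ne']
  ring

theorem gradTwo_smul {a b l : ℝ} (hl : 0 < l) (v : ℝ × ℝ) :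
    gradTwo a b (l • v) = gradTwo a b v := by
  simp only [gradTwo, Prod.smul_fst, Prod.smul_snd, smul_eq_mul]
  rw [← rpow_scale hl v, sqrt_scale hl, mul_div_mul_left _ _ hl.ne']
  ring

theorem gradOne_neg (a b : ℝ) (v : ℝ × ℝ) : gradOne a b (-v) = -gradOne a b v := by
  simp only [gradOne, Prod.fst_neg, Prod.snd_neg, even_two.neg_pow,
    (by decide : Even 4).neg_pow, (by decide : Odd 3).neg_pow]
  ring

theorem gradTwo_neg (a b : ℝ) (v : ℝ × ℝ) : gradTwo a b (-v) = -gradTwo a b v := by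
  simp only [gradTwo, Prod.fst_neg, Prod.snd_neg, even_two.neg_pow,
    (by decide : Even 4).neg_pow, (by decide : Odd 3).neg_pow]
  ring

theorem abs_gradOne_le {a b : ℝ} (ha : 0 ≤ a) (hb : 0 ≤ b) {v : ℝ × ℝ} (hv : v ≠ 0) :
    |gradOne a b v| ≤ a + b := by
  have h1 := Real.sqrt_pos.mpr (sq_add_sq_pos hv)
  have h2 := pow_four_add_pos hv
  have e1 : |v.1 / √(v.1 ^ 2 + v.2 ^ 2)| ≤ 1 := by
    rw [abs_div, abs_of_pos h1, div_le_one h1]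
    exact Real.abs_le_sqrt (by nlinarith [sq_nonneg v.2])
  have e2 : |v.1 ^ 3 * (v.1 ^ 4 + v.2 ^ 4) ^ (-(3 : ℝ) / 4)| ≤ 1 := by
    have h3 : |v.1| ^ 3 ≤ (v.1 ^ 4 + v.2 ^ 4) ^ ((3 : ℝ) / 4) := by
      have h4 : |v.1| ^ 3 = (v.1 ^ 4) ^ ((3 : ℝ) / 4) := by
        rw [← (by decide : Even 4).pow_abs, ← Real.rpow_natCast |v.1| 4,
          ← Real.rpow_mul (abs_nonneg _), ← Real.rpow_natCast |v.1| 3]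
        norm_num
      rw [h4]
      exact Real.rpow_le_rpow (by positivity) (by nlinarith [sq_nonneg (v.2 ^ 2)]) (by norm_num)
    have h5 : (v.1 ^ 4 + v.2 ^ 4) ^ (-(3 : ℝ) / 4) = ((v.1 ^ 4 + v.2 ^ 4) ^ ((3 : ℝ) / 4))⁻¹ := by
      rw [neg_div, Real.rpow_neg h2.le]
    have h6 := Real.rpow_pos_of_pos h2 ((3 : ℝ) / 4)
    rw [h5, abs_mul, abs_pow, abs_inv, abs_of_pos h6, ← div_eq_mul_inv, div_le_one h6]
    exact h3
  unfold gradOne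
  refine (abs_add_le _ _).trans ?_
  rw [abs_mul, abs_mul, abs_of_nonneg ha, abs_of_nonneg hb]
  nlinarith

/-- Both summands of the second partial derivative have the sign of `v.2`, so dropping the four-norm
part leaves a lower bound. This is how a small momentum forces a small slope. -/
theorem le_abs_gradTwo {a b : ℝ} (hb : 0 ≤ b) {v : ℝ × ℝ} (hv : v ≠ 0) :
    a * |v.2| ≤ |gradTwo a b v| * √(v.1 ^ 2 + v.2 ^ 2) := by
  have h1 := Real.sqrt_pos.mpr (sq_add_sq_pos hv)
  have h2 := Real.rpow_nonneg (pow_four_add_pos hv).le (-(3 : ℝ) / 4)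
  rcases eq_or_ne v.2 0 with h0 | h0
  · rw [h0, abs_zero, mul_zero]
    positivity
  · have h3 : 0 < |v.2| := abs_pos.mpr h0
    have h4 : a * v.2 ^ 2 ≤ v.2 * gradTwo a b v * √(v.1 ^ 2 + v.2 ^ 2) := by
      have : v.2 * gradTwo a b v * √(v.1 ^ 2 + v.2 ^ 2) = a * v.2 ^ 2 +
          b * (v.2 ^ 4 * (v.1 ^ 4 + v.2 ^ 4) ^ (-(3 : ℝ) / 4)) * √(v.1 ^ 2 + v.2 ^ 2) := by
        unfold gradTwo
        field_simp
      rw [this]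
      have : 0 ≤ b * (v.2 ^ 4 * (v.1 ^ 4 + v.2 ^ 4) ^ (-(3 : ℝ) / 4)) * √(v.1 ^ 2 + v.2 ^ 2) := by
        positivity
      linarith
    have h5 : v.2 * gradTwo a b v ≤ |v.2| * |gradTwo a b v| := by
      rw [← abs_mul]
      exact le_abs_self _
    have h6 : |v.2| * (a * |v.2|) ≤ |v.2| * (|gradTwo a b v| * √(v.1 ^ 2 + v.2 ^ 2)) := by
      have : |v.2| * (a * |v.2|) = a * v.2 ^ 2 := by
        rw [← sq_abs]
        ring
      rw [this]
      nlinarith [mul_le_mul_of_nonneg_right h5 h1.le]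
    exact le_of_mul_le_mul_left h6 h3

/-! ### Tangential momentum -/

/-- The derivative of `F (y - γ)` along the left end `γ` at height `t`, where `y - γ` has the
direction of `v`. -/
def momentum (a b : ℝ) (α : ℝ → ℝ) (t : ℝ) (v : ℝ × ℝ) : ℝ :=
  -((gradOne a b v * deriv α t + gradTwo a b v) * (speed a b (deriv α t))⁻¹)

theorem momentum_smul {a b l : ℝ} (hl : 0 < l) (α : ℝ → ℝ) (t : ℝ) (v : ℝ × ℝ) :
    momentum a b α t (l • v) = momentum a b α t v := by
  simp only [momentum, gradOne_smul hl, gradTwo_smul hl]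

theorem momentum_neg (a b : ℝ) (α : ℝ → ℝ) (t : ℝ) (v : ℝ × ℝ) :
    momentum a b α t (-v) = -momentum a b α t v := by
  simp only [momentum, gradOne_neg, gradTwo_neg]
  ring

namespace IsProfile

variable {a b ε : ℝ} {α : ℝ → ℝ}

theorem leftCurve_arcLength (h : IsProfile ε α) (ha : 0 < a) (hb : 0 ≤ b) {t : ℝ}
    (ht : t ∈ Ioo (-ε) ε) : leftCurve a b ε α (arcLength a b α t) = (α t, t) := by
  simp only [leftCurve, h.height_arcLength ha hb ht]

theorem rightCurve_arcLength (h : IsProfile ε α) (ha : 0 < a) (hb : 0 ≤ b) (L : ℝ) {t : ℝ}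
    (ht : t ∈ Ioo (-ε) ε) : rightCurve a b L ε α (arcLength a b α t) = (L - α t, -t) := by
  simp only [rightCurve, h.height_arcLength ha hb ht]

theorem hasDerivAt_leftCurve (h : IsProfile ε α) (ha : 0 < a) (hb : 0 ≤ b) {t : ℝ}
    (ht : t ∈ Ioo (-ε) ε) : HasDerivAt (leftCurve a b ε α)
      (deriv α t * (speed a b (deriv α t))⁻¹, (speed a b (deriv α t))⁻¹)
      (arcLength a b α t) := by
  have h1 := h.hasDerivAt_height ha hb ht
  have h2 : HasDerivAt α (deriv α t) (height a b ε α (arcLength a b α t)) := by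
    rw [h.height_arcLength ha hb ht]
    exact h.hasDerivAt ht
  exact (HasDerivAt.comp _ h2 h1).prodMk h1

theorem hasDerivAt_rightCurve (h : IsProfile ε α) (ha : 0 < a) (hb : 0 ≤ b) (L : ℝ) {t : ℝ}
    (ht : t ∈ Ioo (-ε) ε) : HasDerivAt (rightCurve a b L ε α)
      (-(deriv α t * (speed a b (deriv α t))⁻¹, (speed a b (deriv α t))⁻¹))
      (arcLength a b α t) := by
  refine ((h.hasDerivAt_leftCurve ha hb ht).const_sub (L, 0)).congr_of_eventuallyEq
    (.of_forall fun s => ?_)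
  simp [leftCurve, rightCurve]

theorem hasDerivAt_sub_leftCurve (h : IsProfile ε α) (ha : 0 < a) (hb : 0 ≤ b) {t : ℝ}
    (ht : t ∈ Ioo (-ε) ε) {y : ℝ × ℝ} (hy : y - (α t, t) ≠ 0) :
    HasDerivAt (fun σ => mixedNorm a b (y - leftCurve a b ε α σ))
      (momentum a b α t (y - (α t, t))) (arcLength a b α t) := by
  have h1 := (h.hasDerivAt_leftCurve ha hb ht).const_sub y
  have h2 := hasDerivAt_mixedNorm (a := a) (b := b) h1
    (by rwa [h.leftCurve_arcLength ha hb ht])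
  rw [h.leftCurve_arcLength ha hb ht] at h2
  refine h2.congr_deriv ?_
  simp only [momentum, Prod.fst_neg, Prod.snd_neg]
  ring

theorem hasDerivAt_rightCurve_sub (h : IsProfile ε α) (ha : 0 < a) (hb : 0 ≤ b) (L : ℝ) {t : ℝ}
    (ht : t ∈ Ioo (-ε) ε) {x : ℝ × ℝ} (hx : (L - α t, -t) - x ≠ 0) :
    HasDerivAt (fun σ => mixedNorm a b (rightCurve a b L ε α σ - x))
      (momentum a b α t ((L - α t, -t) - x)) (arcLength a b α t) := by
  have h1 := (h.hasDerivAt_rightCurve ha hb L ht).sub_const x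
  have h2 := hasDerivAt_mixedNorm (a := a) (b := b) h1
    (by rwa [h.rightCurve_arcLength ha hb L ht])
  rw [h.rightCurve_arcLength ha hb L ht] at h2
  refine h2.congr_deriv ?_
  simp only [momentum, Prod.fst_neg, Prod.snd_neg]
  ring

theorem hasDerivAt_sub_rightCurve (h : IsProfile ε α) (ha : 0 < a) (hb : 0 ≤ b) (L : ℝ) {t : ℝ}
    (ht : t ∈ Ioo (-ε) ε) {y : ℝ × ℝ} (hy : y - (L - α t, -t) ≠ 0) :
    HasDerivAt (fun σ => mixedNorm a b (y - rightCurve a b L ε α σ))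
      (-momentum a b α t (y - (L - α t, -t))) (arcLength a b α t) := by
  have h1 := h.hasDerivAt_rightCurve_sub ha hb L ht (x := y)
    (by rwa [← neg_sub, neg_ne_zero])
  rw [← momentum_neg, neg_sub]
  refine h1.congr_of_eventuallyEq (.of_forall fun σ => ?_)
  show mixedNorm a b (y - rightCurve a b L ε α σ) = mixedNorm a b (rightCurve a b L ε α σ - y)
  rw [← mixedNorm_neg, neg_sub]

/-- The billiard step in terms of heights and directions. -/
theorem of_reducedStep (h : IsProfile ε α) (ha : 0 < a) (hb : 0 ≤ b) {L : ℝ} {p q : ℝ × ℝ}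
    (hpq : ReducedStep a b L ε α p q) : ∃ t ∈ Ioo (-ε) ε, ∃ t₁ ∈ Ioo (-ε) ε, ∃ v : ℝ × ℝ,
      mixedNorm a b v = 1 ∧ FirstHit (table L ε α) (α t, t) v (L - α t₁, -t₁) ∧
      p = (arcLength a b α t, momentum a b α t v) ∧
      q = (arcLength a b α t₁, -momentum a b α t₁ v) := by
  obtain ⟨x, v, x₁, v₁, ⟨⟨t, ht, htp⟩, hx, hv, -, ⟨t', ht', rfl⟩, hhit', hder⟩,
    ⟨hhit, hv₁, -, ⟨t₁, ht₁, rfl⟩, hx₁, r, hr, -, hrefl⟩, ⟨⟨s, hs, hsq⟩, hxs, -, -, ⟨t₂, ht₂, rfl⟩,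
    hhit₂, hder₂⟩⟩ := hpq
  have ne_zero : ∀ {w : ℝ × ℝ}, mixedNorm a b w = 1 → w ≠ 0 := by
    rintro w hw rfl
    simp [mixedNorm] at hw
  have hv0 := ne_zero hv
  have hv₁0 := ne_zero hv₁
  rw [h.rightCurve_arcLength ha hb L ht'] at hhit' hder
  rw [h.rightCurve_arcLength ha hb L ht₁] at hx₁
  rw [h.rightCurve_arcLength ha hb L ht₂] at hhit₂ hder₂
  rw [← htp, h.leftCurve_arcLength ha hb ht] at hx
  rw [← hsq, h.leftCurve_arcLength ha hb hs] at hxs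
  subst hx hx₁
  -- The half turn carries the right point of parameter height `t₁` to the left point of height
  -- `t₁`.
  have hst : s = t₁ := by simpa [halfTurn] using (congrArg Prod.snd hxs).symm
  subst hst
  refine ⟨t, ht, s, hs, v, hv, hhit, ?_, ?_⟩
  · refine Prod.ext htp.symm ?_
    rw [← htp] at hder
    obtain ⟨l, hl, hl', -⟩ := hhit'
    have hw : (L - α t', -t') - (α t, t) = l • v := by rw [hl']; abel
    have h1 := h.hasDerivAt_sub_leftCurve ha hb ht (y := (L - α t', -t'))
      (by rw [hw]; exact smul_ne_zero hl.ne' hv0)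
    rw [hw, momentum_smul hl] at h1
    exact hder.unique h1
  · refine Prod.ext hsq.symm ?_
    rw [← hsq] at hder₂
    have e1 : q.2 = momentum a b α s (-v₁) := by
      obtain ⟨l, hl, hl', -⟩ := hhit₂
      have hw : (L - α t₂, -t₂) - (α s, s) = l • (-v₁) := by rw [hl', hxs]; abel
      have h1 := h.hasDerivAt_sub_leftCurve ha hb hs (y := (L - α t₂, -t₂))
        (by rw [hw]; exact smul_ne_zero hl.ne' (neg_ne_zero.mpr hv₁0))
      rw [hw, momentum_smul hl] at h1
      exact hder₂.unique h1
    -- The critical point condition: the incoming length contributes the momentum of `v` and the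
    -- outgoing length minus that of `v₁`.
    have e2 : momentum a b α s v = momentum a b α s v₁ := by
      obtain ⟨l, hl, hl', -⟩ := hhit
      have hw : (L - α s, -s) - (α t, t) = l • v := by rw [hl']; abel
      have hw' : (L - α s, -s) + r • v₁ - (L - α s, -s) = r • v₁ := by abel
      have h1 := h.hasDerivAt_rightCurve_sub ha hb L hs (x := (α t, t))
        (by rw [hw]; exact smul_ne_zero hl.ne' hv0)
      have h2 := h.hasDerivAt_sub_rightCurve ha hb L hs (y := (L - α s, -s) + r • v₁)
        (by rw [hw']; exact smul_ne_zero hr.ne' hv₁0)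
      rw [hw, momentum_smul hl] at h1
      rw [hw', momentum_smul hr] at h2
      have h3 := hrefl.unique (h1.fun_add h2)
      linarith
    rw [e1, momentum_neg, e2]

/-- Construction of a billiard step from heights and directions. -/
theorem reducedStep_of (h : IsProfile ε α) (ha : 0 < a) (hb : 0 ≤ b) {L t t₁ t₂ : ℝ}
    (ht : t ∈ Ioo (-ε) ε) (ht₁ : t₁ ∈ Ioo (-ε) ε) (ht₂ : t₂ ∈ Ioo (-ε) ε) {v w : ℝ × ℝ}
    (hv : mixedNorm a b v = 1) (hw : mixedNorm a b w = 1)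
    (hhit : FirstHit (table L ε α) (α t, t) v (L - α t₁, -t₁))
    (hhit₁ : FirstHit (table L ε α) (α t₁, t₁) w (L - α t₂, -t₂))
    (hrefl : momentum a b α t₁ v = -momentum a b α t₁ w) :
    ReducedStep a b L ε α (arcLength a b α t, momentum a b α t v)
      (arcLength a b α t₁, momentum a b α t₁ w) := by
  have ne_zero : ∀ {w : ℝ × ℝ}, mixedNorm a b w = 1 → w ≠ 0 := by
    rintro w hw rfl
    simp [mixedNorm] at hw
  have coords : ∀ {t t₁ : ℝ} {v : ℝ × ℝ}, t ∈ Ioo (-ε) ε → t₁ ∈ Ioo (-ε) ε →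
      mixedNorm a b v = 1 → FirstHit (table L ε α) (α t, t) v (L - α t₁, -t₁) →
      HasCoords a b L ε α (α t, t) v (arcLength a b α t, momentum a b α t v) := by
    intro t t₁ v ht ht₁ hv hhit
    refine ⟨⟨t, ht, rfl⟩, (h.leftCurve_arcLength ha hb ht).symm, hv, _, ⟨t₁, ht₁, rfl⟩, ?_, ?_⟩
    · rwa [h.rightCurve_arcLength ha hb L ht₁]
    · rw [h.rightCurve_arcLength ha hb L ht₁]
      obtain ⟨l, hl, hl', -⟩ := hhit
      have hw : (L - α t₁, -t₁) - (α t, t) = l • v := by rw [hl']; abel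
      have h1 := h.hasDerivAt_sub_leftCurve ha hb ht (y := (L - α t₁, -t₁))
        (by rw [hw]; exact smul_ne_zero hl.ne' (ne_zero hv))
      rwa [hw, momentum_smul hl] at h1
  refine ⟨(α t, t), v, (L - α t₁, -t₁), -w, coords ht ht₁ hv hhit,
    ⟨hhit, by rwa [mixedNorm_neg], _, ⟨t₁, ht₁, rfl⟩,
      (h.rightCurve_arcLength ha hb L ht₁).symm, ?_⟩, ?_⟩
  -- The reflected ray, in direction `-w`, is the half turn image of the next chord, and the table
  -- is invariant under the half turn. Stopping at `l / 2` keeps the closed segment strictly before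
  -- the hitting point.
  · obtain ⟨l, hl, hl', -, hin⟩ := hhit₁
    refine ⟨l / 2, by positivity, fun r' hr' hr'l => ?_, ?_⟩
    · obtain ⟨m1, m2, m3⟩ := hin r' hr' (by linarith)
      simp only [Prod.fst_add, Prod.snd_add, Prod.smul_fst, Prod.smul_snd, smul_eq_mul]
        at m1 m2 m3
      have hy := h.even _ (abs_lt.mp m1)
      have e1 : -t₁ + r' * -w.2 = -(t₁ + r' * w.2) := by ring
      refine ⟨?_, ?_, ?_⟩ <;>
        simp only [Prod.fst_add, Prod.snd_add, Prod.smul_fst, Prod.smul_snd, smul_eq_mul,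
          Prod.fst_neg, Prod.snd_neg, e1, abs_neg, hy] <;> linarith
    · obtain ⟨l₀, hl₀, hl₀', -⟩ := hhit
      have e1 : (L - α t₁, -t₁) - (α t, t) = l₀ • v := by rw [hl₀']; abel
      have e2 : (L - α t₁, -t₁) + (l / 2) • (-w) - (L - α t₁, -t₁) = (l / 2) • (-w) := by abel
      have h1 := h.hasDerivAt_rightCurve_sub ha hb L ht₁ (x := (α t, t))
        (by rw [e1]; exact smul_ne_zero hl₀.ne' (ne_zero hv))
      have h2 := h.hasDerivAt_sub_rightCurve ha hb L ht₁ (y := (L - α t₁, -t₁) + (l / 2) • (-w))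
        (by rw [e2]; exact smul_ne_zero (by positivity) (neg_ne_zero.mpr (ne_zero hw)))
      rw [e1, momentum_smul hl₀] at h1
      rw [e2, momentum_smul (by positivity), momentum_neg] at h2
      refine (h1.fun_add h2).congr_deriv ?_
      rw [hrefl]
      ring
  · rw [neg_neg]
    have : halfTurn L (L - α t₁, -t₁) = (α t₁, t₁) := by simp [halfTurn]
    rw [this]
    exact coords ht₁ ht₂ hw hhit₁

end IsProfile

/-! ### Uniqueness of the step near the periodic orbit -/

theorem FirstHit.unique {Q : Set (ℝ × ℝ)} {x v y z : ℝ × ℝ} (hy : FirstHit Q x v y)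
    (hz : FirstHit Q x v z) : y = z := by
  obtain ⟨l, hl, rfl, hlQ, hlin⟩ := hy
  obtain ⟨m, hm, rfl, hmQ, hmin⟩ := hz
  rcases lt_trichotomy l m with h | h | h
  · exact absurd (hmin l hl h) hlQ
  · rw [h]
  · exact absurd (hlin m hm h) hmQ

/-- The tangential component of the gradient in terms of height and slope. -/
def tangential (a b : ℝ) (α : ℝ → ℝ) (z : ℝ × ℝ) : ℝ :=
  gradOne a b (1, z.2) * deriv α z.1 + gradTwo a b (1, z.2)

theorem contDiff_gradOne_slope (a b : ℝ) : ContDiff ℝ ∞ fun m : ℝ => gradOne a b (1, m) := by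
  simp only [gradOne]
  refine (contDiff_const.mul (contDiff_const.div (ContDiff.sqrt (by fun_prop) fun m => ?_)
    fun m => ?_)).add (contDiff_const.mul (contDiff_const.mul
      (ContDiff.rpow_const_of_ne (by fun_prop) fun m => ?_))) <;> positivity

theorem contDiff_gradTwo_slope (a b : ℝ) : ContDiff ℝ ∞ fun m : ℝ => gradTwo a b (1, m) := by
  simp only [gradTwo]
  refine (contDiff_const.mul (contDiff_id.div (ContDiff.sqrt (by fun_prop) fun m => ?_)
    fun m => ?_)).add (contDiff_const.mul ((contDiff_id.pow 3).mul
      (ContDiff.rpow_const_of_ne (by fun_prop) fun m => ?_))) <;> positivity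

theorem hasDerivAt_gradTwo_slope_zero (a b : ℝ) :
    HasDerivAt (fun m : ℝ => gradTwo a b (1, m)) a 0 := by
  have hid := hasDerivAt_id' (0 : ℝ)
  have h1 : HasDerivAt (fun m : ℝ => √(1 ^ 2 + m ^ 2)) 0 0 := by
    have := ((hid.fun_pow 2).const_add (1 ^ 2)).sqrt (by norm_num)
    simpa using this
  have h2 : HasDerivAt (fun m : ℝ => ((1 : ℝ) ^ 4 + m ^ 4) ^ (-(3 : ℝ) / 4)) 0 0 := by
    have := ((hid.fun_pow 4).const_add (1 ^ 4)).rpow_const (p := -(3 : ℝ) / 4)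
      (Or.inl (by norm_num))
    simpa using this
  have := ((hid.fun_div h1 (by norm_num)).const_mul a).fun_add
    (((hid.fun_pow 3).fun_mul h2).const_mul b)
  simpa [gradTwo] using this

namespace IsProfile

variable {a b ε : ℝ} {α : ℝ → ℝ}

/-- The derivative in the slope at the origin is `a > 0`. By strict differentiability, increments in
the slope equal `a (m - m')` up to an error of at most half that size, uniformly in `t`. -/
theorem tangential_injective (h : IsProfile ε α) (ha : 0 < a) : ∃ δ > 0, ∀ t m m' : ℝ,
    |t| < δ → |m| < δ → |m'| < δ → tangential a b α (t, m) = tangential a b α (t, m') →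
      m = m' := by
  have hc : ContDiffAt ℝ ∞ (tangential a b α) 0 := by
    have h1 : ContDiffAt ℝ ∞ (fun z : ℝ × ℝ => deriv α z.1) 0 :=
      ContDiffAt.comp (g := deriv α) (0 : ℝ × ℝ) (h.smooth_deriv.contDiffAt h.mem_nhds)
        contDiffAt_fst
    exact ((((contDiff_gradOne_slope a b).comp contDiff_snd).contDiffAt).mul h1).add
      ((contDiff_gradTwo_slope a b).comp contDiff_snd).contDiffAt
  have hs : HasStrictFDerivAt (tangential a b α) (fderiv ℝ (tangential a b α) 0) 0 :=
    hc.hasStrictFDerivAt (by simp)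
  have hd : fderiv ℝ (tangential a b α) 0 (0, 1) = a := by
    have h1 : HasDerivAt (fun m : ℝ => ((0 : ℝ), m)) (0, 1) 0 :=
      (hasDerivAt_const (0 : ℝ) (0 : ℝ)).prodMk (hasDerivAt_id' (0 : ℝ))
    have h2 : HasDerivAt (fun m : ℝ => tangential a b α (0, m))
        (fderiv ℝ (tangential a b α) 0 (0, 1)) 0 :=
      HasFDerivAt.comp_hasDerivAt (f := fun m : ℝ => ((0 : ℝ), m)) (0 : ℝ) hs.hasFDerivAt h1
    refine h2.unique ?_
    simpa [tangential, h.deriv_zero] using hasDerivAt_gradTwo_slope_zero a b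
  have hlo := hs.isLittleO.bound (half_pos ha)
  obtain ⟨δ, hδ, hball⟩ := Metric.eventually_nhds_iff.mp hlo
  refine ⟨δ, hδ, fun t m m' ht hm hm' heq => ?_⟩
  have hdist : dist (((t, m), (t, m')) : (ℝ × ℝ) × (ℝ × ℝ)) (0, 0) < δ := by
    simp [Prod.dist_eq, ht, hm, hm']
  have h1 := hball hdist
  have h2 : (t, m) - (t, m') = (m - m') • ((0 : ℝ), (1 : ℝ)) := by ext <;> simp
  simp only [heq, sub_self, zero_sub, norm_neg, h2, map_smul, hd, smul_eq_mul, norm_smul,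
    norm_mul, Real.norm_eq_abs, abs_of_pos ha] at h1
  have h3 : ‖((0 : ℝ), (1 : ℝ))‖ = 1 := by simp [Prod.norm_def]
  rw [h3, mul_one] at h1
  by_contra hne
  have h4 : 0 < |m - m'| := abs_pos.mpr (sub_ne_zero.mpr hne)
  nlinarith

/-- Just after its start the ray lies to the right of the graph of `α`; compare the slopes at `r =
0`. This later rules out directions with `v.1 ≤ 0`, which small momentum alone does not. -/
theorem firstHit_direction (h : IsProfile ε α) {L t : ℝ} (ht : t ∈ Ioo (-ε) ε) {v x' : ℝ × ℝ}
    (hhit : FirstHit (table L ε α) (α t, t) v x') : deriv α t * v.2 ≤ v.1 := by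
  obtain ⟨l, hl, -, -, hin⟩ := hhit
  have h1 : HasDerivAt (fun r : ℝ => t + r * v.2) v.2 0 := by
    simpa using ((hasDerivAt_id' (0 : ℝ)).mul_const v.2).const_add t
  have h2 : HasDerivAt α (deriv α t) (t + 0 * v.2) := by
    simpa using h.hasDerivAt ht
  have h3 : HasDerivAt (fun r : ℝ => α (t + r * v.2)) (deriv α t * v.2) 0 :=
    HasDerivAt.comp (0 : ℝ) h2 h1
  have h4 : HasDerivAt (fun r : ℝ => α t + r * v.1) v.1 0 := by
    simpa using ((hasDerivAt_id' (0 : ℝ)).mul_const v.1).const_add (α t)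
  have h5 := (h4.fun_sub h3).tendsto_slope_zero_right
  have h6 : 0 ≤ v.1 - deriv α t * v.2 := by
    refine ge_of_tendsto h5 ?_
    filter_upwards [Ioo_mem_nhdsGT hl] with r hr
    have h7 := (hin r hr.1 hr.2).2.1
    simp only [Prod.fst_add, Prod.snd_add, Prod.smul_fst, Prod.smul_snd, smul_eq_mul] at h7
    have h8 : 0 < r⁻¹ := inv_pos.mpr hr.1
    simp only [zero_add, zero_mul, add_zero, sub_self, sub_zero, smul_eq_mul]
    nlinarith
  linarith

/-- Directions with small tangential momentum that point into the table are nearly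
horizontal. -/
theorem slope_small (h : IsProfile ε α) (ha : 0 < a) (hb : 0 ≤ b) (hab : a + b = 1) (L : ℝ)
    {δ : ℝ} (hδ : 0 < δ) : ∀ᶠ p in 𝓝 (0 : ℝ × ℝ), ∀ t ∈ Ioo (-ε) ε, ∀ v x' : ℝ × ℝ,
      mixedNorm a b v = 1 → FirstHit (table L ε α) (α t, t) v x' →
      p = (arcLength a b α t, momentum a b α t v) →
      |t| < δ ∧ 0 < v.1 ∧ |v.2 / v.1| < δ := by
  -- Bounding `u` and `α'` by `η` and the speed by two gives `|gradTwo| ≤ 3η`, hence `a |v.2| ≤ 6η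
  -- |v.1|` once the `|v.2|` term is absorbed. The two members of the minimum then give `|v.2| ≤
  -- |v.1| / 2` and `|v.2| ≤ δ |v.1| / 2`.
  set η : ℝ := min (a / 12) (a * δ / 12) with hη
  have hη0 : 0 < η := by positivity
  have hη1 : 12 * η ≤ a := by linarith [min_le_left (a / 12) (a * δ / 12)]
  have hη2 : 12 * η ≤ a * δ := by linarith [min_le_right (a / 12) (a * δ / 12)]
  have hH : Tendsto (fun p : ℝ × ℝ => height a b ε α p.1) (𝓝 0) (𝓝 0) := by
    have h1 := (h.hasDerivAt_height ha hb h.zero_mem).continuousAt.tendsto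
    rw [arcLength_zero, h.height_zero ha hb] at h1
    exact h1.comp (continuous_fst.tendsto (0 : ℝ × ℝ))
  have e1 : ∀ᶠ t in 𝓝 (0 : ℝ), |t| < δ := by
    have : ContinuousAt (fun t : ℝ => |t|) 0 := by fun_prop
    refine this.eventually_lt_const ?_
    simpa using hδ
  have hdc : ContinuousAt (deriv α) 0 := (h.smooth_deriv.contDiffAt h.mem_nhds).continuousAt
  have e2 : ∀ᶠ t in 𝓝 (0 : ℝ), |deriv α t| < η := by
    refine hdc.abs.eventually_lt_const ?_
    simpa [h.deriv_zero] using hη0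
  have e3 : ∀ᶠ t in 𝓝 (0 : ℝ), speed a b (deriv α t) < 2 := by
    have : ContinuousAt (fun t => speed a b (deriv α t)) 0 :=
      (contDiff_speed a b).continuous.continuousAt.comp hdc
    refine this.eventually_lt_const ?_
    show speed a b (deriv α 0) < 2
    rw [h.deriv_zero, speed_zero hab]
    norm_num
  have e4 : ∀ᶠ p in 𝓝 (0 : ℝ × ℝ), |p.2| < η := by
    have : ContinuousAt (fun p : ℝ × ℝ => |p.2|) 0 := by fun_prop
    refine this.eventually_lt_const ?_
    simpa using hη0
  filter_upwards [hH.eventually (e1.and (e2.and e3)), e4] with p hp hp2 t ht v x' hv hhit hpt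
  have hpt1 : p.1 = arcLength a b α t := congrArg Prod.fst hpt
  have hpt2 : p.2 = momentum a b α t v := congrArg Prod.snd hpt
  rw [hpt1, h.height_arcLength ha hb ht] at hp
  obtain ⟨ht1, ht2, ht3⟩ := hp
  have hv0 : v ≠ 0 := by
    rintro rfl
    simp [mixedNorm] at hv
  have hsp := speed_pos ha hb (deriv α t)
  have b1 : |gradOne a b v * deriv α t + gradTwo a b v| ≤ 2 * η := by
    have : gradOne a b v * deriv α t + gradTwo a b v = -(p.2 * speed a b (deriv α t)) := by
      rw [hpt2, momentum]
      field_simp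
    rw [this, abs_neg, abs_mul, abs_of_pos hsp]
    nlinarith [abs_nonneg p.2]
  have b2 : |gradOne a b v * deriv α t| ≤ η := by
    rw [abs_mul]
    have := abs_gradOne_le ha.le hb hv0
    rw [hab] at this
    nlinarith [abs_nonneg (deriv α t), abs_nonneg (gradOne a b v)]
  have b3 : |gradTwo a b v| ≤ 3 * η := by
    have : gradTwo a b v = (gradOne a b v * deriv α t + gradTwo a b v) -
        gradOne a b v * deriv α t := by ring
    rw [this]
    exact (abs_sub _ _).trans (by linarith)
  have b4 := le_abs_gradTwo (a := a) hb hv0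
  have b5 : √(v.1 ^ 2 + v.2 ^ 2) ≤ |v.1| + |v.2| := by
    refine Real.sqrt_le_iff.mpr ⟨by positivity, ?_⟩
    nlinarith [sq_abs v.1, sq_abs v.2, mul_nonneg (abs_nonneg v.1) (abs_nonneg v.2)]
  have b6 : a * |v.2| ≤ 3 * η * (|v.1| + |v.2|) :=
    b4.trans (mul_le_mul b3 b5 (Real.sqrt_nonneg _) (by positivity))
  have b7 : a * |v.2| ≤ 6 * η * |v.1| := by
    nlinarith [abs_nonneg v.2]
  have hv1 : 0 < |v.1| := by
    rw [abs_pos]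
    intro h0
    rw [h0, abs_zero, mul_zero] at b7
    have : |v.2| ≤ 0 := by nlinarith
    exact hv0 (Prod.ext h0 (abs_nonpos_iff.mp this))
  have b8 : |v.2| ≤ |v.1| / 2 := by
    have : a * |v.2| ≤ a * (|v.1| / 2) := by nlinarith
    exact le_of_mul_le_mul_left this ha
  have b9 : |v.2| ≤ δ / 2 * |v.1| := by
    have : a * |v.2| ≤ a * (δ / 2 * |v.1|) := by nlinarith
    exact le_of_mul_le_mul_left this ha
  -- A direction with `v.1 ≤ 0` would need `-|α'| |v.2| ≤ -|v.1|`, impossible when `|α'| ≤ 1` and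
  -- `|v.2| ≤ |v.1| / 2`.
  have hpos : 0 < v.1 := by
    by_contra hneg
    have hdir := h.firstHit_direction ht hhit
    have c1 : |v.1| = -v.1 := abs_of_nonpos (not_lt.mp hneg)
    have c2 : -(|deriv α t| * |v.2|) ≤ deriv α t * v.2 := by
      rw [← abs_mul]
      exact neg_abs_le _
    have c3 : |deriv α t| * |v.2| ≤ 1 * |v.2| := by
      have : |deriv α t| ≤ 1 := by linarith
      gcongr
    linarith
  refine ⟨ht1, hpos, ?_⟩
  rw [abs_div, div_lt_iff₀ hv1]
  nlinarith

theorem momentum_eq_tangential {t : ℝ} {v : ℝ × ℝ} (hv : 0 < v.1) :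
    momentum a b α t v = -(tangential a b α (t, v.2 / v.1) * (speed a b (deriv α t))⁻¹) := by
  have : v = v.1 • ((1 : ℝ), v.2 / v.1) := by
    ext
    · simp
    · simp only [Prod.smul_snd, smul_eq_mul]
      field_simp
  rw [this, momentum_smul hv]
  simp [momentum, tangential, hv.ne']

/-- Near the origin the reduced billiard step is single valued. -/
theorem reducedStep_unique (h : IsProfile ε α) (ha : 0 < a) (hb : 0 ≤ b) (hab : a + b = 1)
    (L : ℝ) : ∀ᶠ p in 𝓝 (0 : ℝ × ℝ), ∀ q q' : ℝ × ℝ, ReducedStep a b L ε α p q →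
      ReducedStep a b L ε α p q' → q = q' := by
  obtain ⟨δ, hδ, hinj⟩ := h.tangential_injective (b := b) ha
  filter_upwards [h.slope_small ha hb hab L hδ] with p hp q q' hq hq'
  obtain ⟨t, ht, t₁, ht₁, v, hv, hhit, hpt, rfl⟩ := h.of_reducedStep ha hb hq
  obtain ⟨t', ht', t₁', ht₁', v', hv', hhit', hpt', rfl⟩ := h.of_reducedStep ha hb hq'
  have htt : t = t' := by
    have := (congrArg Prod.fst hpt).symm.trans (congrArg Prod.fst hpt')
    exact (h.strictMonoOn_arcLength ha hb).injOn ht ht' this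
  subst htt
  obtain ⟨ht1, hv1, hm⟩ := hp t ht v _ hv hhit hpt
  obtain ⟨-, hv1', hm'⟩ := hp t ht v' _ hv' hhit' hpt'
  have hmom : momentum a b α t v = momentum a b α t v' :=
    (congrArg Prod.snd hpt).symm.trans (congrArg Prod.snd hpt')
  rw [momentum_eq_tangential hv1, momentum_eq_tangential hv1', neg_inj] at hmom
  have htan := mul_right_cancel₀ (inv_ne_zero (speed_pos ha hb (deriv α t)).ne') hmom
  have hslope := hinj t _ _ ht1 hm hm' htan
  -- Equal slopes and positive first components make the directions positive multiples of each
  -- other, and both have unit norm.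
  have hvv : v = v' := by
    have e1 : v = (v.1 / v'.1) • v' := by
      ext
      · simp only [Prod.smul_fst, smul_eq_mul]
        field_simp
      · simp only [Prod.smul_snd, smul_eq_mul]
        field_simp at hslope ⊢
        linarith
    have e2 : 0 < v.1 / v'.1 := by positivity
    have e3 := hv
    rw [e1, mixedNorm_smul e2.le, hv', mul_one] at e3
    rw [e1, e3, one_smul]
  subst hvv
  have h1 := hhit.unique hhit'
  have h2 : t₁ = t₁' := by
    have := congrArg Prod.snd h1
    simpa using this
  rw [h2]

/-! ### Chords inside the table -/

/-- Nearly horizontal segments between the two ends run inside the table. -/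
theorem exists_firstHit (h : IsProfile ε α) {L : ℝ} (hL : 0 < L) (hα : 0 < deriv^[2] α 0) :
    ∃ δ > 0, δ ≤ ε ∧ ∀ t t₁ : ℝ, |t| < δ → |t₁| < δ → 0 < L - α t - α t₁ ∧
      ∀ l : ℝ, 0 < l → FirstHit (table L ε α) (α t, t)
        (l⁻¹ • (L - α t - α t₁, -(t + t₁))) (L - α t₁, -t₁) := by
  have e1 : ∀ᶠ t in 𝓝 (0 : ℝ), 0 < deriv^[2] α t :=
    (h.hasDerivAt_iter 2 h.zero_mem).continuousAt.eventually_const_lt hα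
  have e2 : ∀ᶠ t in 𝓝 (0 : ℝ), α t < L / 2 := by
    refine (h.hasDerivAt h.zero_mem).continuousAt.eventually_lt_const ?_
    rw [h.zero]
    positivity
  obtain ⟨δ, hδ, hball⟩ := Metric.eventually_nhds_iff.mp
    ((e1.and e2).and (show ∀ᶠ t in 𝓝 (0 : ℝ), t ∈ Ioo (-ε) ε from h.mem_nhds))
  have hin : ∀ {t : ℝ}, |t| < min δ ε → 0 < deriv^[2] α t ∧ α t < L / 2 ∧ t ∈ Ioo (-ε) ε :=
    fun {t} ht => by
      have := hball (y := t) (by simpa using ht.trans_le (min_le_left _ _))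
      exact ⟨this.1.1, this.1.2, this.2⟩
  have hmem : ∀ t ∈ Ioo (-(min δ ε)) (min δ ε), |t| < min δ ε := fun t ht => abs_lt.mpr ht
  -- Positive second derivative at the vertex makes the table convex there, so it contains the open
  -- segments between nearby points of the two ends.
  have hconv : ConvexOn ℝ (Ioo (-(min δ ε)) (min δ ε)) α := by
    refine convexOn_of_deriv2_nonneg (convex_Ioo _ _) ?_ ?_ ?_ ?_
    · exact fun t ht => (h.hasDerivAt (hin (hmem t ht)).2.2).continuousAt.continuousWithinAt
    · rw [interior_Ioo]
      exact fun t ht => (h.hasDerivAt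
        (hin (hmem t ht)).2.2).differentiableAt.differentiableWithinAt
    · rw [interior_Ioo]
      exact fun t ht => (h.hasDerivAt_iter 1
        (hin (hmem t ht)).2.2).differentiableAt.differentiableWithinAt
    · rw [interior_Ioo]
      exact fun t ht => (hin (hmem t ht)).1.le
  refine ⟨min δ ε, lt_min hδ h.pos, min_le_right _ _, fun t t₁ ht ht₁ => ?_⟩
  have hX : 0 < L - α t - α t₁ := by linarith [(hin ht).2.1, (hin ht₁).2.1]
  refine ⟨hX, fun l hl => ⟨l, hl, ?_, ?_, fun r hr hrl => ?_⟩⟩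
  · rw [smul_smul, mul_inv_cancel₀ hl.ne', one_smul]
    refine Prod.ext ?_ ?_ <;> simp only [Prod.fst_add, Prod.snd_add] <;> ring
  · rintro ⟨-, -, h3⟩
    simp only [h.even t₁ (hin ht₁).2.2, lt_self_iff_false] at h3
  · set s := r * l⁻¹ with hs
    have hs0 : 0 < s := by positivity
    have hs1 : s < 1 := by
      rw [hs, ← div_eq_mul_inv, div_lt_one hl]
      exact hrl
    have hpt : ((α t, t) : ℝ × ℝ) + r • l⁻¹ • (L - α t - α t₁, -(t + t₁)) =
        (α t + s * (L - α t - α t₁), (1 - s) * t + s * -t₁) := by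
      rw [smul_smul, ← hs]
      refine Prod.ext ?_ ?_ <;>
        simp only [Prod.fst_add, Prod.snd_add, Prod.smul_fst, Prod.smul_snd, smul_eq_mul]
      ring
    have ht' : t ∈ Ioo (-(min δ ε)) (min δ ε) := abs_lt.mp ht
    have ht₁' : -t₁ ∈ Ioo (-(min δ ε)) (min δ ε) := abs_lt.mp (by rwa [abs_neg])
    have hymem : (1 - s) • t + s • (-t₁) ∈ Ioo (-(min δ ε)) (min δ ε) :=
      convex_Ioo _ _ ht' ht₁' (by linarith) hs0.le (by ring)
    have hcv := hconv.2 ht' ht₁' (by linarith : 0 ≤ 1 - s) hs0.le (by ring)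
    rw [h.even t₁ (hin ht₁).2.2] at hcv
    simp only [smul_eq_mul] at hcv hymem
    have b1 := (hin ht).2.1
    have b2 := (hin ht₁).2.1
    rw [hpt]
    refine ⟨(hmem _ hymem).trans_le (min_le_right _ _), ?_, ?_⟩
    -- After convexity, the remaining gaps to the left and right ends are `s (L - 2 α t₁)` and `(1 -
    -- s) (L - 2 α t)`; this is why `α` was kept below `L / 2`.
    · nlinarith [mul_pos hs0 (by linarith : 0 < L - 2 * α t₁)]
    · nlinarith [mul_pos (by linarith : 0 < 1 - s) (by linarith : 0 < L - 2 * α t)]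

end IsProfile

/-! ### The cubic jet of the momentum of a chord -/

theorem rpow_jet (s : ℝ) :
    (fun x : ℝ => (1 + x) ^ s - (1 + s * x)) =O[𝓝 0] fun x : ℝ => x ^ 2 := by
  have h1 : ContDiffAt ℝ 2 (fun x : ℝ => (1 + x) ^ s) 0 :=
    (contDiffAt_const.add contDiffAt_id).rpow_const_of_ne (by norm_num)
  have h2 : HasDerivAt (fun x : ℝ => (1 + x) ^ s) s 0 := by
    have := ((hasDerivAt_id' (0 : ℝ)).const_add 1).rpow_const (p := s) (Or.inl (by norm_num))
    simpa using this
  simpa using isBigO_sub_affine h1 h2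

theorem tendsto_pow_zero {n : ℕ} (hn : n ≠ 0) : Tendsto (fun x : ℝ => x ^ n) (𝓝 0) (𝓝 0) := by
  have : Continuous fun x : ℝ => x ^ n := by fun_prop
  simpa [hn] using this.tendsto 0

theorem inv_sqrt_jet :
    (fun m : ℝ => (√(1 ^ 2 + m ^ 2))⁻¹ - (1 - m ^ 2 / 2)) =O[𝓝 0] fun m : ℝ => m ^ 4 := by
  have h := (rpow_jet (-(1 / 2))).comp_tendsto (tendsto_pow_zero two_ne_zero)
  refine (h.congr (fun m => ?_) fun m => ?_)
  · simp only [Function.comp_apply]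
    rw [Real.rpow_neg (by positivity), ← Real.sqrt_eq_rpow]
    ring_nf
  · simp only [Function.comp_apply]
    ring

theorem quartic_rpow_jet :
    (fun m : ℝ => ((1 : ℝ) ^ 4 + m ^ 4) ^ (-(3 : ℝ) / 4) - 1) =O[𝓝 0] fun m : ℝ => m ^ 4 := by
  have h := (rpow_jet (-(3 : ℝ) / 4)).comp_tendsto (tendsto_pow_zero four_ne_zero)
  have h1 : (fun m : ℝ => (m ^ 4) ^ 2) =O[𝓝 0] fun m : ℝ => m ^ 4 :=
    (isLittleO_pow_pow (by norm_num : 4 < 8)).isBigO.congr_left fun m => by ring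
  have h2 := (h.trans h1).add ((isBigO_refl (fun m : ℝ => m ^ 4) (𝓝 0)).const_mul_left (-(3 : ℝ) / 4))
  refine h2.congr_left fun m => ?_
  simp only [Function.comp_apply, one_pow]
  ring

theorem gradOne_jet {a b : ℝ} (hab : a + b = 1) :
    (fun m : ℝ => gradOne a b (1, m) - (1 - a / 2 * m ^ 2)) =O[𝓝 0] fun m : ℝ => m ^ 4 := by
  refine ((inv_sqrt_jet.const_mul_left a).add (quartic_rpow_jet.const_mul_left b)).congr_left
    fun m => ?_
  simp only [gradOne, one_div, one_pow]
  linear_combination -hab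

/-- Apart from the normalization `a + b = 1`, the four-norm is visible to this order only in the
cubic coefficient `b - a/2`. -/
theorem gradTwo_jet (a b : ℝ) :
    (fun m : ℝ => gradTwo a b (1, m) - (a * m + (b - a / 2) * m ^ 3)) =O[𝓝 0]
      fun m : ℝ => m ^ 4 := by
  have h0 : (fun m : ℝ => m ^ 5) =O[𝓝 0] fun m : ℝ => m ^ 4 :=
    (isLittleO_pow_pow (by norm_num : 4 < 5)).isBigO
  have h1 : (fun m : ℝ => m * ((√(1 ^ 2 + m ^ 2))⁻¹ - (1 - m ^ 2 / 2))) =O[𝓝 0]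
      fun m : ℝ => m ^ 4 :=
    (((isBigO_refl (fun m : ℝ => m) (𝓝 0)).mul inv_sqrt_jet).congr_right
      fun m => by ring).trans h0
  have h2 : (fun m : ℝ => m ^ 3 * (((1 : ℝ) ^ 4 + m ^ 4) ^ (-(3 : ℝ) / 4) - 1)) =O[𝓝 0]
      fun m : ℝ => m ^ 4 :=
    (((isBigO_refl (fun m : ℝ => m ^ 3) (𝓝 0)).mul quartic_rpow_jet).congr_right
      fun m => by ring).trans (isLittleO_pow_pow (by norm_num : 4 < 7)).isBigO
  refine ((h1.const_mul_left a).add (h2.const_mul_left b)).congr_left fun m => ?_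
  simp only [gradTwo, div_eq_mul_inv]
  ring

theorem inv_speed_jet {a b : ℝ} (ha : 0 < a) (hb : 0 ≤ b) (hab : a + b = 1) :
    (fun w : ℝ => (speed a b w)⁻¹ - (1 - a / 2 * w ^ 2)) =O[𝓝 0] fun w : ℝ => w ^ 4 := by
  have h1 : (fun w : ℝ => (speed a b w)⁻¹) =O[𝓝 0] fun _ : ℝ => (1 : ℝ) := by
    have : ContinuousAt (fun w : ℝ => (speed a b w)⁻¹) 0 :=
      (contDiff_speed a b).continuous.continuousAt.inv₀ (speed_pos ha hb 0).ne'
    exact this.tendsto.isBigO_one ℝ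
  have h2 : (fun w : ℝ => 1 - a / 2 * w ^ 2) =O[𝓝 0] fun _ : ℝ => (1 : ℝ) := by
    have : ContinuousAt (fun w : ℝ => 1 - a / 2 * w ^ 2) 0 := by fun_prop
    exact this.tendsto.isBigO_one ℝ
  have h3 := ((speed_jet hab).mul h2).neg_left.congr_right fun w : ℝ => mul_one (w ^ 4)
  -- Here `(1 + a w²/2)(1 - a w²/2) = 1 - a² w⁴/4`, so the correction brings the product of the
  -- speed and the proposed inverse to one.
  have h4 := h3.add ((isBigO_refl (fun w : ℝ => w ^ 4) (𝓝 0)).const_mul_left (a ^ 2 / 4))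
  refine (h1.mul h4).congr (fun w => ?_) fun w => one_mul _
  have := (speed_pos ha hb w).ne'
  field_simp
  ring

/-- The momentum at height `z.1` of the chord from height `z.1` on the left end to the point of
the right end with parameter height `z.2`. -/
def chordMomentum (a b L : ℝ) (α : ℝ → ℝ) (z : ℝ × ℝ) : ℝ :=
  momentum a b α z.1 (L - α z.1 - α z.2, -(z.1 + z.2))

namespace IsProfile

variable {a b ε : ℝ} {α : ℝ → ℝ}

theorem isBigO_deriv (h : IsProfile ε α) : deriv α =O[𝓝 0] fun t : ℝ => t ^ 1 := by
  have := (h.hasDerivAt_iter 1 h.zero_mem).isBigO_sub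
  simpa [h.deriv_zero] using this

theorem isBigO_sq (h : IsProfile ε α) : α =O[𝓝 0] fun t : ℝ => t ^ 2 := by
  have h1 := h.jet_zero.trans (isLittleO_pow_pow (by norm_num : 2 < 4)).isBigO
  refine (h1.add ((isBigO_refl _ _).const_mul_left (deriv^[2] α 0 / 2))).congr_left fun t => ?_
  ring

theorem chord_pos (h : IsProfile ε α) {L : ℝ} (hL : 0 < L) :
    ∀ᶠ z in 𝓝 (0 : ℝ × ℝ), 0 < L - α z.1 - α z.2 := by
  have h1 : VanishesTo 2 fun z => α z.1 + α z.2 := by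
    have e1 := VanishesTo.comp_real h.isBigO_sq VanishesTo.fst one_ne_zero
    have e2 := VanishesTo.comp_real h.isBigO_sq VanishesTo.snd one_ne_zero
    exact e1.add e2
  filter_upwards [(h1.tendsto two_ne_zero).eventually_lt_const hL] with z hz
  linarith

theorem chordMomentum_eq {L : ℝ} {z : ℝ × ℝ} (hz : 0 < L - α z.1 - α z.2) :
    chordMomentum a b L α z = -(tangential a b α (z.1, -(z.1 + z.2) / (L - α z.1 - α z.2)) *
      (speed a b (deriv α z.1))⁻¹) :=
  momentum_eq_tangential (v := (L - α z.1 - α z.2, -(z.1 + z.2))) hz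

/-- The reciprocal of the width is multiplied by the linear form `t + t₁`, so the quadratic part of
`α` is enough. -/
theorem slope_jet (h : IsProfile ε α) {L : ℝ} (hL : 0 < L) :
    VanishesTo 4 fun z => -(z.1 + z.2) / (L - α z.1 - α z.2) -
      -((z.1 + z.2) * (1 / L + deriv^[2] α 0 / (2 * L ^ 2) * (z.1 ^ 2 + z.2 ^ 2))) := by
  have e1 := VanishesTo.comp_real h.isBigO_sq VanishesTo.fst one_ne_zero
  have e2 := VanishesTo.comp_real h.isBigO_sq VanishesTo.snd one_ne_zero
  have f1 := VanishesTo.comp_real h.jet_zero VanishesTo.fst one_ne_zero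
  have f2 := VanishesTo.comp_real h.jet_zero VanishesTo.snd one_ne_zero
  have hφ : (fun x : ℝ => (L - x)⁻¹ - (1 / L + 1 / L ^ 2 * x)) =O[𝓝 0] fun x : ℝ => x ^ 2 := by
    have h1 : ContDiffAt ℝ 2 (fun x : ℝ => (L - x)⁻¹) 0 :=
      (contDiffAt_const.sub contDiffAt_id).inv (by simpa using hL.ne')
    have h2 : HasDerivAt (fun x : ℝ => (L - x)⁻¹) (1 / L ^ 2) 0 := by
      have := ((hasDerivAt_id' (0 : ℝ)).const_sub L).fun_inv (by simpa using hL.ne')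
      simpa using this
    simpa using isBigO_sub_affine h1 h2
  have h3 := VanishesTo.comp_real hφ (e1.add e2) (by norm_num)
  have h4 := h3.add (((f1.add f2).const_mul (1 / L ^ 2)))
  refine (((VanishesTo.fst.add VanishesTo.snd).mul h4).neg.mono (by norm_num)).congr fun z => ?_
  rw [show L - α z.1 - α z.2 = L - (α z.1 + α z.2) by ring]
  field_simp
  ring

/-- Substitute the jet of the slope into those of the gradient, then multiply by `α' = k t + q t³`
and by the inverse speed `1 - a k² t²/2`. The quartic coefficient of `α` enters only through `q`. -/
theorem chordMomentum_jet (h : IsProfile ε α) (ha : 0 < a) (hb : 0 ≤ b) (hab : a + b = 1)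
    {L k q : ℝ} (hL : 0 < L) (hk : k = deriv^[2] α 0) (hq : q = deriv^[4] α 0 / 6) :
    VanishesTo 4 fun z => chordMomentum a b L α z - -((k * z.1 - a / L * (z.1 + z.2)) *
      (1 - a * k ^ 2 / 2 * z.1 ^ 2) + q * z.1 ^ 3 - a * k / (2 * L ^ 2) * (z.1 + z.2) ^ 2 * z.1 -
      a * k / (2 * L ^ 2) * (z.1 + z.2) * (z.1 ^ 2 + z.2 ^ 2) -
      (b - a / 2) / L ^ 3 * (z.1 + z.2) ^ 3) := by
  have hY := VanishesTo.fst.add VanishesTo.snd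
  have hM := h.slope_jet hL
  rw [← hk] at hM
  set M : ℝ × ℝ → ℝ := fun z => -(z.1 + z.2) / (L - α z.1 - α z.2) with hMdef
  have d1 : VanishesTo 4 fun z => deriv α z.1 - (k * z.1 + q * z.1 ^ 3) := by
    have := VanishesTo.comp_real h.jet_one VanishesTo.fst one_ne_zero
    rwa [← hk, ← hq] at this
  have d2 : VanishesTo 1 fun z => deriv α z.1 :=
    VanishesTo.comp_real h.isBigO_deriv VanishesTo.fst one_ne_zero
  have hM3 : VanishesTo 3 fun z => M z + (z.1 + z.2) / L := by
    refine ((hM.mono (by norm_num)).sub ((hY.mul .sq_add_sq).const_mul (k / (2 * L ^ 2)))).congr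
      fun z => ?_
    simp only [hMdef]
    ring
  have hM1 : VanishesTo 1 M :=
    ((hM3.mono (by norm_num)).sub (hY.const_mul (1 / L))).congr fun z => by ring
  have hMsub : VanishesTo 1 fun z => M z - (z.1 + z.2) / L :=
    (hM1.sub (hY.const_mul (1 / L))).congr fun z => by ring
  have hMsq : VanishesTo 2 fun z => M z ^ 2 - M z * (z.1 + z.2) / L + (z.1 + z.2) ^ 2 / L ^ 2 := by
    refine (((hM1.pow 2).sub ((hM1.mul hY).const_mul (1 / L))).add
      ((hY.pow 2).const_mul (1 / L ^ 2))).congr fun z => by ring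
  have g1 : VanishesTo 3 fun z => gradOne a b (1, M z) -
      (1 - a / 2 * ((z.1 + z.2) ^ 2 / L ^ 2)) := by
    refine (((VanishesTo.comp_real (gradOne_jet hab) hM1 one_ne_zero).sub
      ((hM3.mul hMsub).const_mul (a / 2))).mono (by norm_num)).congr fun z => ?_
    ring
  have g2 : VanishesTo 4 fun z => gradTwo a b (1, M z) - (-(a / L * (z.1 + z.2)) -
      a * k / (2 * L ^ 2) * (z.1 + z.2) * (z.1 ^ 2 + z.2 ^ 2) -
      (b - a / 2) / L ^ 3 * (z.1 + z.2) ^ 3) := by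
    refine (((VanishesTo.comp_real (gradTwo_jet a b) hM1 one_ne_zero).add
      (hM.const_mul a)).add (((hM3.mul hMsq).mono (by norm_num)).const_mul (b - a / 2))).congr
      fun z => ?_
    simp only [hMdef]
    ring
  have v1 : VanishesTo 4 fun z => (speed a b (deriv α z.1))⁻¹ - (1 - a * k ^ 2 / 2 * z.1 ^ 2) := by
    have e1 : VanishesTo 3 fun z => deriv α z.1 - k * z.1 :=
      ((d1.mono (by norm_num)).add ((VanishesTo.fst.pow 3).const_mul q)).congr fun z => by ring
    have e2 : VanishesTo 1 fun z => deriv α z.1 + k * z.1 :=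
      d2.add (VanishesTo.fst.const_mul k)
    refine ((VanishesTo.comp_real (inv_speed_jet ha hb hab) d2 one_ne_zero).sub
      ((e1.mul e2).const_mul (a / 2))).congr fun z => by ring
  set T₁ : ℝ × ℝ → ℝ := fun z => k * z.1 - a / L * (z.1 + z.2) with hT₁
  set T₃ : ℝ × ℝ → ℝ := fun z => q * z.1 ^ 3 - a * k / (2 * L ^ 2) * (z.1 + z.2) ^ 2 * z.1 -
      a * k / (2 * L ^ 2) * (z.1 + z.2) * (z.1 ^ 2 + z.2 ^ 2) -
      (b - a / 2) / L ^ 3 * (z.1 + z.2) ^ 3 with hT₃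
  have t1 : VanishesTo 1 T₁ := (VanishesTo.fst.const_mul k).sub (hY.const_mul (a / L))
  have t3 : VanishesTo 3 T₃ :=
    (((((VanishesTo.fst.pow 3).const_mul q).sub (((hY.pow 2).mul .fst).const_mul
      (a * k / (2 * L ^ 2)))).sub ((hY.mul .sq_add_sq).const_mul (a * k / (2 * L ^ 2)))).sub
      ((hY.pow 3).const_mul ((b - a / 2) / L ^ 3))).congr fun z => by
        simp only [hT₃]
        ring
  have p2 : VanishesTo 2 fun z => 1 - (1 - a / 2 * ((z.1 + z.2) ^ 2 / L ^ 2)) :=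
    ((hY.pow 2).const_mul (a / (2 * L ^ 2))).congr fun z => by ring
  have p0 : VanishesTo 0 fun z => 1 - a / 2 * ((z.1 + z.2) ^ 2 / L ^ 2) :=
    ((VanishesTo.const 1).sub (p2.mono (by norm_num))).congr fun z => by ring
  have ht : VanishesTo 4 fun z => tangential a b α (z.1, M z) - (T₁ z + T₃ z) := by
    refine (((((g1.mul d2)).add ((p0.mul d1).mono (by norm_num))).sub
      (((p2.mul (VanishesTo.fst.pow 3)).const_mul q).mono (by norm_num))).add g2).congr fun z => ?_
    simp only [tangential, hT₁, hT₃]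
    field_simp
    ring
  have v2 : VanishesTo 2 fun z => a * k ^ 2 / 2 * z.1 ^ 2 := (VanishesTo.fst.pow 2).const_mul _
  have v0 : VanishesTo 0 fun z => (speed a b (deriv α z.1))⁻¹ :=
    (((v1.mono (by norm_num)).add (.const 1)).sub (v2.mono (by norm_num))).congr fun z => by ring
  have total := ((((ht.mul v0)).add (((t1.add (t3.mono (by norm_num))).mul v1).mono
    (by norm_num))).sub ((t3.mul v2).mono (by norm_num))).neg
  refine total.congr' ?_
  filter_upwards [h.chord_pos hL] with z hz
  rw [chordMomentum_eq hz]
  simp only [hMdef, hT₁, hT₃]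
  ring

end IsProfile

/-! ### Chords as coordinates of the phase space -/

theorem hasDerivAt_fst_slice {F : ℝ × ℝ → ℝ × ℝ} {z : ℝ × ℝ} (hF : DifferentiableAt ℝ F z) :
    HasDerivAt (fun x => F (x, z.2)) (fderiv ℝ F z (1, 0)) z.1 :=
  HasFDerivAt.comp_hasDerivAt (f := fun x => (x, z.2)) z.1 hF.hasFDerivAt
    ((hasDerivAt_id' z.1).prodMk (hasDerivAt_const z.1 z.2))

theorem hasDerivAt_snd_slice {F : ℝ × ℝ → ℝ × ℝ} {z : ℝ × ℝ} (hF : DifferentiableAt ℝ F z) :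
    HasDerivAt (fun y => F (z.1, y)) (fderiv ℝ F z (0, 1)) z.2 :=
  HasFDerivAt.comp_hasDerivAt (f := fun y => (z.1, y)) z.2 hF.hasFDerivAt
    ((hasDerivAt_const z.2 z.1).prodMk (hasDerivAt_id' z.2))

/-- A partial derivative of the second component is required only where its cofactor is nonzero. For
the chord maps, whose first component depends on one height, this avoids the derivative of the
momentum in the height of its own foot. -/
theorem det_fderiv_of_slices {F : ℝ × ℝ → ℝ × ℝ} {z x y : ℝ × ℝ} (hF : DifferentiableAt ℝ F z)
    (hx₁ : HasDerivAt (fun s => (F (s, z.2)).1) x.1 z.1)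
    (hy₁ : HasDerivAt (fun s => (F (z.1, s)).1) y.1 z.2) {c : ℝ}
    (hy : x.1 ≠ 0 → HasDerivAt (fun s => (F (z.1, s)).2) y.2 z.2)
    (hx : y.1 ≠ 0 → HasDerivAt (fun s => (F (s, z.2)).2) x.2 z.1)
    (hc : x.1 * y.2 - y.1 * x.2 = c) : (fderiv ℝ F z).det = c := by
  have fst_comp : ∀ {g : ℝ → ℝ × ℝ} {g' : ℝ × ℝ} {s : ℝ}, HasDerivAt g g' s →
      HasDerivAt (fun s => (g s).1) g'.1 s := fun {g g' s} hg =>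
    (hasFDerivAt_fst (𝕜 := ℝ) (p := g s)).comp_hasDerivAt s hg
  have snd_comp : ∀ {g : ℝ → ℝ × ℝ} {g' : ℝ × ℝ} {s : ℝ}, HasDerivAt g g' s →
      HasDerivAt (fun s => (g s).2) g'.2 s := fun {g g' s} hg =>
    (hasFDerivAt_snd (𝕜 := ℝ) (p := g s)).comp_hasDerivAt s hg
  have h1 := hasDerivAt_fst_slice hF
  have h2 := hasDerivAt_snd_slice hF
  have e1 := (fst_comp h1).unique hx₁
  have e2 := (fst_comp h2).unique hy₁
  rw [det_prod_clm, e1, e2, ← hc]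
  congr 1
  · rcases eq_or_ne x.1 0 with h0 | h0
    · rw [h0, zero_mul, zero_mul]
    · rw [(snd_comp h2).unique (hy h0)]
  · rcases eq_or_ne y.1 0 with h0 | h0
    · rw [h0, zero_mul, zero_mul]
    · rw [(snd_comp h1).unique (hx h0)]

/-- The derivative of the second partial derivative of the norm along the line of slopes. -/
def slopeHess (a b m : ℝ) : ℝ := deriv (fun m : ℝ => gradTwo a b (1, m)) m

theorem hasDerivAt_gradTwo_slope (a b m : ℝ) :
    HasDerivAt (fun m : ℝ => gradTwo a b (1, m)) (slopeHess a b m) m :=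
  ((contDiff_gradTwo_slope a b).differentiable (by simp) m).hasDerivAt

/-- Euler's relation for a function homogeneous of degree one: `F₁(1, m) = F(1, m) - m F₂(1, m)`,
and `F(1, m)` has derivative `F₂(1, m)`. -/
theorem hasDerivAt_gradOne_slope (a b m : ℝ) :
    HasDerivAt (fun m : ℝ => gradOne a b (1, m)) (-(m * slopeHess a b m)) m := by
  have euler : ∀ m : ℝ, gradOne a b (1, m) = mixedNorm a b (1, m) - m * gradTwo a b (1, m) := by
    intro m
    have h1 : (0 : ℝ) < 1 ^ 2 + m ^ 2 := by positivity
    have h2 : (0 : ℝ) < 1 ^ 4 + m ^ 4 := by positivity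
    have h3 : ((1 : ℝ) ^ 4 + m ^ 4) ^ ((1 : ℝ) / 4) =
        (1 ^ 4 + m ^ 4) * ((1 : ℝ) ^ 4 + m ^ 4) ^ (-(3 : ℝ) / 4) := by
      rw [← Real.rpow_one_add' h2.le (by norm_num)]
      norm_num
    have h4 := Real.sq_sqrt h1.le
    have h5 := Real.sqrt_pos.mpr h1
    simp only [gradOne, gradTwo, mixedNorm, h3]
    simp only [one_pow] at h4 h5 ⊢
    field_simp
    linear_combination -a * h4
  have hc : HasDerivAt (fun m : ℝ => ((1 : ℝ), m)) (0, 1) m :=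
    (hasDerivAt_const m (1 : ℝ)).prodMk (hasDerivAt_id' m)
  have hn := hasDerivAt_mixedNorm (a := a) (b := b) hc (by simp)
  have := hn.fun_sub ((hasDerivAt_id' m).fun_mul (hasDerivAt_gradTwo_slope a b m))
  refine (this.congr_of_eventuallyEq (.of_forall euler)).congr_deriv ?_
  simp only
  ring

/-- The chord from height `z.1` on the left end to the point of the right end with parameter
height `z.2`, in the coordinates of the phase space. -/
def chordMap (a b L : ℝ) (α : ℝ → ℝ) (z : ℝ × ℝ) : ℝ × ℝ :=
  (arcLength a b α z.1, chordMomentum a b L α z)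

/-- The same chord after the reflection at its right end and the half turn. -/
def reflectedChordMap (a b L : ℝ) (α : ℝ → ℝ) (z : ℝ × ℝ) : ℝ × ℝ :=
  (arcLength a b α z.2, -chordMomentum a b L α (z.2, z.1))

/-- The density of the area form in the coordinates given by the two ends of a chord. -/
def chordDensity (a b L : ℝ) (α : ℝ → ℝ) (z : ℝ × ℝ) : ℝ :=
  slopeHess a b (-(z.1 + z.2) / (L - α z.1 - α z.2)) *
    (1 - -(z.1 + z.2) / (L - α z.1 - α z.2) * deriv α z.1) *
    (1 - -(z.1 + z.2) / (L - α z.1 - α z.2) * deriv α z.2) / (L - α z.1 - α z.2)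

/-- The density is a mixed second derivative of the chord length, which is symmetric in the two
ends. This symmetry is what makes the billiard map preserve area. -/
theorem chordDensity_swap (a b L : ℝ) (α : ℝ → ℝ) (z : ℝ × ℝ) :
    chordDensity a b L α (z.2, z.1) = chordDensity a b L α z := by
  have e : L - α z.2 - α z.1 = L - α z.1 - α z.2 := by ring
  simp only [chordDensity, e, add_comm z.2 z.1]
  ring

namespace IsProfile

variable {a b ε : ℝ} {α : ℝ → ℝ}

/-- Pairs of heights that span a chord. -/
def chords (L ε : ℝ) (α : ℝ → ℝ) : Set (ℝ × ℝ) :=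
  {z | z.1 ∈ Ioo (-ε) ε ∧ z.2 ∈ Ioo (-ε) ε ∧ 0 < L - α z.1 - α z.2}

theorem chords_swap {L : ℝ} {z : ℝ × ℝ} (hz : z ∈ chords L ε α) : (z.2, z.1) ∈ chords L ε α :=
  ⟨hz.2.1, hz.1, by linarith [hz.2.2]⟩

theorem chords_mem_nhds (h : IsProfile ε α) {L : ℝ} {z : ℝ × ℝ} (hz : z ∈ chords L ε α) :
    chords L ε α ∈ 𝓝 z := by
  have c1 : ContinuousAt (fun z : ℝ × ℝ => α z.1) z :=
    ContinuousAt.comp (g := α) (h.hasDerivAt hz.1).continuousAt continuousAt_fst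
  have c2 : ContinuousAt (fun z : ℝ × ℝ => α z.2) z :=
    ContinuousAt.comp (g := α) (h.hasDerivAt hz.2.1).continuousAt continuousAt_snd
  filter_upwards [continuousAt_fst.preimage_mem_nhds (isOpen_Ioo.mem_nhds hz.1),
    continuousAt_snd.preimage_mem_nhds (isOpen_Ioo.mem_nhds hz.2.1),
    ((continuousAt_const.sub c1).sub c2).eventually_const_lt hz.2.2] with y h1 h2 h3
  exact ⟨h1, h2, h3⟩

theorem zero_mem_chords (h : IsProfile ε α) {L : ℝ} (hL : 0 < L) :
    (0 : ℝ × ℝ) ∈ chords L ε α :=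
  ⟨h.zero_mem, h.zero_mem, by simpa [h.zero] using hL⟩

theorem smooth_chordMomentum (h : IsProfile ε α) (ha : 0 < a) (hb : 0 ≤ b) {L : ℝ} {z : ℝ × ℝ}
    (hz : z ∈ chords L ε α) : ContDiffAt ℝ ∞ (chordMomentum a b L α) z := by
  have c1 : ContDiffAt ℝ ∞ (fun z : ℝ × ℝ => α z.1) z :=
    ContDiffAt.comp (g := α) z (h.smooth.contDiffAt (isOpen_Ioo.mem_nhds hz.1)) contDiffAt_fst
  have c2 : ContDiffAt ℝ ∞ (fun z : ℝ × ℝ => α z.2) z :=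
    ContDiffAt.comp (g := α) z (h.smooth.contDiffAt (isOpen_Ioo.mem_nhds hz.2.1)) contDiffAt_snd
  have c3 : ContDiffAt ℝ ∞ (fun z : ℝ × ℝ => deriv α z.1) z :=
    ContDiffAt.comp (g := deriv α) z (h.smooth_deriv.contDiffAt (isOpen_Ioo.mem_nhds hz.1))
      contDiffAt_fst
  have c4 : ContDiffAt ℝ ∞ (fun z : ℝ × ℝ => -(z.1 + z.2) / (L - α z.1 - α z.2)) z :=
    (contDiffAt_fst.add contDiffAt_snd).neg.div ((contDiffAt_const.sub c1).sub c2) hz.2.2.ne'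
  have c5 : ContDiffAt ℝ ∞ (fun z : ℝ × ℝ => -(tangential a b α (z.1, -(z.1 + z.2) /
      (L - α z.1 - α z.2)) * (speed a b (deriv α z.1))⁻¹)) z :=
    (((((contDiff_gradOne_slope a b).contDiffAt.comp z c4).mul c3).add
      ((contDiff_gradTwo_slope a b).contDiffAt.comp z c4)).mul
      (((contDiff_speed a b).contDiffAt.comp z c3).inv (speed_pos ha hb _).ne')).neg
  refine c5.congr_of_eventuallyEq ?_
  filter_upwards [h.chords_mem_nhds hz] with y hy
  exact chordMomentum_eq hy.2.2

theorem hasDerivAt_chordMomentum (h : IsProfile ε α) {L : ℝ} {z : ℝ × ℝ}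
    (hz : z ∈ chords L ε α) : HasDerivAt (fun y => chordMomentum a b L α (z.1, y))
      (chordDensity a b L α z * (speed a b (deriv α z.1))⁻¹) z.2 := by
  have hX := hz.2.2
  have d1 : HasDerivAt (fun y => L - α z.1 - α y) (-deriv α z.2) z.2 :=
    (h.hasDerivAt hz.2.1).const_sub _
  have d2 : HasDerivAt (fun y => -(z.1 + y)) (-1) z.2 := ((hasDerivAt_id' z.2).const_add z.1).neg
  have d3 := d2.fun_div d1 hX.ne'
  set M := -(z.1 + z.2) / (L - α z.1 - α z.2) with hM
  have d4 := HasDerivAt.comp (h₂ := fun m : ℝ => gradOne a b (1, m)) z.2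
    (hasDerivAt_gradOne_slope a b M) d3
  have d5 := HasDerivAt.comp (h₂ := fun m : ℝ => gradTwo a b (1, m)) z.2
    (hasDerivAt_gradTwo_slope a b M) d3
  have d6 := (((d4.mul_const (deriv α z.1)).fun_add d5).mul_const
    (speed a b (deriv α z.1))⁻¹).fun_neg
  have hc : ContinuousAt (fun y : ℝ => (z.1, y)) z.2 := by fun_prop
  have hev : ∀ᶠ y in 𝓝 z.2, (z.1, y) ∈ chords L ε α :=
    hc.eventually (h.chords_mem_nhds hz)
  refine (d6.congr_of_eventuallyEq (hev.mono fun y hy => ?_)).congr_deriv ?_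
  · exact chordMomentum_eq hy.2.2
  -- Expressing `t + t₁` through the slope `M` factors the derivative of the slope as `-(1 - M
  -- α'(t₁))` over the width; the gradient contributes the factor `1 - M α'(t)`.
  · have hMX : z.1 + z.2 = -(M * (L - α z.1 - α z.2)) := by
      rw [hM]
      field_simp
    simp only [chordDensity, ← hM]
    rw [hMX]
    field_simp
    ring

theorem contDiffAt_arcLength_fst (h : IsProfile ε α) {z : ℝ × ℝ}
    (hz : z.1 ∈ Ioo (-ε) ε) : ContDiffAt ℝ ∞ (fun z : ℝ × ℝ => arcLength a b α z.1) z :=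
  ContDiffAt.comp (g := arcLength a b α) z
    ((h.smooth_arcLength a b).contDiffAt (isOpen_Ioo.mem_nhds hz)) contDiffAt_fst

theorem smooth_chordMap (h : IsProfile ε α) (ha : 0 < a) (hb : 0 ≤ b) {L : ℝ} {z : ℝ × ℝ}
    (hz : z ∈ chords L ε α) : ContDiffAt ℝ ∞ (chordMap a b L α) z :=
  (h.contDiffAt_arcLength_fst hz.1).prodMk (h.smooth_chordMomentum ha hb hz)

theorem smooth_reflectedChordMap (h : IsProfile ε α) (ha : 0 < a) (hb : 0 ≤ b) {L : ℝ}
    {z : ℝ × ℝ} (hz : z ∈ chords L ε α) : ContDiffAt ℝ ∞ (reflectedChordMap a b L α) z := by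
  have hs : ContDiffAt ℝ ∞ (fun z : ℝ × ℝ => (z.2, z.1)) z :=
    contDiffAt_snd.prodMk contDiffAt_fst
  have h1 := ContDiffAt.comp (f := fun z : ℝ × ℝ => (z.2, z.1)) z
    (h.smooth_chordMap ha hb (chords_swap hz)) hs
  exact h1.fst.prodMk h1.snd.neg

/-- The derivative is triangular, and the speed cancels between its diagonal entries. -/
theorem det_chordMap (h : IsProfile ε α) (ha : 0 < a) (hb : 0 ≤ b) {L : ℝ} {z : ℝ × ℝ}
    (hz : z ∈ chords L ε α) :
    (fderiv ℝ (chordMap a b L α) z).det = chordDensity a b L α z := by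
  refine det_fderiv_of_slices (x := (speed a b (deriv α z.1), 0))
    (y := (0, chordDensity a b L α z * (speed a b (deriv α z.1))⁻¹))
    ((h.smooth_chordMap ha hb hz).differentiableAt (by simp))
    (h.hasDerivAt_arcLength a b hz.1) (hasDerivAt_const z.2 (arcLength a b α z.1))
    (fun _ => h.hasDerivAt_chordMomentum hz) (fun h0 => absurd rfl h0) ?_
  have := (speed_pos ha hb (deriv α z.1)).ne'
  field_simp
  ring

theorem det_reflectedChordMap (h : IsProfile ε α) (ha : 0 < a) (hb : 0 ≤ b) {L : ℝ} {z : ℝ × ℝ}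
    (hz : z ∈ chords L ε α) :
    (fderiv ℝ (reflectedChordMap a b L α) z).det = chordDensity a b L α z := by
  have hd := h.hasDerivAt_chordMomentum (a := a) (b := b) (chords_swap hz)
  rw [chordDensity_swap] at hd
  refine det_fderiv_of_slices
    (x := (0, -(chordDensity a b L α z * (speed a b (deriv α z.2))⁻¹)))
    (y := (speed a b (deriv α z.2), 0))
    ((h.smooth_reflectedChordMap ha hb hz).differentiableAt (by simp))
    (hasDerivAt_const z.1 (arcLength a b α z.2)) (h.hasDerivAt_arcLength a b hz.2.1)
    (fun h0 => absurd rfl h0) (fun _ => hd.fun_neg) ?_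
  have := (speed_pos ha hb (deriv α z.2)).ne'
  field_simp
  ring

theorem chordMomentum_zero (h : IsProfile ε α) (a b L : ℝ) : chordMomentum a b L α 0 = 0 := by
  simp [chordMomentum, momentum, h.zero, h.deriv_zero, gradTwo]

theorem reflectedChordMap_zero (h : IsProfile ε α) (a b L : ℝ) :
    reflectedChordMap a b L α 0 = 0 := by
  have := h.chordMomentum_zero a b L
  simp only [reflectedChordMap, Prod.fst_zero, Prod.snd_zero, arcLength_zero]
  rw [show ((0 : ℝ), (0 : ℝ)) = 0 from rfl, this, neg_zero]
  rfl

theorem chordDensity_zero (h : IsProfile ε α) (a b L : ℝ) : chordDensity a b L α 0 = a / L := by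
  have : slopeHess a b 0 = a := (hasDerivAt_gradTwo_slope_zero a b).deriv
  simp [chordDensity, h.zero, this]

/-! ### From chords to the billiard map -/

/-- Near the periodic orbit the phase points correspond to chords. -/
theorem exists_chord (h : IsProfile ε α) (ha : 0 < a) (hb : 0 ≤ b) {L : ℝ} (hL : 0 < L) :
    ∃ W : ℝ × ℝ → ℝ × ℝ, ContDiffAt ℝ ∞ W 0 ∧ W 0 = 0 ∧
      ∀ᶠ p in 𝓝 (0 : ℝ × ℝ), chordMap a b L α (W p) = p := by
  have hz := h.zero_mem_chords hL
  have hc := h.smooth_chordMap ha hb hz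
  have hdet : (fderiv ℝ (chordMap a b L α) 0).det ≠ 0 := by
    rw [h.det_chordMap ha hb hz, h.chordDensity_zero]
    positivity
  have hd := (hc.differentiableAt (by simp)).hasFDerivAt
  rw [← ContinuousLinearMap.coe_toContinuousLinearEquivOfDetNeZero _ hdet] at hd
  have h0 : chordMap a b L α 0 = 0 := by
    simp [chordMap, arcLength_zero, h.chordMomentum_zero]
  set e := hc.toOpenPartialHomeomorph _ hd (by simp) with he
  have hmem : (0 : ℝ × ℝ) ∈ e.source := hc.mem_toOpenPartialHomeomorph_source hd (by simp)
  have hcoe : ⇑e = chordMap a b L α := hc.toOpenPartialHomeomorph_coe hd (by simp)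
  have hsymm : ContDiffAt ℝ ∞ e.symm (chordMap a b L α 0) := hc.to_localInverse hd (by simp)
  have htgt : (0 : ℝ × ℝ) ∈ e.target := by
    rw [← h0, ← hcoe]
    exact e.map_source hmem
  rw [h0] at hsymm
  refine ⟨e.symm, hsymm, ?_, ?_⟩
  · have := e.left_inv hmem
    rwa [hcoe, h0] at this
  · filter_upwards [e.open_target.mem_nhds htgt] with p hp
    have := e.right_inv hp
    rwa [hcoe] at this

/-- Consecutive chords that satisfy the reflection law give a billiard step. -/
theorem reducedStep_chord (h : IsProfile ε α) (ha : 0 < a) (hb : 0 ≤ b) {L : ℝ} (hL : 0 < L)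
    (hα : 0 < deriv^[2] α 0) : ∃ δ > 0, ∀ t t₁ t₂ : ℝ, |t| < δ → |t₁| < δ → |t₂| < δ →
      chordMomentum a b L α (t₁, t₂) = -chordMomentum a b L α (t₁, t) →
      ReducedStep a b L ε α (chordMap a b L α (t, t₁)) (reflectedChordMap a b L α (t, t₁)) := by
  obtain ⟨δ, hδ, hδε, hhit⟩ := h.exists_firstHit hL hα
  refine ⟨δ, hδ, fun t t₁ t₂ ht ht₁ ht₂ hrefl => ?_⟩
  have hI : ∀ {s : ℝ}, |s| < δ → s ∈ Ioo (-ε) ε := fun hs => abs_lt.mp (hs.trans_le hδε)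
  have unit : ∀ {s s₁ : ℝ}, |s| < δ → |s₁| < δ → ∃ l : ℝ, 0 < l ∧
      mixedNorm a b (l⁻¹ • (L - α s - α s₁, -(s + s₁))) = 1 := by
    intro s s₁ hs hs₁
    have hX := (hhit s s₁ hs hs₁).1
    have hl : 0 < mixedNorm a b (L - α s - α s₁, -(s + s₁)) :=
      mixedNorm_pos ha hb fun h0 => hX.ne' (congrArg Prod.fst h0)
    refine ⟨_, hl, ?_⟩
    rw [mixedNorm_smul (inv_pos.mpr hl).le, inv_mul_cancel₀ hl.ne']
  obtain ⟨l, hl, hv⟩ := unit ht ht₁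
  obtain ⟨l₁, hl₁, hw⟩ := unit ht₁ ht₂
  have hback : momentum a b α t₁ (L - α t - α t₁, -(t + t₁)) =
      chordMomentum a b L α (t₁, t) := by
    simp only [chordMomentum]
    rw [sub_right_comm, add_comm t t₁]
  have := h.reducedStep_of ha hb (hI ht) (hI ht₁) (hI ht₂) hv hw ((hhit t t₁ ht ht₁).2 l hl)
    ((hhit t₁ t₂ ht₁ ht₂).2 l₁ hl₁) (by
      rw [momentum_smul (inv_pos.mpr hl), momentum_smul (inv_pos.mpr hl₁), hback]
      have : momentum a b α t₁ (L - α t₁ - α t₂, -(t₁ + t₂)) =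
        chordMomentum a b L α (t₁, t₂) := rfl
      rw [this, hrefl, neg_neg])
  rw [momentum_smul (inv_pos.mpr hl), momentum_smul (inv_pos.mpr hl₁)] at this
  have e1 : momentum a b α t₁ (L - α t₁ - α t₂, -(t₁ + t₂)) =
    chordMomentum a b L α (t₁, t₂) := rfl
  rw [e1, hrefl] at this
  exact this

/-- The billiard map in terms of chords. -/
theorem billiardMap_eq (h : IsProfile ε α) (ha : 0 < a) (hb : 0 ≤ b) (hab : a + b = 1) {L : ℝ}
    (hL : 0 < L) (hα : 0 < deriv^[2] α 0) {W : ℝ × ℝ → ℝ × ℝ} (hWc : ContinuousAt W 0)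
    (hW0 : W 0 = 0) (hW : ∀ᶠ p in 𝓝 (0 : ℝ × ℝ), chordMap a b L α (W p) = p) :
    ∀ᶠ p in 𝓝 (0 : ℝ × ℝ), billiardMap a b L ε α p = reflectedChordMap a b L α (W p) := by
  obtain ⟨δ, hδ, hstep⟩ := h.reducedStep_chord ha hb hL hα
  have hsmall : ∀ᶠ z in 𝓝 (0 : ℝ × ℝ), |z.1| < min δ ε ∧ |z.2| < min δ ε := by
    filter_upwards [Metric.ball_mem_nhds (0 : ℝ × ℝ) (lt_min hδ h.pos)] with z hz
    rw [mem_ball_zero_iff] at hz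
    exact ⟨(norm_fst_le z).trans_lt hz, (norm_snd_le z).trans_lt hz⟩
  have hWt : Tendsto W (𝓝 0) (𝓝 0) := by
    have := hWc.tendsto
    rwa [hW0] at this
  have hWs := hWt.eventually hsmall
  have hΨ : Tendsto (fun p => reflectedChordMap a b L α (W p)) (𝓝 0) (𝓝 0) := by
    have h1 := (h.smooth_reflectedChordMap ha hb (h.zero_mem_chords hL)).continuousAt.tendsto
    rw [h.reflectedChordMap_zero] at h1
    exact h1.comp hWt
  filter_upwards [hW, hWs, hΨ.eventually (hW.and hWs), h.reducedStep_unique ha hb hab L]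
    with p hp ⟨hz1, hz2⟩ ⟨hq, hq1, hq2⟩ huniq
  set z := W p with hz
  -- The chord attached to the image phase point is the next chord of the orbit. It starts where the
  -- old one ends and satisfies the reflection law, which supplies the third height needed by
  -- `reducedStep_chord`.
  set z' := W (reflectedChordMap a b L α z) with hz'
  have hI : ∀ {s : ℝ}, |s| < min δ ε → s ∈ Ioo (-ε) ε :=
    fun hs => abs_lt.mp (hs.trans_le (min_le_right _ _))
  have hδ' : ∀ {s : ℝ}, |s| < min δ ε → |s| < δ := fun hs => hs.trans_le (min_le_left _ _)
  have e1 : z'.1 = z.2 :=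
    (h.strictMonoOn_arcLength ha hb).injOn (hI hq1) (hI hz2) (congrArg Prod.fst hq)
  have e2 : chordMomentum a b L α z' = -chordMomentum a b L α (z.2, z.1) :=
    congrArg Prod.snd hq
  have hs := hstep z.1 z.2 z'.2 (hδ' hz1) (hδ' hz2) (hδ' hq2) (by
    rw [← e2, ← e1])
  rw [show (z.1, z.2) = z from rfl, hp] at hs
  -- The value chosen by `billiardMap` is a billiard step because one exists, and near the origin
  -- there is only one.
  exact huniq _ _ (Classical.epsilon_spec ⟨_, hs⟩) hs

end IsProfile

/-! ### The twist coefficient of the billiard map -/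

theorem vanishesTo_one_of_differentiableAt {W : ℝ × ℝ → ℝ × ℝ} (hW : DifferentiableAt ℝ W 0)
    (h0 : W 0 = 0) : (VanishesTo 1 fun p => (W p).1) ∧ VanishesTo 1 fun p => (W p).2 := by
  have h1 : W =O[𝓝 0] fun p : ℝ × ℝ => ‖p‖ ^ 1 := by
    have := hW.isBigO_sub.norm_right
    simpa [h0] using this
  have fst_le : (fun p => (W p).1) =O[𝓝 0] W := isBigO_of_le _ fun p => norm_fst_le (W p)
  have snd_le : (fun p => (W p).2) =O[𝓝 0] W := isBigO_of_le _ fun p => norm_snd_le (W p)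
  exact ⟨fst_le.trans h1, snd_le.trans h1⟩

namespace IsProfile

variable {a b ε : ℝ} {α : ℝ → ℝ}

/-- With `Y = t + t₁`, `X = L - α(t) - α(t₁)` and `F(1, m) = 1 + a m²/2 + (2b - a) m⁴/8 + ⋯`, the
chord has length `X + a Y²/(2X) + (2b - a) Y⁴/(8X³) + ⋯`. Substituting `t = s - (a k²/6) s³ + ⋯`
gives the displayed quartic coefficients, and the general formula for the twist coefficient applies.
-/
theorem isFirstTwistCoefficient (h : IsProfile ε α) (ha : 0 < a) (hb : 0 ≤ b) (hab : a + b = 1)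
    {L k q : ℝ} (hL : 0 < L) (hk : k = deriv^[2] α 0) (hq : q = deriv^[4] α 0 / 6) (hk0 : 0 < k)
    (hell : L * k < 2 * a) (hres : L * k ≠ a) :
    IsFirstTwistCoefficient (billiardMap a b L ε α)
      (-(4 / ((a / L) ^ 2 - (a / L - k) ^ 2)) *
        (3 * (a * k ^ 3 / 6 - q / 4 + a * k / (4 * L ^ 2) - a ^ 2 * k ^ 2 / (6 * L) +
          (2 * b - a) / (8 * L ^ 3)) / 4 -
        3 * (a * k / (2 * L ^ 2) - a ^ 2 * k ^ 2 / (6 * L) + (2 * b - a) / (2 * L ^ 3)) *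
          (a / L - k) / (4 * (a / L)) +
        (a * k / (2 * L ^ 2) + 3 * (2 * b - a) / (4 * L ^ 3)) *
          (1 + 2 * (a / L - k) ^ 2 / (a / L) ^ 2) / 8)) := by
  have hB : 0 < a / L := by positivity
  obtain ⟨W, hWs, hW0, hW⟩ := h.exists_chord (b := b) ha hb hL
  have hf := h.billiardMap_eq ha hb hab hL (hk ▸ hk0) hWs.continuousAt hW0 hW
  have hWt : Tendsto W (𝓝 0) (𝓝 0) := by
    have := hWs.continuousAt.tendsto
    rwa [hW0] at this
  have hchord : ∀ᶠ p in 𝓝 (0 : ℝ × ℝ), W p ∈ chords L ε α :=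
    hWt.eventually (h.chords_mem_nhds (h.zero_mem_chords hL))
  obtain ⟨hW1, hW2⟩ := vanishesTo_one_of_differentiableAt (hWs.differentiableAt (by simp)) hW0
  obtain ⟨f1, f2⟩ := jet_of_parametrization (A := a / L - k) (S := arcLength a b α)
    (w := chordMomentum a b L α) (e := a * k ^ 2 / 6)
    (κ := a * k ^ 3 / 6 - q / 4 + a * k / (4 * L ^ 2) - a ^ 2 * k ^ 2 / (6 * L) +
      (2 * b - a) / (8 * L ^ 3))
    (m₁ := a * k / (2 * L ^ 2) - a ^ 2 * k ^ 2 / (6 * L) + (2 * b - a) / (2 * L ^ 3))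
    (m₂ := a * k / (2 * L ^ 2) + 3 * (2 * b - a) / (4 * L ^ 3)) hB.ne'
    (by simpa only [hk] using h.arcLength_jet hab) (by
      refine (h.chordMomentum_jet ha hb hab hL hk hq).congr fun z => ?_
      simp only [cubic]
      field_simp
      ring)
    hW1 hW2 hW hf
  have hfs : ContDiffAt ℝ ∞ (fun p => reflectedChordMap a b L α (W p)) 0 :=
    ContDiffAt.comp (g := reflectedChordMap a b L α) 0
      (by rw [hW0]; exact h.smooth_reflectedChordMap ha hb (h.zero_mem_chords hL)) hWs
  refine isFirstTwistCoefficient_of_jet hB ?_ ?_ (hfs.congr_of_eventuallyEq hf) ?_ ?_ f1 f2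
  -- Ellipticity: `B² - A² = k (2a/L - k)` is positive for `0 < k < 2a/L`.
  · have : k < 2 * a / L := by rwa [lt_div_iff₀ hL, mul_comm]
    have : (a / L) ^ 2 - (a / L - k) ^ 2 = k * (2 * a / L - k) := by ring
    nlinarith
  · rw [sub_ne_zero, ne_eq, div_eq_iff hL.ne']
    intro h0
    exact hres (by linarith)
  · rw [hf.self_of_nhds, hW0, h.reflectedChordMap_zero]
  -- The map is `reflectedChordMap ∘ W`, where `W` is a right inverse of `chordMap`. The two chord
  -- maps have equal determinants at each chord, so the quotient has determinant one.
  · filter_upwards [hf.eventually_nhds, hW.eventually_nhds, hchord,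
      (hWs.of_le (m := 1) (by simp)).eventually (by simp)] with p hfp hWp hz hWsp
    have hWd : DifferentiableAt ℝ W p := hWsp.differentiableAt (by simp)
    have hΦ := (h.smooth_chordMap ha hb hz).differentiableAt (by simp)
    have hΨ := (h.smooth_reflectedChordMap ha hb hz).differentiableAt (by simp)
    have e1 : fderiv ℝ (billiardMap a b L ε α) p =
        (fderiv ℝ (reflectedChordMap a b L α) (W p)).comp (fderiv ℝ W p) := by
      rw [Filter.EventuallyEq.fderiv_eq hfp]
      exact fderiv_comp p hΨ hWd
    have e2 : (fderiv ℝ (chordMap a b L α) (W p)).comp (fderiv ℝ W p) =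
        ContinuousLinearMap.id ℝ (ℝ × ℝ) := by
      rw [← fderiv_comp p hΦ hWd, ← fderiv_id (x := p)]
      exact Filter.EventuallyEq.fderiv_eq hWp
    have e3 := congrArg ContinuousLinearMap.det e2
    rw [det_clm_comp, h.det_chordMap ha hb hz] at e3
    rw [e1, det_clm_comp, h.det_reflectedChordMap ha hb hz, e3]
    simp [ContinuousLinearMap.det]

end IsProfile

end MinkowskiBilliard
end

/-! ### The formula in terms of the radius of curvature -/

theorem theorem4p1 (a b L ε R R'' : ℝ) (α : ℝ → ℝ)
    (ha : 0 < a) (ha1 : a ≤ 1) (hab : a + b = 1)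
    (hε : 0 < ε)
    (hα : ContDiffOn ℝ ∞ α (Set.Ioo (-ε) ε))
    (heven : ∀ t ∈ Set.Ioo (-ε) ε, α (-t) = α t)
    (hα0 : α 0 = 0)
    (hR : R = MinkowskiBilliard.radius a b ε α 0)
    (hR'' : R'' = iteratedDeriv 2 (MinkowskiBilliard.radius a b ε α) 0)
    (hL : 0 < L) (helliptic : L < 2 * a * R) (hnonres : L ≠ a * R) :
    ∀ τ : ℝ,
      MinkowskiBilliard.IsFirstTwistCoefficient (MinkowskiBilliard.billiardMap a b L ε α) τ ↔
        τ = (a ^ 2 * L * R * R'' + (4 - 3 * a) * a * L + 2 * (2 * a - 9) * a * R + 12 * R) /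
          (8 * a ^ 2 * R * (L - 2 * a * R)) := by
  have h : MinkowskiBilliard.IsProfile ε α := ⟨hε, hα, heven, hα0⟩
  have hb : 0 ≤ b := by linarith
  -- The inequalities `0 < L < 2 a R` force `R > 0`. In particular `α''(0) = 0` is excluded, since
  -- division by zero would make the radius `0`.
  have hR0 : 0 < R := by
    have : 0 < 2 * a * R := hL.trans helliptic
    exact pos_of_mul_pos_right this (by positivity)
  rw [h.radius_zero ha hb] at hR
  have hk0 : 0 < deriv^[2] α 0 := by
    rw [hR] at hR0
    exact one_div_pos.mp hR0
  have hk : deriv^[2] α 0 = 1 / R := by rw [hR, one_div_one_div]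
  rw [h.iteratedDeriv_radius ha hb hab hk0.ne'] at hR''
  -- Solve `R'' = 3k - α''''(0)/k²` for the fourth derivative, with `k = 1/R`.
  have hq : deriv^[4] α 0 / 6 = (3 / R - R'') / (6 * R ^ 2) := by
    rw [hR'', hk]
    field_simp
    ring
  have key := h.isFirstTwistCoefficient ha hb hab hL (k := 1 / R) hk.symm hq.symm (by positivity)
    (by rw [mul_one_div, div_lt_iff₀ hR0]; exact helliptic)
    (by rw [mul_one_div, ne_eq, div_eq_iff hR0.ne']; exact hnonres)
  have hb' : b = 1 - a := by linarith
  have hden : (a / L) ^ 2 - (a / L - 1 / R) ^ 2 = -(L - 2 * a * R) / (L * R ^ 2) := by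
    field_simp
    ring
  have hne : L - 2 * a * R ≠ 0 := by linarith
  have hvalue : MinkowskiBilliard.IsFirstTwistCoefficient
      (MinkowskiBilliard.billiardMap a b L ε α)
      ((a ^ 2 * L * R * R'' + (4 - 3 * a) * a * L + 2 * (2 * a - 9) * a * R + 12 * R) /
        (8 * a ^ 2 * R * (L - 2 * a * R))) := by
    convert key using 1
    rw [hden, hb']
    field_simp
    ring
  exact fun τ => ⟨fun hτ => hτ.unique hvalue, fun hτ => hτ ▸ hvalue⟩
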